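/- For a finite set $S$ of points in the plane let $\mathcal P(S)$ be the set of all simple polygons whose vertex set is exactly $S$ (a polygon is the closed region bounded by a simple closed polygonal chain through all points of $S$; three consecutive vertices may be collinear). A point $g\in P$ sees $a\in P$ if the segment $ga$ is contained in $P$. A set $G\subseteq S$ is a guard set for a set $A\subseteq\mathcal P(S)$ if, for every $P\in A$, each point of $P$ is seen, with respect to $P$, by some $g\in G$; let $u(A)$ denote the minimum cardinality of such a set $G$. For $k,n\in\mathbb N$ let $$UG^k(n)=\max_{S\subset\mathbb R^2,\ |S|=n}\ \ \max_{A\subseteq\mathcal P(S),\ |A|=k} u(A)$$ be the $k$-universal guard number for simple polygons, where the maximum over an empty family is $0$ (for $k\in\{4,5\}$ this convention is needed only for $n\le 4$). Then, for every $n\in\mathbb N$, $$UG^5(n)\ \ge\ UG^4(n)\ \ge\ \frac n2-8\sqrt n-23 .$$ -/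

import Mathlib

open scoped ENNReal

namespace UniversalGuards

/-- The Euclidean plane. -/
abbrev Plane : Type := EuclideanSpace ℝ (Fin 2)

/-- A closed polygonal chain `v₀ v₁ … v_{n-1} v₀` is simple if it has at least three vertices, the
vertices are distinct, two consecutive edges meet exactly in their common vertex, and any two other
distinct edges are disjoint. Three consecutive vertices may be collinear. -/
structure IsSimple {n : ℕ} (v : Polygon Plane n) : Prop where
  three_le : 3 ≤ n
  injective : Function.Injective v.vertices
  consecutive : ∀ i : Fin n,
    v.edgeSet ℝ i ∩ v.edgeSet ℝ (finRotate n i) = {v (finRotate n i)}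
  disjoint : ∀ i j : Fin n, j ≠ i → j ≠ finRotate n i → i ≠ finRotate n j →
    Disjoint (v.edgeSet ℝ i) (v.edgeSet ℝ j)

/-- The closed region bounded by a closed polygonal chain: the chain itself together with all
bounded connected components of its complement. For a simple chain the latter is the interior in
the sense of the Jordan curve theorem. -/
def region {n : ℕ} (v : Polygon Plane n) : Set Plane :=
  v.boundary ℝ ∪
    {x | x ∉ v.boundary ℝ ∧ Bornology.IsBounded (connectedComponentIn (v.boundary ℝ)ᶜ x)}

/-- The set of all simple polygons (as closed regions of the plane) whose vertex set is `S`. -/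
def simplePolygons (S : Finset Plane) : Set (Set Plane) :=
  {P | ∃ (n : ℕ) (v : Polygon Plane n),
    IsSimple v ∧ Set.range v.vertices = (S : Set Plane) ∧ P = region v}

/-- `p` sees `q` with respect to `P`. -/
def Sees (P : Set Plane) (p q : Plane) : Prop :=
  segment ℝ p q ⊆ P

/-- The visible region of `g` with respect to `P`. -/
def visibleRegion (P : Set Plane) (g : Plane) : Set Plane :=
  {a | a ∈ P ∧ Sees P g a}

/-- `G` is a guard set for the polygon `P`. -/
def IsGuardSet (G : Finset Plane) (P : Set Plane) : Prop :=
  ⋃ g ∈ G, visibleRegion P g = P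

/-- The minimum cardinality of a set `G ⊆ S` that is a guard set for every polygon in `A`. -/
noncomputable def guardNumber (S : Finset Plane) (A : Set (Set Plane)) : ℕ∞ :=
  ⨅ G ∈ {G : Finset Plane | G ⊆ S ∧ ∀ P ∈ A, IsGuardSet G P}, (G.card : ℕ∞)

/-- The `k`-universal guard number for simple polygons: the maximum of `guardNumber S A` over all
`n`-point sets `S` in the plane and all sets `A` of exactly `k` simple polygons with vertex
set `S`. -/
noncomputable def kUniversalGuardNumber (k n : ℕ) : ℕ∞ :=
  ⨆ S ∈ {S : Finset Plane | S.card = n},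
    ⨆ A ∈ {A : Set (Set Plane) | A ⊆ simplePolygons S ∧ A.encard = k}, guardNumber S A

end UniversalGuards

namespace UniversalGuards

/-! ### Regions bounded by polygonal chains -/

section Polygons

variable {n : ℕ} (v : Polygon Plane n)

/-! Every polygon needed is bimonotone: for linear coordinates `l`, `w` it is bounded by two chains
from a leftmost point `a` to a rightmost point `c`, both monotone in `l`. `BiChain.exists_region`
turns two separated chains into a simple polygon and describes its region by side tests against
chain edges.

Lower bound. Take `k` columns of two points each, four far corners, and one extra point for parity.
For each pair of signs `σ`, `τ` the lower chain zigzags through the columns, in the direction given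
by `σ` and with the orientation given by `τ`, while the upper chain follows two sides of the
bounding rectangle. The tip of a tooth is seen only from itself and the two neighbouring chain
points (`eq_of_sees`). In a block of two adjacent columns the four polygons yield four such triples,
each omitting a different point of the block, so one guard cannot hit them all. This forces `2 * (k
/ 2)` guards, which is at least `(n - 7) / 2` and hence more than is claimed.

Comparison of four and five polygons. A family of four grows by any further polygon on `S` without
needing fewer guards, so the problem is a set `S` with exactly four polygons. Call a point of `S`
inner if no supporting line passes through it. Without inner points the polygon is unique
(`encard_le_one_of_no_inner`), and two inner points give at least five polygons
(`five_le_of_two_inner`), so there is exactly one inner point `p`. At most four points give at most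
three polygons (`encard_le_three`). Otherwise the hull boundary with one edge rerouted through `p`
already gives `S.card - 1` polygons (`le_encard_hullRegions`), so `S.card = 5` and all four polygons
arise in this way. Each of them is star-shaped about `p` (`IsHullRegion.isGuardSet`), so one guard
suffices, and a five-point set with two inner points shows that the five-polygon number is at least
one. -/

lemma edgeSet_eq_segment (i : Fin n) :
    v.edgeSet ℝ i = segment ℝ (v i) (v (finRotate n i)) := by
  rw [Polygon.edgeSet, affineSegment_eq_segment]

lemma mem_boundary {z : Plane} :
    z ∈ v.boundary ℝ ↔ ∃ i, z ∈ segment ℝ (v i) (v (finRotate n i)) := by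
  simp [Polygon.boundary, edgeSet_eq_segment]

lemma segment_subset_region (i : Fin n) :
    segment ℝ (v i) (v (finRotate n i)) ⊆ region v :=
  fun _ hz => Or.inl ((mem_boundary v).2 ⟨i, hz⟩)

variable {v}

lemma region_congr {m : ℕ} {v' : Polygon Plane m} (h : v.boundary ℝ = v'.boundary ℝ) :
    region v = region v' := by
  simp only [region, h]

/-- A ray that avoids the chain keeps `z` in an unbounded component of the complement. -/
lemma notMem_region_of_ray {z d : Plane} (hd : d ≠ 0)
    (h : ∀ t : ℝ, 0 ≤ t → z + t • d ∉ v.boundary ℝ) : z ∉ region v := by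
  have hz : z ∉ v.boundary ℝ := by simpa using h 0 le_rfl
  rintro (hb | ⟨-, hb⟩)
  · exact hz hb
  have hray : (fun t : ℝ => z + t • d) '' Set.Ici 0 ⊆
      connectedComponentIn (v.boundary ℝ)ᶜ z := by
    apply IsPreconnected.subset_connectedComponentIn
    · exact isPreconnected_Ici.image _ (by fun_prop)
    · exact ⟨0, by simp, by simp⟩
    · rintro _ ⟨t, ht, rfl⟩
      exact h t ht
  obtain ⟨C, hC⟩ := (hb.subset hray).exists_norm_le
  have hd' : 0 < ‖d‖ := norm_pos_iff.2 hd
  have h1 := hC (z + ((|C| + ‖z‖ + 1) / ‖d‖) • d) ⟨_, by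
    simp only [Set.mem_Ici]; positivity, rfl⟩
  have h2 : ‖((|C| + ‖z‖ + 1) / ‖d‖) • d‖ = |C| + ‖z‖ + 1 := by
    rw [norm_smul, Real.norm_of_nonneg (by positivity)]
    field_simp
  have h3 := norm_sub_le (z + ((|C| + ‖z‖ + 1) / ‖d‖) • d) z
  rw [add_sub_cancel_left, h2] at h3
  linarith [le_abs_self C]

/-- Off the chain `W` is relatively open and closed, so the component of `z` stays in `W` and is
bounded. This replaces any appeal to the Jordan curve theorem. -/
lemma mem_region_of_isOpen {W : Set Plane} {z : Plane} (hW : IsOpen W)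
    (hb : Bornology.IsBounded W) (hcl : closure W ⊆ W ∪ v.boundary ℝ) (hz : z ∈ W) :
    z ∈ region v := by
  by_cases hzb : z ∈ v.boundary ℝ
  · exact Or.inl hzb
  · refine Or.inr ⟨hzb, hb.subset ?_⟩
    refine isPreconnected_connectedComponentIn.subset_of_closure_inter_subset hW
      ⟨z, mem_connectedComponentIn hzb, hz⟩ ?_
    rintro x ⟨hx, hxc⟩
    rcases hcl hx with h | h
    · exact h
    · exact absurd h (connectedComponentIn_subset _ _ hxc)

lemma finRotate_finRotate_ne (hn : 3 ≤ n) (i : Fin n) : finRotate n (finRotate n i) ≠ i := by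
  obtain ⟨m, rfl⟩ : ∃ m, n = m + 3 := ⟨n - 3, by omega⟩
  intro h
  rw [finRotate_apply, finRotate_apply, add_assoc, add_eq_left] at h
  have := congrArg Fin.val h
  simp [Fin.val_add, Nat.mod_eq_of_lt] at this

lemma finRotate_ne (hn : 3 ≤ n) (i : Fin n) : finRotate n i ≠ i := by
  intro h
  exact finRotate_finRotate_ne hn i (by rw [h, h])

lemma isSimple_of_edges (hn : 3 ≤ n) (hinj : Function.Injective v.vertices)
    (h : ∀ i j, i ≠ j → ∀ z ∈ segment ℝ (v i) (v (finRotate n i)),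
      z ∈ segment ℝ (v j) (v (finRotate n j)) →
      (i = finRotate n j ∧ z = v i) ∨ (j = finRotate n i ∧ z = v j)) : IsSimple v where
  three_le := hn
  injective := hinj
  consecutive i := by
    rw [edgeSet_eq_segment, edgeSet_eq_segment]
    apply Set.Subset.antisymm
    · rintro z ⟨h1, h2⟩
      rcases h i (finRotate n i) (finRotate_ne hn i).symm z h1 h2 with h3 | h3
      · exact absurd h3.1.symm (finRotate_finRotate_ne hn i)
      · exact h3.2
    · rintro z rfl
      exact ⟨right_mem_segment _ _ _, left_mem_segment _ _ _⟩
  disjoint i j hji hj hi := by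
    rw [edgeSet_eq_segment, edgeSet_eq_segment, Set.disjoint_left]
    intro z h1 h2
    rcases h i j hji.symm z h1 h2 with h3 | h3
    · exact hi h3.1
    · exact hj h3.1

end Polygons

lemma exists_strictMono_enum {α : Type*} (S : Finset α) (κ : α → ℝ) (hκ : Set.InjOn κ S) :
    ∃ v : Fin S.card → α, StrictMono (fun i => κ (v i)) ∧ Set.range v = (S : Set α) := by
  classical
  have hcard : (S.image κ).card = S.card := Finset.card_image_of_injOn hκ
  let o := (S.image κ).orderEmbOfFin hcard
  have ho : ∀ i, ∃ s ∈ S, κ s = o i := fun i =>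
    Finset.mem_image.1 (Finset.orderEmbOfFin_mem (S.image κ) hcard i)
  choose v hvS hv using ho
  refine ⟨v, fun i j hij => ?_, ?_⟩
  · simpa only [hv] using o.strictMono hij
  · apply Set.Subset.antisymm
    · rintro _ ⟨i, rfl⟩
      exact hvS i
    · intro s hs
      have : κ s ∈ Set.range o := by
        rw [Finset.range_orderEmbOfFin]
        exact Finset.mem_coe.2 (Finset.mem_image_of_mem _ hs)
      obtain ⟨i, hi⟩ := this
      exact ⟨i, hκ (hvS i) hs (by rw [hv, hi])⟩

/-! ### Frames and bimonotone polygons -/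

/-- Linear coordinates `l`, `w` of the plane together with the dual basis `f`, `e`. -/
structure Frame where
  l : Plane →ₗ[ℝ] ℝ
  w : Plane →ₗ[ℝ] ℝ
  f : Plane
  e : Plane
  decomp : ∀ z, z = l z • f + w z • e
  l_f : l f = 1
  w_f : w f = 0
  l_e : l e = 0
  w_e : w e = 1

namespace Frame

variable (F : Frame)

/-- Positive iff `z` lies above the line from `x` to `y`, provided `l x < l y`. -/
def side (x y z : Plane) : ℝ :=
  (F.l y - F.l x) * (F.w z - F.w x) - (F.l z - F.l x) * (F.w y - F.w x)

lemma ext_coords {x y : Plane} (h1 : F.l x = F.l y) (h2 : F.w x = F.w y) : x = y := by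
  rw [F.decomp x, F.decomp y, h1, h2]

lemma e_ne_zero : F.e ≠ 0 := fun h => by
  have := F.w_e
  simp [h] at this

@[simp] lemma side_left (x y : Plane) : F.side x y x = 0 := by simp [side]
@[simp] lemma side_right (x y : Plane) : F.side x y y = 0 := by simp only [side]; ring

lemma continuous_l : Continuous F.l := F.l.continuous_of_finiteDimensional
lemma continuous_w : Continuous F.w := F.w.continuous_of_finiteDimensional

lemma continuous_side (x y : Plane) : Continuous (F.side x y) := by
  have := F.continuous_l
  have := F.continuous_w
  unfold side
  fun_prop

lemma side_comb (x y p q : Plane) {a b : ℝ} (hab : a + b = 1) :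
    F.side x y (a • p + b • q) = a * F.side x y p + b * F.side x y q := by
  obtain rfl : b = 1 - a := by linarith
  simp only [side, map_add, map_smul, smul_eq_mul]
  ring

/-- Upside-down version of a frame. -/
def flip : Frame where
  l := F.l
  w := -F.w
  f := F.f
  e := -F.e
  decomp z := by
    rw [LinearMap.neg_apply, smul_neg, neg_smul, neg_neg]
    exact F.decomp z
  l_f := F.l_f
  w_f := by simp [F.w_f]
  l_e := by simp [F.l_e]
  w_e := by simp [F.w_e]

@[simp] lemma flip_l : F.flip.l = F.l := rfl
@[simp] lemma flip_w (z : Plane) : F.flip.w z = -F.w z := rfl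

@[simp] lemma flip_side (x y z : Plane) : F.flip.side x y z = -F.side x y z := by
  simp only [side, flip_l, flip_w]
  ring

lemma mem_segment_iff {x y z : Plane} (h : F.l x < F.l y) :
    z ∈ segment ℝ x y ↔ F.l x ≤ F.l z ∧ F.l z ≤ F.l y ∧ F.side x y z = 0 := by
  constructor
  · rintro ⟨a, b, ha, hb, hab, rfl⟩
    obtain rfl : a = 1 - b := by linarith
    refine ⟨?_, ?_, ?_⟩
    · simp only [map_add, map_smul, smul_eq_mul]; nlinarith
    · simp only [map_add, map_smul, smul_eq_mul]; nlinarith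
    · rw [F.side_comb _ _ _ _ hab]; simp
  · rintro ⟨h1, h2, h3⟩
    have hd : 0 < F.l y - F.l x := by linarith
    refine ⟨(F.l y - F.l z) / (F.l y - F.l x), (F.l z - F.l x) / (F.l y - F.l x),
      div_nonneg (by linarith) hd.le, div_nonneg (by linarith) hd.le, by field_simp; ring, ?_⟩
    apply F.ext_coords
    · simp only [map_add, map_smul, smul_eq_mul]
      field_simp
      ring
    · simp only [map_add, map_smul, smul_eq_mul]
      field_simp
      unfold side at h3
      linarith

lemma eq_left_of_level {x y z : Plane} (h : F.l x < F.l y) (hz : z ∈ segment ℝ x y)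
    (hl : F.l z ≤ F.l x) : z = x := by
  obtain ⟨h1, -, h3⟩ := (F.mem_segment_iff h).1 hz
  have h4 : F.l z = F.l x := le_antisymm hl h1
  refine F.ext_coords h4 ?_
  simp only [side, h4, sub_self, zero_mul, sub_zero] at h3
  rcases mul_eq_zero.1 h3 with h5 | h5 <;> linarith

lemma eq_right_of_level {x y z : Plane} (h : F.l x < F.l y) (hz : z ∈ segment ℝ x y)
    (hl : F.l y ≤ F.l z) : z = y := by
  obtain ⟨-, h2, h3⟩ := (F.mem_segment_iff h).1 hz
  have h4 : F.l z = F.l y := le_antisymm h2 hl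
  refine F.ext_coords h4 ?_
  simp only [side, h4] at h3
  have h5 : (F.l y - F.l x) * (F.w z - F.w y) = 0 := by linarith
  rcases mul_eq_zero.1 h5 with h6 | h6 <;> linarith

/-- `x` and `y` are consecutive points of `T` with respect to `l`. -/
structure Consec (T : Set Plane) (x y : Plane) : Prop where
  left_mem : x ∈ T
  right_mem : y ∈ T
  lt : F.l x < F.l y
  gap : ∀ z ∈ T, F.l x < F.l z → F.l y ≤ F.l z

variable {F}

lemma Consec.eq_or {T : Set Plane} (hT : Set.InjOn F.l T) {x y x' y' z : Plane}
    (h : F.Consec T x y) (h' : F.Consec T x' y') (h1 : F.l x ≤ F.l z) (h2 : F.l z ≤ F.l y)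
    (h1' : F.l x' ≤ F.l z) (h2' : F.l z ≤ F.l y') :
    (x = x' ∧ y = y') ∨ (y = x' ∧ F.l z = F.l y) ∨ (y' = x ∧ F.l z = F.l x) := by
  rcases lt_trichotomy (F.l x) (F.l x') with hx | hx | hx
  · have h3 := h.gap x' h'.left_mem hx
    have h4 : F.l y = F.l x' := by linarith
    exact Or.inr (Or.inl ⟨hT h.right_mem h'.left_mem h4, by linarith⟩)
  · have hxx := hT h.left_mem h'.left_mem hx
    subst hxx
    refine Or.inl ⟨rfl, hT h.right_mem h'.right_mem (le_antisymm ?_ ?_)⟩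
    · exact h.gap _ h'.right_mem h'.lt
    · exact h'.gap _ h.right_mem h.lt
  · have h3 := h'.gap x h.left_mem hx
    have h4 : F.l y' = F.l x := by linarith
    exact Or.inr (Or.inr ⟨hT h'.right_mem h.left_mem h4, by linarith⟩)

/-- A single monotone chain does not cross itself, because its edges occupy level intervals that
overlap only at common endpoints. -/
lemma Consec.segment_inter {T : Set Plane} (hT : Set.InjOn F.l T) {x y x' y' z : Plane}
    (h : F.Consec T x y) (h' : F.Consec T x' y') (hz : z ∈ segment ℝ x y)
    (hz' : z ∈ segment ℝ x' y') :
    (x = x' ∧ y = y') ∨ (y = x' ∧ z = y) ∨ (y' = x ∧ z = x) := by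
  obtain ⟨h1, h2, h3⟩ := (F.mem_segment_iff h.lt).1 hz
  obtain ⟨h1', h2', h3'⟩ := (F.mem_segment_iff h'.lt).1 hz'
  rcases h.eq_or hT h' h1 h2 h1' h2' with h4 | h4 | h4
  · exact Or.inl h4
  · exact Or.inr (Or.inl ⟨h4.1, F.eq_right_of_level h.lt hz h4.2.ge⟩)
  · exact Or.inr (Or.inr ⟨h4.1, F.eq_left_of_level h.lt hz h4.2.le⟩)

lemma Consec.eq_right {T : Set Plane} (hT : Set.InjOn F.l T) {x y y' : Plane}
    (h : F.Consec T x y) (h' : F.Consec T x y') : y = y' :=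
  hT h.right_mem h'.right_mem
    (le_antisymm (h.gap _ h'.right_mem h'.lt) (h'.gap _ h.right_mem h.lt))

lemma Consec.eq_left {T : Set Plane} (hT : Set.InjOn F.l T) {x x' y : Plane}
    (h : F.Consec T x y) (h' : F.Consec T x' y) : x = x' := by
  apply hT h.left_mem h'.left_mem
  rcases lt_trichotomy (F.l x) (F.l x') with hx | hx | hx
  · exact absurd (h.gap x' h'.left_mem hx) (not_le.2 h'.lt)
  · exact hx
  · exact absurd (h'.gap x h.left_mem hx) (not_le.2 h.lt)

/-- The successor in a finite set. -/
lemma exists_consec_right {T : Set Plane} (hfin : T.Finite) {x c : Plane} (hx : x ∈ T)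
    (hc : c ∈ T) (h : F.l x < F.l c) : ∃ y, F.Consec T x y := by
  obtain ⟨y, ⟨hyT, hy⟩, hmin⟩ := Set.exists_min_image {y ∈ T | F.l x < F.l y} F.l
    (hfin.subset (Set.sep_subset _ _)) ⟨c, hc, h⟩
  exact ⟨y, hx, hyT, hy, fun z hz hxz => hmin z ⟨hz, hxz⟩⟩

/-- The predecessor in a finite set. -/
lemma exists_consec_left {T : Set Plane} (hfin : T.Finite) {y a : Plane} (hy : y ∈ T)
    (ha : a ∈ T) (h : F.l a < F.l y) : ∃ x, F.Consec T x y := by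
  obtain ⟨x, ⟨hxT, hx⟩, hmax⟩ := Set.exists_max_image {x ∈ T | F.l x < F.l y} F.l
    (hfin.subset (Set.sep_subset _ _)) ⟨a, ha, h⟩
  refine ⟨x, hxT, hy, hx, fun z hz hxz => ?_⟩
  by_contra hlt
  exact absurd (hmax z ⟨hz, not_le.1 hlt⟩) (not_le.2 hxz)

/-- Every level between two points of a finite set is covered by a consecutive pair. -/
lemma exists_consec_level {T : Set Plane} (hfin : T.Finite) {a c : Plane} (ha : a ∈ T)
    (hc : c ∈ T) (hac : F.l a < F.l c) {t : ℝ} (h1 : F.l a ≤ t) (h2 : t ≤ F.l c) :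
    ∃ x y, F.Consec T x y ∧ F.l x ≤ t ∧ t ≤ F.l y := by
  rcases h2.eq_or_lt with rfl | h2
  · obtain ⟨x, hx⟩ := exists_consec_left hfin hc ha hac
    exact ⟨x, c, hx, hx.lt.le, le_rfl⟩
  · obtain ⟨x, ⟨hxT, hx⟩, hmax⟩ := Set.exists_max_image {x ∈ T | F.l x ≤ t} F.l
      (hfin.subset (Set.sep_subset _ _)) ⟨a, ha, h1⟩
    obtain ⟨y, hy⟩ := exists_consec_right hfin hxT hc (hx.trans_lt h2)
    refine ⟨x, y, hy, hx, ?_⟩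
    by_contra hlt
    exact absurd (hmax y ⟨hy.right_mem, (not_le.1 hlt).le⟩) (not_le.2 hy.lt)

end Frame

/-- Data of a polygon consisting of two chains from `a` to `c` that are monotone with respect to
`l`: the upper chain runs through `U`, the lower chain through the remaining points. -/
structure BiChain (F : Frame) (S : Finset Plane) (U : Set Plane) (a c : Plane) : Prop where
  ha : a ∈ S
  hc : c ∈ S
  subset : U ⊆ S
  ha' : a ∉ U
  hc' : c ∉ U
  inj : Set.InjOn F.l S
  a_min : ∀ s ∈ S, F.l a ≤ F.l s
  c_max : ∀ s ∈ S, F.l s ≤ F.l c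
  card : 3 ≤ S.card
  sep : ∀ x y x' y' z z', F.Consec (S \ U) x y → F.Consec (U ∪ {a, c}) x' y' →
    z ∈ segment ℝ x y → z' ∈ segment ℝ x' y' → F.l z = F.l z' → F.l a < F.l z →
    F.l z < F.l c → F.w z < F.w z'

/-- Membership criteria for the region bounded by a bimonotone polygon. -/
structure IsRegionOf (F : Frame) (S : Finset Plane) (U : Set Plane) (a c : Plane)
    (P : Set Plane) : Prop where
  mem : P ∈ simplePolygons S
  low : ∀ x y, F.Consec (S \ U) x y → segment ℝ x y ⊆ P
  up : ∀ x y, F.Consec (U ∪ {a, c}) x y → segment ℝ x y ⊆ P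
  below : ∀ x y z, F.Consec (S \ U) x y → F.l x ≤ F.l z → F.l z ≤ F.l y →
    F.side x y z < 0 → z ∉ P
  above : ∀ x y z, F.Consec (U ∪ {a, c}) x y → F.l x ≤ F.l z → F.l z ≤ F.l y →
    0 < F.side x y z → z ∉ P
  level : ∀ z ∈ P, F.l a ≤ F.l z ∧ F.l z ≤ F.l c
  between : ∀ x y x' y' z, F.Consec (S \ U) x y → F.Consec (U ∪ {a, c}) x' y' →
    F.l x ≤ F.l z → F.l z ≤ F.l y → F.l x' ≤ F.l z → F.l z ≤ F.l y' →
    0 ≤ F.side x y z → F.side x' y' z ≤ 0 → z ∈ P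

namespace BiChain

variable {F : Frame} {S : Finset Plane} {U : Set Plane} {a c : Plane}

lemma upper_subset (h : BiChain F S U a c) : U ∪ {a, c} ⊆ (S : Set Plane) := by
  rintro x (hx | rfl | rfl)
  exacts [h.subset hx, h.ha, h.hc]

lemma inj_low (h : BiChain F S U a c) : Set.InjOn F.l ((S : Set Plane) \ U) :=
  h.inj.mono Set.sdiff_subset

lemma inj_up (h : BiChain F S U a c) : Set.InjOn F.l (U ∪ {a, c}) :=
  h.inj.mono h.upper_subset

lemma lt_c (h : BiChain F S U a c) {s : Plane} (hs : s ∈ U) : F.l s < F.l c :=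
  lt_of_le_of_ne (h.c_max s (h.subset hs)) fun heq =>
    h.hc' (h.inj (h.subset hs) h.hc heq ▸ hs)

lemma a_lt (h : BiChain F S U a c) {s : Plane} (hs : s ∈ U) : F.l a < F.l s :=
  lt_of_le_of_ne (h.a_min s (h.subset hs)) fun heq =>
    h.ha' (h.inj h.ha (h.subset hs) heq ▸ hs)

lemma lt (h : BiChain F S U a c) : F.l a < F.l c := by
  refine lt_of_le_of_ne (h.a_min c h.hc) fun heq => ?_
  have hS : S ⊆ {a} := fun s hs => by
    rw [Finset.mem_singleton]
    exact h.inj hs h.ha (le_antisymm (heq ▸ h.c_max s hs) (h.a_min s hs))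
  have := (Finset.card_le_card hS).trans (Finset.card_singleton a).le
  have := h.card
  omega

lemma exists_low (h : BiChain F S U a c) {t : ℝ} (h1 : F.l a ≤ t) (h2 : t ≤ F.l c) :
    ∃ x y, F.Consec (S \ U) x y ∧ F.l x ≤ t ∧ t ≤ F.l y :=
  Frame.exists_consec_level (S.finite_toSet.subset Set.sdiff_subset) ⟨h.ha, h.ha'⟩ ⟨h.hc, h.hc'⟩
    h.lt h1 h2

lemma exists_up (h : BiChain F S U a c) {t : ℝ} (h1 : F.l a ≤ t) (h2 : t ≤ F.l c) :
    ∃ x y, F.Consec (U ∪ {a, c}) x y ∧ F.l x ≤ t ∧ t ≤ F.l y :=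
  Frame.exists_consec_level (S.finite_toSet.subset h.upper_subset) (by simp) (by simp)
    h.lt h1 h2

/-- A cyclic enumeration of the points along the two chains. -/
lemma exists_polygon (h : BiChain F S U a c) :
    ∃ v : Polygon Plane S.card, Function.Injective v.vertices ∧
      Set.range v.vertices = (S : Set Plane) ∧ ∀ i,
      F.Consec (S \ U) (v i) (v (finRotate _ i)) ∨
      F.Consec (U ∪ {a, c}) (v (finRotate _ i)) (v i) := by
  classical
  -- Reflecting the levels of upper points at `F.l c` makes their keys exceed all lower keys.
  -- Sorting by `κ` runs along the lower chain from `a` to `c` and back along the upper chain.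
  let κ : Plane → ℝ := fun s => if s ∈ U then 2 * F.l c - F.l s else F.l s
  have κU : ∀ s, s ∈ U → κ s = 2 * F.l c - F.l s := fun s hs => if_pos hs
  have κL : ∀ s, s ∉ U → κ s = F.l s := fun s hs => if_neg hs
  have κgt : ∀ s, s ∈ U → F.l c < κ s := fun s hs => by
    rw [κU s hs]
    linarith [h.lt_c hs]
  have κle : ∀ s ∈ S, s ∉ U → κ s ≤ F.l c := fun s hs hsU => by
    rw [κL s hsU]
    exact h.c_max s hs
  have κc : κ c = F.l c := κL c h.hc'
  have κa : κ a = F.l a := κL a h.ha'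
  have hinj : Set.InjOn κ S := by
    intro s hs t ht hst
    by_cases hsU : s ∈ U <;> by_cases htU : t ∈ U
    · rw [κU s hsU, κU t htU] at hst
      exact h.inj hs ht (by linarith)
    · linarith [κgt s hsU, κle t ht htU]
    · linarith [κgt t htU, κle s hs hsU]
    · rw [κL s hsU, κL t htU] at hst
      exact h.inj hs ht hst
  obtain ⟨v, hv, hrange⟩ := exists_strictMono_enum S κ hinj
  have hvS : ∀ i, v i ∈ S := fun i => by
    rw [← Finset.mem_coe, ← hrange]
    exact ⟨i, rfl⟩
  have hex : ∀ s ∈ S, ∃ i, v i = s := fun s hs => by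
    rwa [← Finset.mem_coe, ← hrange] at hs
  refine ⟨⟨v⟩, fun i j hij => hv.injective (by simpa using congrArg κ hij), hrange, fun i => ?_⟩
  obtain ⟨m, hm⟩ : ∃ m, S.card = m + 1 := ⟨S.card - 1, by have := h.card; omega⟩
  generalize S.card = N at *
  subst hm
  rcases eq_or_ne i (Fin.last m) with rfl | hi
  · rw [finRotate_last]
    have h0 : v 0 = a := by
      obtain ⟨j, hj⟩ := hex a h.ha
      have h1 : κ (v 0) ≤ κ a := hj ▸ hv.monotone (Fin.zero_le j)
      have h2 : v 0 ∉ U := fun hU => by linarith [κgt _ hU, h.lt]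
      rw [κL _ h2, κa] at h1
      exact h.inj (hvS 0) h.ha (le_antisymm h1 (h.a_min _ (hvS 0)))
    have hlast : ∀ s ∈ S, κ s ≤ κ (v (Fin.last m)) := fun s hs => by
      obtain ⟨j, rfl⟩ := hex s hs
      exact hv.monotone (Fin.le_last j)
    right
    change F.Consec _ (v 0) (v (Fin.last m))
    rw [h0]
    -- The closing edge is the first edge of the upper chain. If the last vertex is not in `U`, the
    -- upper chain is just the segment from `a` to `c`.
    by_cases hU : v (Fin.last m) ∈ U
    · refine ⟨by simp, Or.inl hU, h.a_lt hU, ?_⟩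
      rintro z (hz | rfl | rfl) hlt
      · have := hlast z (h.subset hz)
        rw [κU z hz, κU _ hU] at this
        linarith
      · exact absurd hlt (lt_irrefl _)
      · exact h.c_max _ (hvS _)
    · have h1 := hlast c h.hc
      rw [κc, κL _ hU] at h1
      have hlc : v (Fin.last m) = c :=
        h.inj (hvS _) h.hc (le_antisymm (h.c_max _ (hvS _)) h1)
      rw [hlc]
      refine ⟨by simp, by simp, h.lt, ?_⟩
      rintro z (hz | rfl | rfl) hlt
      · have := hlast z (h.subset hz)
        rw [hlc, κc] at this
        linarith [κgt z hz]
      · exact absurd hlt (lt_irrefl _)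
      · exact le_rfl
  · have hlt : i.val < m := lt_of_le_of_ne (Nat.lt_succ_iff.1 i.isLt)
      fun hne => hi (Fin.ext hne)
    have hrot : (finRotate (m + 1) i).val = i.val + 1 := by
      rw [coe_finRotate_of_ne_last hi]
    generalize finRotate (m + 1) i = j at hrot
    have hij : κ (v i) < κ (v j) := hv (Fin.lt_def.2 (by omega))
    have hgap : ∀ s ∈ S, κ (v i) < κ s → κ (v j) ≤ κ s := fun s hs hlt => by
      obtain ⟨k, rfl⟩ := hex s hs
      have : i < k := by
        by_contra hle
        exact absurd (hv.monotone (not_lt.1 hle)) (not_le.2 hlt)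
      exact hv.monotone (Fin.le_def.2 (by have := Fin.lt_def.1 this; omega))
    change F.Consec _ (v i) (v j) ∨ F.Consec _ (v j) (v i)
    by_cases hjU : v j ∈ U
    · right
      by_cases hiU : v i ∈ U
      · rw [κU _ hiU, κU _ hjU] at hij
        refine ⟨Or.inl hjU, Or.inl hiU, by linarith, ?_⟩
        rintro z (hz | rfl | rfl) hz'
        · by_contra hzi
          have := hgap z (h.subset hz) (by rw [κU _ hiU, κU _ hz]; linarith)
          rw [κU _ hz, κU _ hjU] at this
          linarith
        · exact absurd hz' (not_lt.2 (h.a_min _ (hvS _)))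
        · exact h.c_max _ (hvS _)
      · have hic : v i = c := by
          apply h.inj (hvS i) h.hc
          rcases (κle _ (hvS i) hiU).eq_or_lt with heq | hlt'
          · rwa [κL _ hiU] at heq
          · have := hgap c h.hc (κc ▸ hlt')
            linarith [κgt _ hjU]
        rw [hic]
        refine ⟨Or.inl hjU, by simp, h.lt_c hjU, ?_⟩
        rintro z (hz | rfl | rfl) hz'
        · have := hgap z (h.subset hz) (by rw [hic, κc]; exact κgt z hz)
          rw [κU _ hz, κU _ hjU] at this
          linarith
        · exact absurd hz' (not_lt.2 (h.a_min _ (hvS _)))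
        · exact le_rfl
    · left
      have hiU : v i ∉ U := fun hiU => by linarith [κgt _ hiU, κle _ (hvS j) hjU]
      rw [κL _ hiU, κL _ hjU] at hij
      refine ⟨⟨hvS _, hiU⟩, ⟨hvS _, hjU⟩, hij, fun z hz hz' => ?_⟩
      have := hgap z hz.1 (by rwa [κL _ hiU, κL _ hz.2])
      rwa [κL _ hjU, κL _ hz.2] at this

/-- At intermediate levels `sep` keeps the chains strictly apart, so they can meet only at the
extreme levels, where both edges have an endpoint. -/
lemma eq_a_or_eq_c (h : BiChain F S U a c) {x y x' y' z : Plane}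
    (hl : F.Consec (S \ U) x y) (hu : F.Consec (U ∪ {a, c}) x' y') (hz : z ∈ segment ℝ x y)
    (hz' : z ∈ segment ℝ x' y') : (x = x' ∧ z = x) ∨ (y = y' ∧ z = y) := by
  have hax := h.a_min x hl.left_mem.1
  have hax' := h.a_min x' (h.upper_subset hu.left_mem)
  have hcy := h.c_max y hl.right_mem.1
  have hcy' := h.c_max y' (h.upper_subset hu.right_mem)
  by_cases h1 : F.l a < F.l z
  · by_cases h2 : F.l z < F.l c
    · exact absurd (h.sep x y x' y' z z hl hu hz hz' rfl h1 h2) (lt_irrefl _)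
    · have h3 := F.eq_right_of_level hl.lt hz (by linarith)
      have h4 := F.eq_right_of_level hu.lt hz' (by linarith)
      exact Or.inr ⟨h3.symm.trans h4, h3⟩
  · have h3 := F.eq_left_of_level hl.lt hz (by linarith)
    have h4 := F.eq_left_of_level hu.lt hz' (by linarith)
    exact Or.inl ⟨h3.symm.trans h4, h3⟩

end BiChain

/-! ### Vertical comparison of points with chains. -/

namespace Frame

variable (F : Frame)

lemma l_add_e (z : Plane) (t : ℝ) : F.l (z + t • F.e) = F.l z := by simp [F.l_e]
lemma w_add_e (z : Plane) (t : ℝ) : F.w (z + t • F.e) = F.w z + t := by simp [F.w_e]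

/-- The point `z₀` is the vertical projection of `z` to the segment. The formula turns signs of
`side` into comparisons of heights. -/
lemma exists_mem_segment_level {x y z : Plane} (h : F.l x < F.l y) (h1 : F.l x ≤ F.l z)
    (h2 : F.l z ≤ F.l y) : ∃ z₀ ∈ segment ℝ x y, F.l z₀ = F.l z ∧
      F.side x y z = (F.l y - F.l x) * (F.w z - F.w z₀) := by
  have hd : 0 < F.l y - F.l x := by linarith
  refine ⟨z + (-(F.side x y z / (F.l y - F.l x))) • F.e, ?_, F.l_add_e _ _, ?_⟩
  · rw [F.mem_segment_iff h, F.l_add_e]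
    refine ⟨h1, h2, ?_⟩
    simp only [side, F.l_add_e, F.w_add_e]
    field_simp
    ring
  · rw [F.w_add_e]
    field_simp
    ring

lemma mem_segment_vertical {x y z : Plane} (h1 : F.l x = F.l z) (h2 : F.l y = F.l z)
    (h3 : F.w x ≤ F.w z) (h4 : F.w z ≤ F.w y) : z ∈ segment ℝ x y := by
  rcases (h3.trans h4).eq_or_lt with h | h
  · rw [F.ext_coords h1 (by linarith)]
    exact left_mem_segment _ _ _
  · have hd : 0 < F.w y - F.w x := by linarith
    refine ⟨(F.w y - F.w z) / (F.w y - F.w x), (F.w z - F.w x) / (F.w y - F.w x),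
      div_nonneg (by linarith) hd.le, div_nonneg (by linarith) hd.le, by field_simp; ring, ?_⟩
    apply F.ext_coords
    · simp only [map_add, map_smul, smul_eq_mul, h1, h2]
      field_simp
      ring
    · simp only [map_add, map_smul, smul_eq_mul]
      field_simp
      ring

variable {F}

lemma Consec.eq_of_level {T : Set Plane} (hT : Set.InjOn F.l T) {x y x' y' z z' : Plane}
    (h : F.Consec T x y) (h' : F.Consec T x' y') (hz : z ∈ segment ℝ x y)
    (hz' : z' ∈ segment ℝ x' y') (hl : F.l z = F.l z') : z = z' := by
  obtain ⟨h1, h2, h3⟩ := (F.mem_segment_iff h.lt).1 hz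
  obtain ⟨h1', h2', h3'⟩ := (F.mem_segment_iff h'.lt).1 hz'
  rcases h.eq_or hT h' h1 h2 (hl ▸ h1') (hl ▸ h2') with ⟨rfl, rfl⟩ | ⟨rfl, h4⟩ | ⟨rfl, h4⟩
  · have := h.lt
    refine F.ext_coords hl ?_
    simp only [side, hl] at h3 h3'
    nlinarith
  · rw [F.eq_right_of_level h.lt hz h4.ge, F.eq_left_of_level h'.lt hz' (by linarith)]
  · rw [F.eq_left_of_level h.lt hz h4.le, F.eq_right_of_level h'.lt hz' (by linarith)]

/-- The relative position of a point and a chain does not depend on the chosen edge. -/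
lemma Consec.side_pos_iff {T : Set Plane} (hT : Set.InjOn F.l T) {x y x' y' z : Plane}
    (h : F.Consec T x y) (h' : F.Consec T x' y') (h1 : F.l x ≤ F.l z) (h2 : F.l z ≤ F.l y)
    (h1' : F.l x' ≤ F.l z) (h2' : F.l z ≤ F.l y') :
    (0 < F.side x y z ↔ 0 < F.side x' y' z) ∧ (F.side x y z < 0 ↔ F.side x' y' z < 0) := by
  obtain ⟨z₀, hz₀, hl, hs⟩ := F.exists_mem_segment_level h.lt h1 h2
  obtain ⟨z₁, hz₁, hl', hs'⟩ := F.exists_mem_segment_level h'.lt h1' h2'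
  obtain rfl := h.eq_of_level hT h' hz₀ hz₁ (hl.trans hl'.symm)
  rw [hs, hs']
  have := sub_pos.2 h.lt
  have := sub_pos.2 h'.lt
  constructor
  · rw [mul_pos_iff_of_pos_left, mul_pos_iff_of_pos_left] <;> assumption
  · rw [← smul_eq_mul, ← smul_eq_mul, smul_neg_iff_of_pos_left, smul_neg_iff_of_pos_left] <;>
      assumption

end Frame

/-! ### Construction of the region between two chains. -/

namespace BiChain

variable {F : Frame} {S : Finset Plane} {U : Set Plane} {a c : Plane}

lemma eq_a_of_low (h : BiChain F S U a c) {x y z : Plane} (hl : F.Consec (S \ U) x y)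
    (hz : z ∈ segment ℝ x y) (hza : F.l z ≤ F.l a) : z = a := by
  have h1 := F.eq_left_of_level hl.lt hz (hza.trans (h.a_min x hl.left_mem.1))
  subst h1
  exact h.inj hl.left_mem.1 h.ha (le_antisymm hza (h.a_min _ hl.left_mem.1))

lemma eq_c_of_low (h : BiChain F S U a c) {x y z : Plane} (hl : F.Consec (S \ U) x y)
    (hz : z ∈ segment ℝ x y) (hzc : F.l c ≤ F.l z) : z = c := by
  have h1 := F.eq_right_of_level hl.lt hz ((h.c_max y hl.right_mem.1).trans hzc)
  subst h1
  exact h.inj hl.right_mem.1 h.hc (le_antisymm (h.c_max _ hl.right_mem.1) hzc)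

lemma eq_a_of_up (h : BiChain F S U a c) {x y z : Plane} (hl : F.Consec (U ∪ {a, c}) x y)
    (hz : z ∈ segment ℝ x y) (hza : F.l z ≤ F.l a) : z = a := by
  have hx := h.upper_subset hl.left_mem
  have h1 := F.eq_left_of_level hl.lt hz (hza.trans (h.a_min x hx))
  subst h1
  exact h.inj hx h.ha (le_antisymm hza (h.a_min _ hx))

lemma eq_c_of_up (h : BiChain F S U a c) {x y z : Plane} (hl : F.Consec (U ∪ {a, c}) x y)
    (hz : z ∈ segment ℝ x y) (hzc : F.l c ≤ F.l z) : z = c := by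
  have hy := h.upper_subset hl.right_mem
  have h1 := F.eq_right_of_level hl.lt hz ((h.c_max y hy).trans hzc)
  subst h1
  exact h.inj hy h.hc (le_antisymm (h.c_max _ hy) hzc)

lemma w_le (h : BiChain F S U a c) {x y x' y' z z' : Plane} (hl : F.Consec (S \ U) x y)
    (hu : F.Consec (U ∪ {a, c}) x' y') (hz : z ∈ segment ℝ x y) (hz' : z' ∈ segment ℝ x' y')
    (hlev : F.l z = F.l z') : F.w z ≤ F.w z' := by
  by_cases h1 : F.l a < F.l z
  · by_cases h2 : F.l z < F.l c
    · exact (h.sep x y x' y' z z' hl hu hz hz' hlev h1 h2).le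
    · rw [h.eq_c_of_low hl hz (not_lt.1 h2), h.eq_c_of_up hu hz' (hlev ▸ not_lt.1 h2)]
  · rw [h.eq_a_of_low hl hz (not_lt.1 h1), h.eq_a_of_up hu hz' (hlev ▸ not_lt.1 h1)]

lemma segment_subset_convexHull_low {x y : Plane} (hl : F.Consec (S \ U) x y) :
    segment ℝ x y ⊆ convexHull ℝ (S : Set Plane) :=
  segment_subset_convexHull hl.left_mem.1 hl.right_mem.1

lemma segment_subset_convexHull_up (h : BiChain F S U a c) {x y : Plane}
    (hl : F.Consec (U ∪ {a, c}) x y) : segment ℝ x y ⊆ convexHull ℝ (S : Set Plane) :=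
  segment_subset_convexHull (h.upper_subset hl.left_mem) (h.upper_subset hl.right_mem)

lemma mem_convexHull (h : BiChain F S U a c) {x y x' y' z : Plane} (hl : F.Consec (S \ U) x y)
    (hu : F.Consec (U ∪ {a, c}) x' y') (h1 : F.l x ≤ F.l z) (h2 : F.l z ≤ F.l y)
    (h1' : F.l x' ≤ F.l z) (h2' : F.l z ≤ F.l y') (hs : 0 ≤ F.side x y z)
    (hs' : F.side x' y' z ≤ 0) : z ∈ convexHull ℝ (S : Set Plane) := by
  obtain ⟨z₀, hz₀, hl₀, hs₀⟩ := F.exists_mem_segment_level hl.lt h1 h2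
  obtain ⟨z₁, hz₁, hl₁, hs₁⟩ := F.exists_mem_segment_level hu.lt h1' h2'
  have := sub_pos.2 hl.lt
  have := sub_pos.2 hu.lt
  refine (convex_convexHull ℝ _).segment_subset (segment_subset_convexHull_low hl hz₀)
    (h.segment_subset_convexHull_up hu hz₁) (F.mem_segment_vertical hl₀ hl₁ ?_ ?_)
  · by_contra hlt
    nlinarith
  · by_contra hlt
    nlinarith

/-- The polygon formed by two separated monotone chains. -/
theorem exists_region (h : BiChain F S U a c) : ∃ P, IsRegionOf F S U a c P := by
  obtain ⟨v, hinj, hrange, hedge⟩ := h.exists_polygon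
  have hsimple : IsSimple v := by
    refine isSimple_of_edges h.card hinj fun i j hij z hz hz' => ?_
    rcases hedge i with hi | hi <;> rcases hedge j with hj | hj
    · rcases hi.segment_inter h.inj_low hj hz hz' with h1 | h1 | h1
      · exact absurd (hinj h1.1) hij
      · exact Or.inr ⟨(hinj h1.1).symm, h1.2.trans h1.1⟩
      · exact Or.inl ⟨(hinj h1.1).symm, h1.2⟩
    · rw [segment_symm] at hz'
      rcases h.eq_a_or_eq_c hi hj hz hz' with h1 | h1
      · exact Or.inl ⟨hinj h1.1, h1.2⟩
      · exact Or.inr ⟨(hinj h1.1).symm, h1.2.trans h1.1⟩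
    · rw [segment_symm] at hz
      rcases h.eq_a_or_eq_c hj hi hz' hz with h1 | h1
      · exact Or.inr ⟨hinj h1.1, h1.2⟩
      · exact Or.inl ⟨(hinj h1.1).symm, h1.2.trans h1.1⟩
    · rw [segment_symm] at hz hz'
      rcases hi.segment_inter h.inj_up hj hz hz' with h1 | h1 | h1
      · exact absurd (hinj h1.2) hij
      · exact Or.inl ⟨hinj h1.1, h1.2⟩
      · exact Or.inr ⟨hinj h1.1, h1.2.trans h1.1.symm⟩
  have hex : ∀ s ∈ S, ∃ i, v i = s := fun s hs => by
    rwa [← Finset.mem_coe, ← hrange] at hs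
  have hlow : ∀ x y, F.Consec (S \ U) x y → segment ℝ x y ⊆ v.boundary ℝ := by
    intro x y hxy z hz
    obtain ⟨i, rfl⟩ := hex x hxy.left_mem.1
    refine (mem_boundary v).2 ⟨i, ?_⟩
    rcases hedge i with hi | hi
    · rwa [← hxy.eq_right h.inj_low hi]
    · exfalso
      rcases hi.right_mem with h1 | h1 | h1
      · exact hxy.left_mem.2 h1
      · exact absurd hi.lt (not_lt.2 (h1 ▸ h.a_min _ (h.upper_subset hi.left_mem)))
      · exact absurd hxy.lt (not_lt.2 (h1 ▸ h.c_max _ hxy.right_mem.1))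
  have hup : ∀ x y, F.Consec (U ∪ {a, c}) x y → segment ℝ x y ⊆ v.boundary ℝ := by
    intro x y hxy z hz
    obtain ⟨i, rfl⟩ := hex y (h.upper_subset hxy.right_mem)
    refine (mem_boundary v).2 ⟨i, ?_⟩
    rcases hedge i with hi | hi
    · exfalso
      rcases hxy.right_mem with h1 | h1 | h1
      · exact hi.left_mem.2 h1
      · exact absurd hxy.lt (not_lt.2 (h1 ▸ h.a_min _ (h.upper_subset hxy.left_mem)))
      · exact absurd hi.lt (not_lt.2 (h1 ▸ h.c_max _ hi.right_mem.1))
    · rwa [segment_symm, ← hxy.eq_left h.inj_up hi]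
  have hbd : ∀ z ∈ v.boundary ℝ, (∃ x y, F.Consec (S \ U) x y ∧ z ∈ segment ℝ x y) ∨
      ∃ x y, F.Consec (U ∪ {a, c}) x y ∧ z ∈ segment ℝ x y := by
    intro z hz
    obtain ⟨i, hi⟩ := (mem_boundary v).1 hz
    rcases hedge i with h1 | h1
    · exact Or.inl ⟨_, _, h1, hi⟩
    · exact Or.inr ⟨_, _, h1, segment_symm ℝ (v i) _ ▸ hi⟩
  have hlevel : ∀ z ∈ region v, F.l a ≤ F.l z ∧ F.l z ≤ F.l c := by
    intro z hz
    by_contra hcon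
    refine notMem_region_of_ray F.e_ne_zero (fun t _ ht => hcon ?_) hz
    rcases hbd _ ht with ⟨x, y, hxy, hm⟩ | ⟨x, y, hxy, hm⟩
    · have := (F.mem_segment_iff hxy.lt).1 hm
      rw [F.l_add_e] at this
      exact ⟨(h.a_min _ hxy.left_mem.1).trans this.1,
        this.2.1.trans (h.c_max _ hxy.right_mem.1)⟩
    · have := (F.mem_segment_iff hxy.lt).1 hm
      rw [F.l_add_e] at this
      exact ⟨(h.a_min _ (h.upper_subset hxy.left_mem)).trans this.1,
        this.2.1.trans (h.c_max _ (h.upper_subset hxy.right_mem))⟩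
  refine ⟨region v, ⟨_, v, hsimple, hrange, rfl⟩, fun x y hxy => (hlow x y hxy).trans fun _ =>
    Or.inl, fun x y hxy => (hup x y hxy).trans fun _ => Or.inl, ?_, ?_, hlevel, ?_⟩
  · intro x y z hxy h1 h2 hs
    obtain ⟨z₀, hz₀, hl₀, hs₀⟩ := F.exists_mem_segment_level hxy.lt h1 h2
    have hlt := sub_pos.2 hxy.lt
    have hw : F.w z < F.w z₀ := by
      by_contra hle
      nlinarith
    refine notMem_region_of_ray (neg_ne_zero.2 F.e_ne_zero) fun t ht hm => ?_
    rw [smul_neg, ← neg_smul] at hm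
    rcases hbd _ hm with ⟨x', y', hxy', hm'⟩ | ⟨x', y', hxy', hm'⟩
    · have := hxy.eq_of_level h.inj_low hxy' hz₀ hm' (by rw [F.l_add_e, hl₀])
      rw [this, F.w_add_e] at hw
      linarith
    · have := h.w_le hxy hxy' hz₀ hm' (by rw [F.l_add_e, hl₀])
      rw [F.w_add_e] at this
      linarith
  · intro x y z hxy h1 h2 hs
    obtain ⟨z₀, hz₀, hl₀, hs₀⟩ := F.exists_mem_segment_level hxy.lt h1 h2
    have hlt := sub_pos.2 hxy.lt
    have hw : F.w z₀ < F.w z := by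
      by_contra hle
      nlinarith
    refine notMem_region_of_ray F.e_ne_zero fun t ht hm => ?_
    rcases hbd _ hm with ⟨x', y', hxy', hm'⟩ | ⟨x', y', hxy', hm'⟩
    · have := h.w_le hxy' hxy hm' hz₀ (by rw [F.l_add_e, hl₀])
      rw [F.w_add_e] at this
      linarith
    · have := hxy.eq_of_level h.inj_up hxy' hz₀ hm' (by rw [F.l_add_e, hl₀])
      rw [this, F.w_add_e] at hw
      linarith
  · intro x y x' y' z hxy hxy' h1 h2 h1' h2' hs hs'
    have hbr : ∀ {s : Set Plane}, s ⊆ v.boundary ℝ → z ∈ s → z ∈ region v :=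
      fun hs hz => Or.inl (hs hz)
    rcases hs.eq_or_lt with hs | hs
    · exact hbr (hlow x y hxy) ((F.mem_segment_iff hxy.lt).2 ⟨h1, h2, hs.symm⟩)
    rcases hs'.eq_or_lt with hs' | hs'
    · exact hbr (hup x' y' hxy') ((F.mem_segment_iff hxy'.lt).2 ⟨h1', h2', hs'⟩)
    have pairs_fin : ∀ T : Set Plane, T ⊆ S → {q : Plane × Plane | F.Consec T q.1 q.2}.Finite :=
      fun T hT => ((S.finite_toSet.subset hT).prod (S.finite_toSet.subset hT)).subset
        fun q hq => ⟨hq.left_mem, hq.right_mem⟩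
    have hLfin := pairs_fin (S \ U) Set.sdiff_subset
    have hUfin := pairs_fin (U ∪ {a, c}) h.upper_subset
    have closed_up : ∀ p q : Plane, IsClosed {z | F.l p ≤ F.l z ∧ F.l z ≤ F.l q ∧
        0 ≤ F.side p q z} := fun p q =>
      (isClosed_le continuous_const F.continuous_l).inter
        ((isClosed_le F.continuous_l continuous_const).inter
          (isClosed_le continuous_const (F.continuous_side p q)))
    have closed_down : ∀ p q : Plane, IsClosed {z | F.l p ≤ F.l z ∧ F.l z ≤ F.l q ∧
        F.side p q z ≤ 0} := fun p q =>
      (isClosed_le continuous_const F.continuous_l).inter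
        ((isClosed_le F.continuous_l continuous_const).inter
          (isClosed_le (F.continuous_side p q) continuous_const))
    -- The candidate interior is written as the complement of finitely many closed pieces, on or
    -- below a lower edge and on or above an upper edge, so that it is visibly open.
    let W : Set Plane := ({z | F.l a < F.l z} ∩ {z | F.l z < F.l c}) ∩
      ((⋃ q ∈ {q : Plane × Plane | F.Consec (S \ U) q.1 q.2},
          {z | F.l q.1 ≤ F.l z ∧ F.l z ≤ F.l q.2 ∧ F.side q.1 q.2 z ≤ 0}) ∪
        ⋃ q ∈ {q : Plane × Plane | F.Consec (U ∪ {a, c}) q.1 q.2},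
          {z | F.l q.1 ≤ F.l z ∧ F.l z ≤ F.l q.2 ∧ 0 ≤ F.side q.1 q.2 z})ᶜ
    have memW : ∀ z, z ∈ W ↔ (F.l a < F.l z ∧ F.l z < F.l c) ∧
        (∀ x y, F.Consec (S \ U) x y → F.l x ≤ F.l z → F.l z ≤ F.l y → 0 < F.side x y z) ∧
        (∀ x y, F.Consec (U ∪ {a, c}) x y → F.l x ≤ F.l z → F.l z ≤ F.l y →
          F.side x y z < 0) := by
      intro z
      simp only [W, Set.mem_inter_iff, Set.mem_compl_iff, Set.mem_union, Set.mem_iUnion,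
        Set.mem_ofPred_eq, not_or, not_exists, Prod.forall, not_and, not_le, exists_prop]
    -- One lower and one upper edge over the level of `z` suffice, since the sign of `side` is the
    -- same for all edges of a chain covering that level. The extreme levels drop out because both
    -- chains end there in the same point.
    have strict : ∀ x y x' y' z, F.Consec (S \ U) x y → F.Consec (U ∪ {a, c}) x' y' →
        F.l x ≤ F.l z → F.l z ≤ F.l y → F.l x' ≤ F.l z → F.l z ≤ F.l y' →
        0 < F.side x y z → F.side x' y' z < 0 → z ∈ W := by
      intro x y x' y' z hxy hxy' h1 h2 h1' h2' hs hs'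
      obtain ⟨z₀, hz₀, hl₀, hs₀⟩ := F.exists_mem_segment_level hxy.lt h1 h2
      obtain ⟨z₁, hz₁, hl₁, hs₁⟩ := F.exists_mem_segment_level hxy'.lt h1' h2'
      have hlt := sub_pos.2 hxy.lt
      have hlt' := sub_pos.2 hxy'.lt
      have hw : F.w z₀ < F.w z := by
        by_contra hle
        nlinarith
      have hw' : F.w z < F.w z₁ := by
        by_contra hle
        nlinarith
      refine (memW z).2 ⟨⟨?_, ?_⟩, fun p q hpq hp hq => ?_, fun p q hpq hp hq => ?_⟩
      · by_contra hle
        rw [h.eq_a_of_low hxy hz₀ (by rw [hl₀]; exact not_lt.1 hle)] at hw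
        rw [h.eq_a_of_up hxy' hz₁ (by rw [hl₁]; exact not_lt.1 hle)] at hw'
        linarith
      · by_contra hle
        rw [h.eq_c_of_low hxy hz₀ (by rw [hl₀]; exact not_lt.1 hle)] at hw
        rw [h.eq_c_of_up hxy' hz₁ (by rw [hl₁]; exact not_lt.1 hle)] at hw'
        linarith
      · exact (hxy.side_pos_iff h.inj_low hpq h1 h2 hp hq).1.1 hs
      · exact (hxy'.side_pos_iff h.inj_up hpq h1' h2' hp hq).2.1 hs'
    have hWconv : W ⊆ convexHull ℝ (S : Set Plane) := by
      intro z hz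
      obtain ⟨⟨hza, hzc⟩, hzl, hzu⟩ := (memW z).1 hz
      obtain ⟨x, y, hxy, h1, h2⟩ := h.exists_low hza.le hzc.le
      obtain ⟨x', y', hxy', h1', h2'⟩ := h.exists_up hza.le hzc.le
      exact h.mem_convexHull hxy hxy' h1 h2 h1' h2' (hzl x y hxy h1 h2).le
        (hzu x' y' hxy' h1' h2').le
    refine mem_region_of_isOpen (W := W) ?_ ?_ ?_
      (strict x y x' y' z hxy hxy' h1 h2 h1' h2' hs hs')
    · refine ((isOpen_lt continuous_const F.continuous_l).inter
        (isOpen_lt F.continuous_l continuous_const)).inter (IsClosed.isOpen_compl (self := ?_))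
      exact (hLfin.isClosed_biUnion fun q _ => closed_down q.1 q.2).union
        (hUfin.isClosed_biUnion fun q _ => closed_up q.1 q.2)
    · exact ((isBounded_convexHull).2 S.finite_toSet.isBounded).subset hWconv
    · have hcl : closure W ⊆
          (⋃ q ∈ {q : Plane × Plane | F.Consec (S \ U) q.1 q.2},
            {z | F.l q.1 ≤ F.l z ∧ F.l z ≤ F.l q.2 ∧ 0 ≤ F.side q.1 q.2 z}) ∩
          ⋃ q ∈ {q : Plane × Plane | F.Consec (U ∪ {a, c}) q.1 q.2},
            {z | F.l q.1 ≤ F.l z ∧ F.l z ≤ F.l q.2 ∧ F.side q.1 q.2 z ≤ 0} := by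
        refine closure_minimal (fun z hz => ?_)
          ((hLfin.isClosed_biUnion fun q _ => closed_up q.1 q.2).inter
            (hUfin.isClosed_biUnion fun q _ => closed_down q.1 q.2))
        obtain ⟨⟨hza, hzc⟩, hzl, hzu⟩ := (memW z).1 hz
        obtain ⟨x, y, hxy, h1, h2⟩ := h.exists_low hza.le hzc.le
        obtain ⟨x', y', hxy', h1', h2'⟩ := h.exists_up hza.le hzc.le
        exact ⟨Set.mem_biUnion (x := (x, y)) hxy ⟨h1, h2, (hzl x y hxy h1 h2).le⟩,
          Set.mem_biUnion (x := (x', y')) hxy' ⟨h1', h2', (hzu x' y' hxy' h1' h2').le⟩⟩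
      intro z hz
      obtain ⟨hz1, hz2⟩ := hcl hz
      simp only [Set.mem_iUnion, Prod.exists, exists_prop, Set.mem_ofPred_eq] at hz1 hz2
      obtain ⟨x, y, hxy, h1, h2, hs⟩ := hz1
      obtain ⟨x', y', hxy', h1', h2', hs'⟩ := hz2
      rcases hs.eq_or_lt with hs | hs
      · exact Or.inr (hlow x y hxy ((F.mem_segment_iff hxy.lt).2 ⟨h1, h2, hs.symm⟩))
      rcases hs'.eq_or_lt with hs' | hs'
      · exact Or.inr (hup x' y' hxy' ((F.mem_segment_iff hxy'.lt).2 ⟨h1', h2', hs'⟩))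
      exact Or.inl (strict x y x' y' z hxy hxy' h1 h2 h1' h2' hs hs')

end BiChain

/-! ### Segments that leave the region near a lower vertex. -/

namespace IsRegionOf

variable {F : Frame} {S : Finset Plane} {U : Set Plane} {a c : Plane} {P : Set Plane}

lemma vertex_mem (h : IsRegionOf F S U a c P) {s : Plane} (hs : s ∈ S) : s ∈ P := by
  obtain ⟨n, v, -, hrange, rfl⟩ := h.mem
  obtain ⟨i, rfl⟩ : s ∈ Set.range v.vertices := hrange ▸ hs
  exact segment_subset_region v i (left_mem_segment _ _ _)

/-- Close to a lower vertex `b`, the points below the following edge are outside. -/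
lemma not_segment_subset_right (h : IsRegionOf F S U a c P) {b y s : Plane}
    (hb : F.Consec (S \ U) b y) (hl : F.l b < F.l s) (hs : F.side b y s < 0) :
    ¬ segment ℝ s b ⊆ P := by
  intro hsub
  have h1 := sub_pos.2 hl
  have h2 := sub_pos.2 hb.lt
  -- The point at fraction `t` from `b` towards `s` still has its level between those of `b` and
  -- `y`, so the criterion `below` applies to it.
  set t := min 1 ((F.l y - F.l b) / (F.l s - F.l b)) with ht
  have ht0 : 0 < t := lt_min one_pos (div_pos h2 h1)
  have ht1 : t ≤ 1 := min_le_left _ _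
  have ht2 : t * (F.l s - F.l b) ≤ F.l y - F.l b := (le_div_iff₀ h1).1 (min_le_right _ _)
  have hlz : F.l (t • s + (1 - t) • b) = F.l b + t * (F.l s - F.l b) := by
    simp only [map_add, map_smul, smul_eq_mul]
    ring
  refine h.below b y (t • s + (1 - t) • b) hb ?_ ?_ ?_ (hsub ⟨t, 1 - t, ht0.le, by linarith, by ring, rfl⟩)
  · rw [hlz]; nlinarith
  · rw [hlz]; linarith
  · rw [F.side_comb _ _ _ _ (by ring), F.side_left]
    nlinarith

/-- Close to a lower vertex `b`, the points below the preceding edge are outside. -/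
lemma not_segment_subset_left (h : IsRegionOf F S U a c P) {x b s : Plane}
    (hb : F.Consec (S \ U) x b) (hl : F.l s < F.l b) (hs : F.side x b s < 0) :
    ¬ segment ℝ s b ⊆ P := by
  intro hsub
  have h1 := sub_pos.2 hl
  have h2 := sub_pos.2 hb.lt
  set t := min 1 ((F.l b - F.l x) / (F.l b - F.l s)) with ht
  have ht0 : 0 < t := lt_min one_pos (div_pos h2 h1)
  have ht1 : t ≤ 1 := min_le_left _ _
  have ht2 : t * (F.l b - F.l s) ≤ F.l b - F.l x := (le_div_iff₀ h1).1 (min_le_right _ _)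
  have hlz : F.l (t • s + (1 - t) • b) = F.l b - t * (F.l b - F.l s) := by
    simp only [map_add, map_smul, smul_eq_mul]
    ring
  refine h.below x b (t • s + (1 - t) • b) hb ?_ ?_ ?_ (hsub ⟨t, 1 - t, ht0.le, by linarith, by ring, rfl⟩)
  · rw [hlz]; linarith
  · rw [hlz]; nlinarith
  · rw [F.side_comb _ _ _ _ (by ring), F.side_right]
    nlinarith

end IsRegionOf

/-! ### The lower hull -/

namespace Frame

variable (F : Frame) (S : Finset Plane)

/-- `s` lies on a non-vertical line below which there are no points of `S`. -/
def IsLower (s : Plane) : Prop := ∃ α : ℝ, ∀ t ∈ S, α * (F.l t - F.l s) ≤ F.w t - F.w s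

/-- The points of `S` that are not on the lower hull. -/
def nonLower : Set Plane := {s | s ∈ S ∧ ¬ F.IsLower S s}

variable {F S}

lemma mem_diff_nonLower {s : Plane} :
    s ∈ (S : Set Plane) \ F.nonLower S ↔ s ∈ S ∧ F.IsLower S s := by
  simp only [nonLower, Set.mem_sdiff, Finset.mem_coe, Set.mem_ofPred_eq]
  tauto

/-- The parallel to the line `x y` through `p` has no points of `S` below it. -/
lemma isLower_of_side {x y p : Plane} (hxy : F.l x < F.l y) (h : ∀ s ∈ S, 0 ≤ F.side x y s)
    (hp : F.side x y p ≤ 0) : F.IsLower S p := by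
  have hd : 0 < F.l y - F.l x := by linarith
  refine ⟨(F.w y - F.w x) / (F.l y - F.l x), fun t ht => ?_⟩
  have := h t ht
  rw [div_mul_eq_mul_div, div_le_iff₀ hd]
  simp only [side] at this hp
  nlinarith

/-- Any lower bound of the finitely many slopes from `a` is the slope of a supporting line. -/
lemma isLower_of_min {a : Plane} (h : ∀ s ∈ S, s ≠ a → F.l a < F.l s) : F.IsLower S a := by
  obtain ⟨α, hα⟩ := (S.image fun s => (F.w s - F.w a) / (F.l s - F.l a)).bddBelow
  refine ⟨α, fun t ht => ?_⟩
  rcases eq_or_ne t a with rfl | hne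
  · simp
  · exact (le_div_iff₀ (sub_pos.2 (h t ht hne))).1
      (hα (Finset.mem_coe.2 (Finset.mem_image_of_mem _ ht)))

lemma isLower_of_max {c : Plane} (h : ∀ s ∈ S, s ≠ c → F.l s < F.l c) : F.IsLower S c := by
  obtain ⟨α, hα⟩ := (S.image fun s => (F.w c - F.w s) / (F.l c - F.l s)).bddAbove
  refine ⟨α, fun t ht => ?_⟩
  rcases eq_or_ne t c with rfl | hne
  · simp
  · have := (div_le_iff₀ (sub_pos.2 (h t ht hne))).1
      (hα (Finset.mem_coe.2 (Finset.mem_image_of_mem _ ht)))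
    linarith

/-- Consecutive points of the lower hull span a supporting line. -/
lemma Consec.side_nonneg {x y : Plane} (h : F.Consec (S \ F.nonLower S) x y) :
    ∀ s ∈ S, 0 ≤ F.side x y s := by
  obtain ⟨hxS, α, hα⟩ := mem_diff_nonLower.1 h.left_mem
  obtain ⟨hyS, β, hβ⟩ := mem_diff_nonLower.1 h.right_mem
  have hd := sub_pos.2 h.lt
  -- The lowest point `p` relative to the line `x y` is on the lower hull, by the parallel through
  -- it. If it were strictly below the line, then consecutiveness would put it at or beyond `y`, or
  -- at or before `x`, against the supporting line at `y` or at `x`.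
  obtain ⟨p, hpS, hp⟩ := S.exists_min_image (F.side x y) ⟨x, hxS⟩
  have key : 0 ≤ F.side x y p := by
    by_contra hneg
    rw [not_le] at hneg
    have hlow : F.IsLower S p := by
      refine ⟨(F.w y - F.w x) / (F.l y - F.l x), fun t ht => ?_⟩
      have := hp t ht
      rw [div_mul_eq_mul_div, div_le_iff₀ hd]
      simp only [side] at this
      nlinarith
    by_cases hpx : F.l x < F.l p
    · have hpy := h.gap p (mem_diff_nonLower.2 ⟨hpS, hlow⟩) hpx
      have h1 := hβ p hpS
      have h2 := hβ x hxS
      simp only [side] at hneg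
      have h3 := mul_le_mul_of_nonneg_left h1 hd.le
      have h4 := mul_le_mul_of_nonneg_left h2 (sub_nonneg.2 hpy)
      nlinarith
    · rw [not_lt] at hpx
      have h1 := hα p hpS
      have h2 := hα y hyS
      simp only [side] at hneg
      have h3 := mul_le_mul_of_nonneg_left h1 hd.le
      have h4 := mul_le_mul_of_nonneg_left h2 (sub_nonneg.2 hpx)
      nlinarith
  exact fun s hs => key.trans (hp s hs)

end Frame

lemma pos_of_mem_segment {F : Frame} {x y p q z : Plane} (hz : z ∈ segment ℝ p q)
    (hp : 0 ≤ F.side x y p) (hq : 0 ≤ F.side x y q) : 0 ≤ F.side x y z := by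
  obtain ⟨a, b, ha, hb, hab, rfl⟩ := hz
  rw [F.side_comb _ _ _ _ hab]
  positivity

/-- The polygon whose lower chain is the lower hull. -/
theorem biChain_nonLower {F : Frame} {S : Finset Plane} {a c p : Plane} (hcard : 3 ≤ S.card)
    (hinj : Set.InjOn F.l S) (ha : a ∈ S) (hc : c ∈ S) (amin : ∀ s ∈ S, F.l a ≤ F.l s)
    (cmax : ∀ s ∈ S, F.l s ≤ F.l c) (hp : p ∈ F.nonLower S) :
    BiChain F S (F.nonLower S) a c where
  ha := ha
  hc := hc
  subset s hs := hs.1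
  ha' h := h.2 <| Frame.isLower_of_min fun s hs hne =>
    lt_of_le_of_ne (amin s hs) fun heq => hne (hinj hs ha heq.symm)
  hc' h := h.2 <| Frame.isLower_of_max fun s hs hne =>
    lt_of_le_of_ne (cmax s hs) fun heq => hne (hinj hs hc heq)
  inj := hinj
  a_min := amin
  c_max := cmax
  card := hcard
  sep x y x' y' z z' hl hu hz hz' hlev h1 h2 := by
    have hside := hl.side_nonneg
    have hsub : ∀ s ∈ F.nonLower S ∪ {a, c}, s ∈ S := by
      rintro s (hs | rfl | rfl)
      exacts [hs.1, ha, hc]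
    have hpos : ∀ s ∈ F.nonLower S ∪ {a, c}, s ≠ a → s ≠ c → 0 < F.side x y s := by
      rintro s (hs | rfl | rfl) hsa hsc
      · by_contra hle
        exact hs.2 (Frame.isLower_of_side hl.lt hside (not_lt.1 hle))
      · exact absurd rfl hsa
      · exact absurd rfl hsc
    have hz0 := ((F.mem_segment_iff hl.lt).1 hz).2.2
    have hd := sub_pos.2 hl.lt
    have hz'l := (F.mem_segment_iff hu.lt).1 hz'
    -- The lower edge spans a supporting line, so the upper edge is weakly above it. Strictness
    -- comes from an endpoint other than `a` and `c` that carries positive weight.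
    suffices h : 0 < F.side x y z' by
      simp only [Frame.side, ← hlev] at h hz0
      by_contra hle
      nlinarith
    obtain ⟨s, t, hs, ht, hst, rfl⟩ := hz'
    rw [F.side_comb _ _ _ _ hst]
    have hx0 := hside x' (hsub x' hu.left_mem)
    have hy0 := hside y' (hsub y' hu.right_mem)
    rcases hs.eq_or_lt with rfl | hs
    · obtain rfl : t = 1 := by linarith
      simp only [zero_smul, one_smul, zero_add] at hlev
      have := hpos y' hu.right_mem (fun h => by rw [h] at hlev; linarith)
        (fun h => by rw [h] at hlev; linarith)
      linarith
    rcases ht.eq_or_lt with rfl | ht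
    · obtain rfl : s = 1 := by linarith
      simp only [zero_smul, one_smul, add_zero] at hlev
      have := hpos x' hu.left_mem (fun h => by rw [h] at hlev; linarith)
        (fun h => by rw [h] at hlev; linarith)
      linarith
    by_cases hxa : x' = a
    · have hya : y' ≠ a := fun h => absurd hu.lt (by rw [hxa, h]; exact lt_irrefl _)
      by_cases hyc : y' = c
      -- The point `p` outside the lower hull prevents the upper chain from being the single edge
      -- from `a` to `c`.
      · exfalso
        have hpa : F.l a < F.l p := lt_of_le_of_ne (amin p hp.1) fun heq =>
          hp.2 (hinj ha hp.1 heq ▸ Frame.isLower_of_min fun s hs hne =>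
            lt_of_le_of_ne (amin s hs) fun heq => hne (hinj hs ha heq.symm))
        have hpc : F.l p < F.l c := lt_of_le_of_ne (cmax p hp.1) fun heq =>
          hp.2 (hinj hc hp.1 heq.symm ▸ Frame.isLower_of_max fun s hs hne =>
            lt_of_le_of_ne (cmax s hs) fun heq => hne (hinj hs hc heq))
        exact absurd (hu.gap p (Or.inl hp) (hxa ▸ hpa)) (not_le.2 (hyc ▸ hpc))
      · have := mul_pos ht (hpos y' hu.right_mem hya hyc)
        have := mul_nonneg hs.le hx0
        linarith
    · have hxc : x' ≠ c := fun h =>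
        absurd (cmax y' (hsub y' hu.right_mem)) (not_le.2 (h ▸ hu.lt))
      have := mul_pos hs (hpos x' hu.left_mem hxa hxc)
      have := mul_nonneg ht.le hy0
      linarith

/-! ### Zigzag polygons on two rows of points -/

/-- The point with integer coordinates `i`, `j`. -/
noncomputable def pt (q : ℤ × ℤ) : Plane := !₂[(q.1 : ℝ), (q.2 : ℝ)]

lemma pt_injective : Function.Injective pt := by
  rintro ⟨i, j⟩ ⟨i', j'⟩ h
  have h0 := congrFun (congrArg WithLp.ofLp h) 0
  have h1 := congrFun (congrArg WithLp.ofLp h) 1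
  simp [pt] at h0 h1
  simp [h0, h1]

/-- Slightly sheared coordinates with orientation given by two signs. -/
noncomputable def shearFrame (σ τ : ℤˣ) : Frame where
  l := { toFun := fun z => (σ : ℤ) * z 0 - (τ : ℤ) * z 1 / 4
         map_add' := fun x y => by simp; ring
         map_smul' := fun c x => by simp; ring }
  w := { toFun := fun z => (τ : ℤ) * z 1
         map_add' := fun x y => by simp; ring
         map_smul' := fun c x => by simp; ring }
  f := !₂[((σ : ℤ) : ℝ), 0]
  e := !₂[((σ : ℤ) : ℝ) / 4, ((τ : ℤ) : ℝ)]
  decomp z := by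
    rcases Int.units_eq_one_or σ with rfl | rfl <;> rcases Int.units_eq_one_or τ with rfl | rfl <;>
      ext i <;> fin_cases i <;> simp <;> ring
  l_f := by
    rcases Int.units_eq_one_or σ with rfl | rfl <;> simp
  w_f := by simp
  l_e := by
    rcases Int.units_eq_one_or σ with rfl | rfl <;> rcases Int.units_eq_one_or τ with rfl | rfl <;>
      norm_num
  w_e := by
    rcases Int.units_eq_one_or τ with rfl | rfl <;> simp

section Shear

variable (σ τ : ℤˣ)

lemma shear_l (q : ℤ × ℤ) :
    (shearFrame σ τ).l (pt q) = ((4 * (σ * q.1) - τ * q.2 : ℤ) : ℝ) / 4 := by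
  simp [shearFrame, pt]
  ring

lemma shear_w (q : ℤ × ℤ) : (shearFrame σ τ).w (pt q) = ((τ * q.2 : ℤ) : ℝ) := by
  simp [shearFrame, pt]

lemma shear_lt (q q' : ℤ × ℤ) : (shearFrame σ τ).l (pt q) < (shearFrame σ τ).l (pt q') ↔
    4 * (σ * q.1) - τ * q.2 < 4 * (σ * q'.1) - (τ : ℤ) * q'.2 := by
  rw [shear_l, shear_l, div_lt_div_iff_of_pos_right (by norm_num), Int.cast_lt]

lemma shear_le (q q' : ℤ × ℤ) : (shearFrame σ τ).l (pt q) ≤ (shearFrame σ τ).l (pt q') ↔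
    4 * (σ * q.1) - τ * q.2 ≤ 4 * (σ * q'.1) - (τ : ℤ) * q'.2 := by
  rw [shear_l, shear_l, div_le_div_iff_of_pos_right (by norm_num), Int.cast_le]

lemma shear_side (p q s : ℤ × ℤ) : (shearFrame σ τ).side (pt p) (pt q) (pt s) =
    ((σ * τ * ((q.1 - p.1) * (s.2 - p.2) - (s.1 - p.1) * (q.2 - p.2)) : ℤ) : ℝ) := by
  simp only [Frame.side, shear_l, shear_w]
  push_cast
  ring

end Shear

/-- `k` columns of two points each, four corners, and one more point if `r = 1`. -/
noncomputable def gridIndex (k r : ℕ) : Finset (ℤ × ℤ) :=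
  (Finset.Ico 0 (k : ℤ) ×ˢ {-1, 1}) ∪ (({-3, (k : ℤ) + 2} : Finset ℤ) ×ˢ {-2, 2}) ∪
    if r = 1 then {(-1, 0)} else ∅

lemma mem_gridIndex {k r : ℕ} {q : ℤ × ℤ} : q ∈ gridIndex k r ↔
    ((0 ≤ q.1 ∧ q.1 < k) ∧ (q.2 = -1 ∨ q.2 = 1)) ∨
    ((q.1 = -3 ∨ q.1 = k + 2) ∧ (q.2 = -2 ∨ q.2 = 2)) ∨ (r = 1 ∧ q.1 = -1 ∧ q.2 = 0) := by
  unfold gridIndex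
  split_ifs with h
  · simp [h, Prod.ext_iff]
    tauto
  · simp [h]

lemma card_gridIndex {k r : ℕ} (hr : r < 2) : (gridIndex k r).card = 2 * k + 4 + r := by
  unfold gridIndex
  have h1 : Disjoint (Finset.Ico 0 (k : ℤ) ×ˢ ({-1, 1} : Finset ℤ))
      (({-3, (k : ℤ) + 2} : Finset ℤ) ×ˢ ({-2, 2} : Finset ℤ)) := by
    rw [Finset.disjoint_left]
    intro q
    simp
    omega
  have h2 : (({-3, (k : ℤ) + 2} : Finset ℤ)).card = 2 := Finset.card_pair (by omega)
  split_ifs with h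
  · rw [Finset.card_union_of_disjoint, Finset.card_union_of_disjoint h1]
    · simp [h2, h]
      omega
    · rw [Finset.disjoint_left]
      intro q
      simp [Prod.ext_iff]
      omega
  · obtain rfl : r = 0 := by omega
    rw [Finset.union_empty, Finset.card_union_of_disjoint h1]
    simp [h2]
    omega

/-- The point set of the lower bound construction. -/
noncomputable def grid (k r : ℕ) : Finset Plane := (gridIndex k r).map ⟨pt, pt_injective⟩

lemma mem_grid {k r : ℕ} {s : Plane} : s ∈ grid k r ↔ ∃ q ∈ gridIndex k r, pt q = s := by
  simp [grid]

lemma pt_mem_grid {k r : ℕ} {q : ℤ × ℤ} : pt q ∈ grid k r ↔ q ∈ gridIndex k r := by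
  simp [grid]

/-- The first coordinate of the two corners on the side given by a sign. -/
def cornerX (k : ℕ) (σ : ℤˣ) : ℤ := if σ = 1 then k + 2 else -3

/-- This separates lower edges from a side of the bounding rectangle that they may touch only at the
corner `q`. -/
lemma lt_of_mem_segment (g : Plane →ₗ[ℝ] ℝ) {M : ℝ} {x y z q : Plane} (hz : z ∈ segment ℝ x y)
    (hx : g x < M ∨ x = q ∧ g q = M) (hy : g y < M ∨ y = q ∧ g q = M) (hzq : z ≠ q) :
    g z < M := by
  obtain ⟨a, b, ha, hb, hab, rfl⟩ := hz
  obtain rfl : a = 1 - b := by linarith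
  simp only [map_add, map_smul, smul_eq_mul]
  rcases ha.eq_or_lt with ha | ha
  · obtain rfl : b = 1 := by linarith
    rcases hy with hy | ⟨rfl, hy⟩
    · simpa using hy
    · simp at hzq
  rcases hb.eq_or_lt with rfl | hb
  · rcases hx with hx | ⟨rfl, hx⟩
    · simpa using hx
    · simp at hzq
  rcases hx with hx | ⟨rfl, hx⟩ <;> rcases hy with hy | ⟨rfl, hy⟩
  · nlinarith
  · nlinarith
  · nlinarith
  · exfalso
    apply hzq
    rw [← add_smul]
    simp

section Zigzag

variable {k r : ℕ} (σ τ : ℤˣ)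

/-- The shear by a quarter is weak enough not to mix columns: the level orders the grid first by `σ
* x` and then by decreasing `τ * y`. -/
lemma grid_injOn : Set.InjOn (shearFrame σ τ).l (grid k r) := by
  intro s hs t ht hst
  obtain ⟨q, hq, rfl⟩ := mem_grid.1 hs
  obtain ⟨q', hq', rfl⟩ := mem_grid.1 ht
  have h1 := (shear_le σ τ q q').1 hst.le
  have h2 := (shear_le σ τ q' q).1 hst.ge
  rw [mem_gridIndex] at hq hq'
  congr 1
  rcases Int.units_eq_one_or σ with rfl | rfl <;> rcases Int.units_eq_one_or τ with rfl | rfl <;>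
    · simp only [Units.val_one, Units.val_neg] at h1 h2
      ext <;> omega

/-- The upper chain consists of two sides of the bounding rectangle. Among the remaining grid points
only the ends of the chain lie on these sides. -/
lemma grid_biChain : BiChain (shearFrame σ τ) (grid k r) {pt (cornerX k σ, 2 * τ)}
    (pt (cornerX k (-σ), 2 * τ)) (pt (cornerX k σ, -2 * τ)) where
  ha := by
    rw [pt_mem_grid, mem_gridIndex]
    rcases Int.units_eq_one_or σ with rfl | rfl <;> rcases Int.units_eq_one_or τ with rfl | rfl <;>
      simp [cornerX]
  hc := by
    rw [pt_mem_grid, mem_gridIndex]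
    rcases Int.units_eq_one_or σ with rfl | rfl <;> rcases Int.units_eq_one_or τ with rfl | rfl <;>
      simp [cornerX]
  subset := by
    rintro _ rfl
    rw [Finset.mem_coe, pt_mem_grid, mem_gridIndex]
    rcases Int.units_eq_one_or σ with rfl | rfl <;> rcases Int.units_eq_one_or τ with rfl | rfl <;>
      simp [cornerX]
  ha' := by
    rw [Set.mem_singleton_iff, pt_injective.eq_iff]
    rcases Int.units_eq_one_or σ with rfl | rfl <;> simp [cornerX] <;> omega
  hc' := by
    rw [Set.mem_singleton_iff, pt_injective.eq_iff]
    rcases Int.units_eq_one_or τ with rfl | rfl <;> simp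
  inj := grid_injOn σ τ
  a_min s hs := by
    obtain ⟨q, hq, rfl⟩ := mem_grid.1 hs
    rw [shear_le]
    rw [mem_gridIndex] at hq
    rcases Int.units_eq_one_or σ with rfl | rfl <;> rcases Int.units_eq_one_or τ with rfl | rfl <;>
      simp [cornerX] <;> omega
  c_max s hs := by
    obtain ⟨q, hq, rfl⟩ := mem_grid.1 hs
    rw [shear_le]
    rw [mem_gridIndex] at hq
    rcases Int.units_eq_one_or σ with rfl | rfl <;> rcases Int.units_eq_one_or τ with rfl | rfl <;>
      simp [cornerX] <;> omega
  card := by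
    have h1 : (gridIndex k r).card = (grid k r).card := (Finset.card_map _).symm
    have h2 : (({-3, (k : ℤ) + 2} : Finset ℤ) ×ˢ ({-2, 2} : Finset ℤ)) ⊆ gridIndex k r := by
      intro q hq
      rw [mem_gridIndex]
      simp at hq
      tauto
    have h3 := Finset.card_le_card h2
    rw [Finset.card_product, Finset.card_pair (by omega), Finset.card_pair (by norm_num)] at h3
    omega
  sep x y x' y' z z' hl hu hz hz' hlev h1 h2 := by
    set F := shearFrame σ τ with hF
    set L := pt (cornerX k (-σ), 2 * τ) with hL
    set R := pt (cornerX k σ, 2 * τ) with hR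
    set D := pt (cornerX k σ, -2 * τ) with hD
    have hLR : F.l L < F.l R := by
      rw [shear_lt]
      rcases Int.units_eq_one_or σ with rfl | rfl <;> simp [cornerX] <;> omega
    have hRD : F.l R < F.l D := by
      rw [shear_lt]
      rcases Int.units_eq_one_or τ with rfl | rfl <;> simp <;> omega
    have hww : ∀ s ∈ (grid k r : Set Plane) \ {R}, F.w s < 2 ∨ s = L ∧ F.w L = 2 := by
      rintro s ⟨hs, hsR⟩
      obtain ⟨q, hq, rfl⟩ := mem_grid.1 hs
      rw [Set.mem_singleton_iff, hR, pt_injective.eq_iff, Prod.ext_iff] at hsR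
      rw [hL, pt_injective.eq_iff, Prod.ext_iff, hF, shear_w, shear_w]
      rw [mem_gridIndex] at hq
      have : (((τ : ℤ) * q.2 : ℤ) : ℝ) < 2 ↔ (τ : ℤ) * q.2 < 2 := by exact_mod_cast Iff.rfl
      rw [this]
      rcases Int.units_eq_one_or σ with rfl | rfl <;>
        rcases Int.units_eq_one_or τ with rfl | rfl <;> simp [cornerX] at hsR ⊢ <;> omega
    -- Adding a quarter of `w` undoes the shear, so `X` is the signed horizontal coordinate and is
    -- constant on the side from `R` to `D`.
    let X : Plane →ₗ[ℝ] ℝ := F.l + (1 / 4 : ℝ) • F.w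
    have hX : ∀ q, X (pt q) = ((σ * q.1 : ℤ) : ℝ) := fun q => by
      simp only [X, LinearMap.add_apply, LinearMap.smul_apply, hF, shear_l, shear_w, smul_eq_mul]
      push_cast
      ring
    have hXX : ∀ s ∈ (grid k r : Set Plane) \ {R},
        X s < ((σ * cornerX k σ : ℤ) : ℝ) ∨ s = D ∧ X D = ((σ * cornerX k σ : ℤ) : ℝ) := by
      rintro s ⟨hs, hsR⟩
      obtain ⟨q, hq, rfl⟩ := mem_grid.1 hs
      rw [Set.mem_singleton_iff, hR, pt_injective.eq_iff, Prod.ext_iff] at hsR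
      rw [hD, pt_injective.eq_iff, Prod.ext_iff, hX, hX, Int.cast_lt]
      rw [mem_gridIndex] at hq
      rcases Int.units_eq_one_or σ with rfl | rfl <;>
        rcases Int.units_eq_one_or τ with rfl | rfl <;> simp [cornerX] at hsR ⊢ <;> omega
    have hcases : (x' = L ∧ y' = R) ∨ (x' = R ∧ y' = D) := by
      rcases hu.left_mem with rfl | rfl | rfl <;> rcases hu.right_mem with rfl | rfl | rfl
      · exact absurd hu.lt (lt_irrefl _)
      · exact absurd hu.lt (not_lt.2 hLR.le)
      · exact Or.inr ⟨rfl, rfl⟩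
      · exact Or.inl ⟨rfl, rfl⟩
      · exact absurd hu.lt (lt_irrefl _)
      · exact absurd (hu.gap R (Or.inl rfl) hLR) (not_le.2 hRD)
      · exact absurd hu.lt (not_lt.2 hRD.le)
      · exact absurd hu.lt (not_lt.2 (hLR.trans hRD).le)
      · exact absurd hu.lt (lt_irrefl _)
    rcases hcases with ⟨rfl, rfl⟩ | ⟨rfl, rfl⟩
    · have hw' : F.w z' = 2 := by
        obtain ⟨a, b, -, -, hab, rfl⟩ := hz'
        have e1 : F.w L = 2 := by
          rw [hL, hF, shear_w]
          rcases Int.units_eq_one_or τ with rfl | rfl <;> simp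
        have e2 : F.w R = 2 := by
          rw [hR, hF, shear_w]
          rcases Int.units_eq_one_or τ with rfl | rfl <;> simp
        simp only [map_add, map_smul, smul_eq_mul, e1, e2]
        linarith
      rw [hw']
      exact lt_of_mem_segment F.w hz (hww x hl.left_mem) (hww y hl.right_mem)
        fun h => absurd h1 (by rw [h]; exact lt_irrefl _)
    · have hX' : X z' = ((σ * cornerX k σ : ℤ) : ℝ) := by
        obtain ⟨a, b, -, -, hab, rfl⟩ := hz'
        simp only [map_add, map_smul, smul_eq_mul, hR, hD, hX]
        rw [← add_mul, hab, one_mul]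
      have := lt_of_mem_segment X hz (hXX x hl.left_mem) (hXX y hl.right_mem)
        fun h => absurd h2 (by rw [h]; exact lt_irrefl _)
      rw [← hX'] at this
      simp only [X, LinearMap.add_apply, LinearMap.smul_apply, smul_eq_mul, hlev] at this
      linarith

end Zigzag

section Zigzag

variable {k r : ℕ} (σ τ : ℤˣ)

/-- Together with `consec_diagonal` this describes one tooth: down a column, then up to the top of
the next one. -/
lemma consec_column {i : ℤ} (h0 : 0 ≤ i) (h1 : i < k) :
    (shearFrame σ τ).Consec ((grid k r : Set Plane) \ {pt (cornerX k σ, 2 * τ)})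
      (pt (i, τ)) (pt (i, -τ)) := by
  refine ⟨⟨pt_mem_grid.2 (mem_gridIndex.2 ?_), ?_⟩, ⟨pt_mem_grid.2 (mem_gridIndex.2 ?_), ?_⟩,
    ?_, ?_⟩
  · rcases Int.units_eq_one_or τ with rfl | rfl <;> simp [h0, h1]
  · rw [Set.mem_singleton_iff, pt_injective.eq_iff, Prod.ext_iff]
    rcases Int.units_eq_one_or τ with rfl | rfl <;> simp
  · rcases Int.units_eq_one_or τ with rfl | rfl <;> simp [h0, h1]
  · rw [Set.mem_singleton_iff, pt_injective.eq_iff, Prod.ext_iff]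
    rcases Int.units_eq_one_or τ with rfl | rfl <;> simp
  · rw [shear_lt]
    rcases Int.units_eq_one_or τ with rfl | rfl <;> simp
  · rintro z ⟨hz, -⟩ hlt
    obtain ⟨q, hq, rfl⟩ := mem_grid.1 hz
    rw [shear_lt] at hlt
    rw [shear_le]
    rw [mem_gridIndex] at hq
    rcases Int.units_eq_one_or σ with rfl | rfl <;> rcases Int.units_eq_one_or τ with rfl | rfl <;>
      simp at hlt ⊢ <;> omega

lemma consec_diagonal {i : ℤ} (h0 : 0 ≤ i) (h1 : i < k) (h0' : 0 ≤ i + σ) (h1' : i + σ < k) :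
    (shearFrame σ τ).Consec ((grid k r : Set Plane) \ {pt (cornerX k σ, 2 * τ)})
      (pt (i, -τ)) (pt (i + σ, τ)) := by
  refine ⟨(consec_column σ τ h0 h1).right_mem, (consec_column σ τ h0' h1').left_mem, ?_, ?_⟩
  · rw [shear_lt]
    rcases Int.units_eq_one_or σ with rfl | rfl <;> rcases Int.units_eq_one_or τ with rfl | rfl <;>
      simp <;> omega
  · rintro z ⟨hz, hzR⟩ hlt
    obtain ⟨q, hq, rfl⟩ := mem_grid.1 hz
    rw [shear_lt] at hlt
    rw [shear_le]
    rw [mem_gridIndex] at hq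
    rcases Int.units_eq_one_or σ with rfl | rfl <;> rcases Int.units_eq_one_or τ with rfl | rfl <;>
      simp at hlt h0' h1' ⊢ <;> omega

variable {σ τ} {P : Set Plane}

/-- All other grid points at earlier levels lie strictly beyond the column line, that is, below the
edge leading into the tip. -/
lemma eq_of_sees_left
    (hP : IsRegionOf (shearFrame σ τ) (grid k r) {pt (cornerX k σ, 2 * τ)}
      (pt (cornerX k (-σ), 2 * τ)) (pt (cornerX k σ, -2 * τ)) P) {i : ℤ} (h0 : 0 ≤ i)
    (h1 : i < k) {s : Plane} (hs : s ∈ grid k r)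
    (hl : (shearFrame σ τ).l s < (shearFrame σ τ).l (pt (i, -τ)))
    (hsee : segment ℝ s (pt (i, -τ)) ⊆ P) : s = pt (i, (τ : ℤ)) := by
  by_contra hne
  refine hP.not_segment_subset_left (consec_column σ τ h0 h1) hl ?_ hsee
  obtain ⟨q, hq, rfl⟩ := mem_grid.1 hs
  rw [pt_injective.eq_iff, Prod.ext_iff] at hne
  rw [shear_lt] at hl
  rw [shear_side, Int.cast_lt_zero]
  rw [mem_gridIndex] at hq
  rcases Int.units_eq_one_or σ with rfl | rfl <;> rcases Int.units_eq_one_or τ with rfl | rfl <;>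
    simp at hne hl ⊢ <;> omega

/-- The diagonal climbs two units per column. From the second column on it is above height 2, so all
other later grid points lie strictly below its line. -/
lemma eq_of_sees_right
    (hP : IsRegionOf (shearFrame σ τ) (grid k r) {pt (cornerX k σ, 2 * τ)}
      (pt (cornerX k (-σ), 2 * τ)) (pt (cornerX k σ, -2 * τ)) P) {i : ℤ} (h0 : 0 ≤ i)
    (h1 : i < k) (h0' : 0 ≤ i + σ) (h1' : i + σ < k) {s : Plane} (hs : s ∈ grid k r)
    (hl : (shearFrame σ τ).l (pt (i, -τ)) < (shearFrame σ τ).l s)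
    (hsee : segment ℝ s (pt (i, -τ)) ⊆ P) : s = pt (i + σ, (τ : ℤ)) := by
  by_contra hne
  refine hP.not_segment_subset_right (consec_diagonal σ τ h0 h1 h0' h1') hl ?_ hsee
  obtain ⟨q, hq, rfl⟩ := mem_grid.1 hs
  rw [pt_injective.eq_iff, Prod.ext_iff] at hne
  rw [shear_lt] at hl
  rw [shear_side, Int.cast_lt_zero]
  rw [mem_gridIndex] at hq
  rcases Int.units_eq_one_or σ with rfl | rfl <;> rcases Int.units_eq_one_or τ with rfl | rfl <;>
    simp at hne hl h0' h1' ⊢ <;> omega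

/-- A bottom point of the zigzag is guarded only by itself and its two neighbours. -/
lemma eq_of_sees
    (hP : IsRegionOf (shearFrame σ τ) (grid k r) {pt (cornerX k σ, 2 * τ)}
      (pt (cornerX k (-σ), 2 * τ)) (pt (cornerX k σ, -2 * τ)) P) {i : ℤ} (h0 : 0 ≤ i)
    (h1 : i < k) (h0' : 0 ≤ i + σ) (h1' : i + σ < k) {s : Plane} (hs : s ∈ grid k r)
    (hsee : segment ℝ s (pt (i, -τ)) ⊆ P) :
    s = pt (i, -τ) ∨ s = pt (i, (τ : ℤ)) ∨ s = pt (i + σ, (τ : ℤ)) := by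
  rcases lt_trichotomy ((shearFrame σ τ).l s) ((shearFrame σ τ).l (pt (i, -τ))) with hl | hl | hl
  · exact Or.inr (Or.inl (eq_of_sees_left hP h0 h1 hs hl hsee))
  · exact Or.inl (grid_injOn σ τ hs (consec_column σ τ h0 h1).right_mem.1 hl)
  · exact Or.inr (Or.inr (eq_of_sees_right hP h0 h1 h0' h1' hs hl hsee))

end Zigzag

/-! ### Counting guards for the four zigzag polygons. -/

lemma IsGuardSet.exists_segment_subset {G : Finset Plane} {P : Set Plane} (h : IsGuardSet G P)
    {x : Plane} (hx : x ∈ P) : ∃ g ∈ G, segment ℝ g x ⊆ P := by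
  rw [IsGuardSet] at h
  rw [← h] at hx
  simp only [Set.mem_iUnion, exists_prop] at hx
  obtain ⟨g, hg, hxg⟩ := hx
  exact ⟨g, hg, hxg.2⟩

lemma le_guardNumber {S : Finset Plane} {A : Set (Set Plane)} {m : ℕ}
    (h : ∀ G ⊆ S, (∀ P ∈ A, IsGuardSet G P) → m ≤ G.card) : (m : ℕ∞) ≤ guardNumber S A :=
  le_iInf₂ fun G hG => by exact_mod_cast h G hG.1 hG.2

/-- Each of the four conditions omits exactly one of the four points, so no single point meets all
of them. -/
lemma two_le_card_of_hit {α : Type*} [DecidableEq α] {G : Finset α} {p q p' q' : α}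
    (h1 : p ≠ q) (h2 : p ≠ p') (h3 : p ≠ q') (h4 : q ≠ p') (h5 : q ≠ q') (h6 : p' ≠ q')
    (e1 : ∃ g ∈ G, g = q ∨ g = p ∨ g = p') (e2 : ∃ g ∈ G, g = p ∨ g = q ∨ g = q')
    (e3 : ∃ g ∈ G, g = q' ∨ g = p' ∨ g = p) (e4 : ∃ g ∈ G, g = p' ∨ g = q' ∨ g = q) :
    2 ≤ (G ∩ {p, q, p', q'}).card := by
  by_contra hlt
  have hle := Finset.card_le_one.1 (Nat.lt_succ_iff.1 (not_le.1 hlt))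
  have mem : ∀ {x}, x ∈ G → (x = p ∨ x = q ∨ x = p' ∨ x = q') → x ∈ G ∩ {p, q, p', q'} :=
    fun hx h => by simpa using ⟨hx, h⟩
  have key : ∀ x ∈ G, ∀ y ∈ G, (x = p ∨ x = q ∨ x = p' ∨ x = q') →
      (y = p ∨ y = q ∨ y = p' ∨ y = q') → x = y :=
    fun x hx y hy h h' => hle x (mem hx h) y (mem hy h')
  obtain ⟨x, hx, rfl | rfl | rfl⟩ := e1
  · obtain ⟨y, hy, rfl | rfl | rfl⟩ := e3
    · exact h5 (key _ hx _ hy (by simp) (by simp))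
    · exact h4 (key _ hx _ hy (by simp) (by simp))
    · exact h1 (key _ hx _ hy (by simp) (by simp)).symm
  · obtain ⟨y, hy, rfl | rfl | rfl⟩ := e4
    · exact h2 (key _ hx _ hy (by simp) (by simp))
    · exact h3 (key _ hx _ hy (by simp) (by simp))
    · exact h1 (key _ hx _ hy (by simp) (by simp))
  · obtain ⟨y, hy, rfl | rfl | rfl⟩ := e2
    · exact h2 (key _ hx _ hy (by simp) (by simp)).symm
    · exact h4 (key _ hx _ hy (by simp) (by simp)).symm
    · exact h6 (key _ hx _ hy (by simp) (by simp))

/-- A diagonal edge of the zigzag in direction `-σ` ends at a tip of the zigzag in direction `σ`,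
but comes from the previous column, where that tip cannot be seen. -/
lemma zigzag_ne_of_neg_left {k r : ℕ} (hk : 2 ≤ k) {σ τ' : ℤˣ} {Q : Set Plane}
    (h1 : IsRegionOf (shearFrame σ τ') (grid k r) {pt (cornerX k σ, 2 * (τ' : ℤˣ))}
      (pt (cornerX k (-σ), 2 * (τ' : ℤˣ))) (pt (cornerX k σ, -2 * (τ' : ℤˣ))) Q)
    (h2 : IsRegionOf (shearFrame (-σ) τ') (grid k r) {pt (cornerX k (-σ), 2 * (τ' : ℤˣ))}
      (pt (cornerX k (-(-σ)), 2 * (τ' : ℤˣ))) (pt (cornerX k (-σ), -2 * (τ' : ℤˣ))) Q) : False := by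
  obtain ⟨i, hi0, hi1, hi0', hi1'⟩ : ∃ i : ℤ, 0 ≤ i ∧ i < k ∧ 0 ≤ i + σ ∧ i + σ < k := by
    rcases Int.units_eq_one_or σ with rfl | rfl
    · exact ⟨0, by simp; omega⟩
    · exact ⟨1, by simp; omega⟩
  have hedge := h2.low _ _ (consec_diagonal (-σ) τ' hi0' hi1'
    (by push_cast; linarith) (by push_cast; linarith))
  rw [segment_symm] at hedge
  have h3 := eq_of_sees_left h1 hi0' hi1'
    (consec_column (-σ) τ' (by push_cast; linarith) (by push_cast; linarith)).left_mem.1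
    (by
      rw [shear_lt]
      rcases Int.units_eq_one_or σ with rfl | rfl <;>
        rcases Int.units_eq_one_or τ' with rfl | rfl <;> simp <;> omega) hedge
  rw [pt_injective.eq_iff, Prod.ext_iff] at h3
  have h4 := h3.1
  rcases Int.units_eq_one_or σ with rfl | rfl <;> simp at h4


/-- The side of the rectangle at height `-2 * τ` is an upper edge of the second polygon. In the
first one the lower chain rises right after its corner on that side, so the side leaves the region
there. -/
lemma zigzag_ne_of_neg_right {k r : ℕ} (hk : 2 ≤ k) {σ σ' τ : ℤˣ} {Q : Set Plane}
    (h1 : IsRegionOf (shearFrame σ τ) (grid k r) {pt (cornerX k σ, 2 * (τ : ℤˣ))}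
      (pt (cornerX k (-σ), 2 * (τ : ℤˣ))) (pt (cornerX k σ, -2 * (τ : ℤˣ))) Q)
    (h2 : IsRegionOf (shearFrame σ' (-τ)) (grid k r) {pt (cornerX k σ', 2 * ((-τ) : ℤˣ))}
      (pt (cornerX k (-σ'), 2 * ((-τ) : ℤˣ))) (pt (cornerX k σ', -2 * ((-τ) : ℤˣ))) Q) : False := by
  have hB := grid_biChain (k := k) (r := r) σ τ
  have hB' := grid_biChain (k := k) (r := r) σ' (-τ)
  have hD : pt (cornerX k (-σ), -2 * τ) ∈ (grid k r : Set Plane) \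
      {pt (cornerX k σ, 2 * τ)} := by
    refine ⟨pt_mem_grid.2 (mem_gridIndex.2 ?_), ?_⟩
    · rcases Int.units_eq_one_or σ with rfl | rfl <;>
        rcases Int.units_eq_one_or τ with rfl | rfl <;> simp [cornerX]
    · rw [Set.mem_singleton_iff, pt_injective.eq_iff, Prod.ext_iff]
      rcases Int.units_eq_one_or τ with rfl | rfl <;> simp
  have hDc : (shearFrame σ τ).l (pt (cornerX k (-σ), -2 * τ)) <
      (shearFrame σ τ).l (pt (cornerX k σ, -2 * τ)) := by
    rw [shear_lt]
    rcases Int.units_eq_one_or σ with rfl | rfl <;> simp [cornerX] <;> omega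
  obtain ⟨y, hy⟩ := Frame.exists_consec_right
    ((grid k r).finite_toSet.subset Set.sdiff_subset) hD ⟨hB.hc, hB.hc'⟩ hDc
  have hcol := hy.gap _ (consec_column σ τ (i := 0) le_rfl (by omega)).left_mem (by
    rw [shear_lt]
    rcases Int.units_eq_one_or σ with rfl | rfl <;>
      rcases Int.units_eq_one_or τ with rfl | rfl <;> simp [cornerX] <;> omega)
  have hup : (shearFrame σ' (-τ)).Consec ({pt (cornerX k σ', 2 * (-τ : ℤˣ))} ∪
      {pt (cornerX k (-σ'), 2 * (-τ : ℤˣ)), pt (cornerX k σ', -2 * (-τ : ℤˣ))})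
      (pt (cornerX k (-σ'), 2 * (-τ : ℤˣ))) (pt (cornerX k σ', 2 * (-τ : ℤˣ))) := by
    refine ⟨by simp, by simp, hB'.a_lt rfl, ?_⟩
    rintro z (rfl | rfl | rfl) hz
    · exact le_rfl
    · exact absurd hz (lt_irrefl _)
    · exact (hB'.lt_c rfl).le
  have hedge : segment ℝ (pt (cornerX k σ, -2 * τ)) (pt (cornerX k (-σ), -2 * τ)) ⊆ Q := by
    have := h2.up _ _ hup
    rcases Int.units_eq_one_or σ with rfl | rfl <;>
      rcases Int.units_eq_one_or σ' with rfl | rfl <;>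
      simp only [neg_neg, Units.val_neg, mul_neg, neg_mul] at this ⊢ <;>
      first | exact this | (rw [segment_symm]; exact this)
  refine h1.not_segment_subset_right hy hDc ?_ hedge
  obtain ⟨q, hq, rfl⟩ := mem_grid.1 hy.right_mem.1
  have hlt := hy.lt
  rw [shear_le] at hcol
  rw [shear_lt] at hlt hDc
  have hside : 0 < (τ : ℤ) * (q.2 + 2 * τ) := by
    rw [mem_gridIndex] at hq
    rcases Int.units_eq_one_or σ with rfl | rfl <;>
      rcases Int.units_eq_one_or τ with rfl | rfl <;>
      simp [cornerX] at hcol hlt ⊢ <;> omega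
  rw [shear_side, Int.cast_lt_zero]
  have hpos : 0 < (σ : ℤ) * (cornerX k σ - cornerX k (-σ)) := by
    rcases Int.units_eq_one_or σ with rfl | rfl <;> simp [cornerX] <;> omega
  have := mul_pos hpos hside
  simp only
  linarith


/-- Four zigzag polygons on `2 * k + 4 + r` points that need `2 * (k / 2)` guards. -/
theorem exists_four_zigzags {k r : ℕ} (hk : 2 ≤ k) :
    ∃ A : Set (Set Plane), A ⊆ simplePolygons (grid k r) ∧ A.encard = 4 ∧
      ((2 * (k / 2) : ℕ) : ℕ∞) ≤ guardNumber (grid k r) A := by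
  choose P hP using fun q : ℤˣ × ℤˣ => (grid_biChain (k := k) (r := r) q.1 q.2).exists_region
  have hPinj : Function.Injective P := by
    rintro ⟨σ, τ⟩ ⟨σ', τ'⟩ heq
    have h1 := hP (σ, τ)
    have h2 := hP (σ', τ')
    rw [heq] at h1
    simp only at h1 h2
    generalize P (σ', τ') = Q at h1 h2
    by_cases hτ : τ' = τ
    · subst hτ
      by_cases hσ : σ' = σ
      · rw [hσ]
      · obtain rfl : σ' = -σ := by
          rcases Int.units_eq_one_or σ with rfl | rfl <;>
            rcases Int.units_eq_one_or σ' with rfl | rfl <;> simp_all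
        exact (zigzag_ne_of_neg_left hk h1 h2).elim
    · obtain rfl : τ' = -τ := by
        rcases Int.units_eq_one_or τ with rfl | rfl <;>
          rcases Int.units_eq_one_or τ' with rfl | rfl <;> simp_all
      exact (zigzag_ne_of_neg_right hk h1 h2).elim
  refine ⟨Set.range P, ?_, ?_, le_guardNumber fun G hG hguard => ?_⟩
  · rintro _ ⟨q, rfl⟩
    exact (hP q).mem
  · rw [← Set.image_univ, hPinj.encard_image, Set.encard_univ, ENat.card_eq_coe_fintype_card]
    rfl
  · have hit : ∀ (σ τ : ℤˣ) (i : ℤ), 0 ≤ i → i < k → 0 ≤ i + σ → i + σ < k → ∃ g ∈ G,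
        g = pt (i, -τ) ∨ g = pt (i, (τ : ℤ)) ∨ g = pt (i + σ, (τ : ℤ)) := by
      intro σ τ i h0 h1 h0' h1'
      obtain ⟨g, hg, hseg⟩ := (hguard _ ⟨(σ, τ), rfl⟩).exists_segment_subset
        ((hP (σ, τ)).vertex_mem (consec_column σ τ h0 h1).right_mem.1)
      exact ⟨g, hg, eq_of_sees (hP (σ, τ)) h0 h1 h0' h1' (hG hg) hseg⟩
    classical
    let block : ℕ → Finset Plane := fun j =>
      G ∩ {pt (2 * j, 1), pt (2 * j, -1), pt (2 * j + 1, 1), pt (2 * j + 1, -1)}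
    have hdisj : Set.PairwiseDisjoint (Finset.range (k / 2) : Set ℕ) block := by
      intro j _ j' _ hjj
      rw [Function.onFun, Finset.disjoint_left]
      intro x hx hx'
      simp only [block, Finset.mem_inter, Finset.mem_insert, Finset.mem_singleton] at hx hx'
      obtain ⟨q, rfl⟩ : ∃ q, x = pt q := by
        rcases hx.2 with h | h | h | h <;> exact ⟨_, h⟩
      simp only [pt_injective.eq_iff, Prod.ext_iff] at hx hx'
      omega
    have hcard : ∀ j ∈ Finset.range (k / 2), 2 ≤ (block j).card := by
      intro j hj
      rw [Finset.mem_range] at hj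
      -- The tip is chosen in the left column for `σ = 1` and in the right one for `σ = -1`, so that
      -- the next column belongs to the same block.
      have e1 := hit 1 1 (2 * j) (by omega) (by omega) (by simp; omega) (by simp; omega)
      have e2 := hit 1 (-1) (2 * j) (by omega) (by omega) (by simp; omega) (by simp; omega)
      have e3 := hit (-1) 1 (2 * j + 1) (by omega) (by omega) (by simp) (by simp; omega)
      have e4 := hit (-1) (-1) (2 * j + 1) (by omega) (by omega) (by simp) (by simp; omega)
      simp only [Units.val_one, Units.val_neg, neg_neg, add_neg_cancel_right] at e1 e2 e3 e4
      have n12 : pt (2 * j, 1) ≠ pt (2 * j, -1) := by simp [pt_injective.eq_iff]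
      have n13 : pt (2 * j, 1) ≠ pt (2 * j + 1, 1) := by simp [pt_injective.eq_iff]
      have n14 : pt (2 * j, 1) ≠ pt (2 * j + 1, -1) := by simp [pt_injective.eq_iff]
      have n23 : pt (2 * j, -1) ≠ pt (2 * j + 1, 1) := by simp [pt_injective.eq_iff]
      have n24 : pt (2 * j, -1) ≠ pt (2 * j + 1, -1) := by simp [pt_injective.eq_iff]
      have n34 : pt (2 * j + 1, 1) ≠ pt (2 * j + 1, -1) := by simp [pt_injective.eq_iff]
      exact two_le_card_of_hit n12 n13 n14 n23 n24 n34 e1 e2 e3 e4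
    calc 2 * (k / 2) = ∑ _j ∈ Finset.range (k / 2), 2 := by simp [mul_comm]
      _ ≤ ∑ j ∈ Finset.range (k / 2), (block j).card := Finset.sum_le_sum hcard
      _ = ((Finset.range (k / 2)).biUnion block).card := (Finset.card_biUnion hdisj).symm
      _ ≤ G.card := Finset.card_le_card (Finset.biUnion_subset.2 fun j _ =>
        Finset.inter_subset_left)

/-! ### Inner points and tilted frames -/

/-- No supporting line of `S` passes through `s`. -/
def IsInner (S : Finset Plane) (s : Plane) : Prop :=
  ∀ g : Plane →ₗ[ℝ] ℝ, g ≠ 0 → ∃ t ∈ S, g t < g s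

namespace Frame

variable (F : Frame)

lemma l_ne_zero : F.l ≠ 0 := fun h => by
  have := F.l_f
  simp [h] at this

/-- The frame with level function `l + δ * w`. -/
def tilt (δ : ℝ) : Frame where
  l := F.l + δ • F.w
  w := F.w
  f := F.f
  e := F.e - δ • F.f
  decomp z := by
    have := F.decomp z
    simp only [LinearMap.add_apply, LinearMap.smul_apply, smul_eq_mul]
    nth_rewrite 1 [this]
    module
  l_f := by simp [F.l_f, F.w_f]
  w_f := F.w_f
  l_e := by simp [F.l_f, F.w_f, F.l_e, F.w_e]
  w_e := by simp [F.w_f, F.w_e]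

lemma tilt_l (δ : ℝ) (z : Plane) : (F.tilt δ).l z = F.l z + δ * F.w z := by simp [tilt]

@[simp] lemma tilt_w (δ : ℝ) (z : Plane) : (F.tilt δ).w z = F.w z := rfl

@[simp] lemma tilt_side (δ : ℝ) (x y z : Plane) : (F.tilt δ).side x y z = F.side x y z := by
  simp only [side, tilt_l, tilt_w]
  ring

lemma flip_tilt (δ : ℝ) : (F.tilt δ).flip = F.flip.tilt (-δ) := by
  simp only [tilt, flip, Frame.mk.injEq, true_and]
  refine ⟨by simp, ?_⟩
  module

/-- A frame with given vertical direction. -/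
noncomputable def ofDirection (d : Plane) (hd : d ≠ 0) : Frame where
  l := { toFun := fun z => (d 1 * z 0 - d 0 * z 1) / (d 0 ^ 2 + d 1 ^ 2)
         map_add' := fun x y => by simp; ring
         map_smul' := fun c x => by simp; ring }
  w := { toFun := fun z => (d 0 * z 0 + d 1 * z 1) / (d 0 ^ 2 + d 1 ^ 2)
         map_add' := fun x y => by simp; ring
         map_smul' := fun c x => by simp; ring }
  f := !₂[d 1, -d 0]
  e := d
  decomp z := by
    have h : d 0 ^ 2 + d 1 ^ 2 ≠ 0 := fun h => hd <| by
      ext i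
      fin_cases i <;> simp <;> nlinarith [sq_nonneg (d 0), sq_nonneg (d 1)]
    ext i
    fin_cases i <;> simp <;> field_simp <;> ring
  l_f := by
    have h : d 0 ^ 2 + d 1 ^ 2 ≠ 0 := fun h => hd <| by
      ext i
      fin_cases i <;> simp <;> nlinarith [sq_nonneg (d 0), sq_nonneg (d 1)]
    simp
    field_simp
    ring
  w_f := by
    simp
    left
    ring
  l_e := by
    simp
    left
    ring
  w_e := by
    have h : d 0 ^ 2 + d 1 ^ 2 ≠ 0 := fun h => hd <| by
      ext i
      fin_cases i <;> simp <;> nlinarith [sq_nonneg (d 0), sq_nonneg (d 1)]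
    simp
    field_simp

/-- A tilt so small that it preserves strict inequalities between levels. -/
def SmallTilt (S : Finset Plane) (δ : ℝ) : Prop :=
  δ ≠ 0 ∧ ∀ s ∈ S, ∀ t ∈ S, F.l s < F.l t → (F.tilt δ).l s < (F.tilt δ).l t

/-- Finitely many strict inequalities, all true at `δ = 0`, persist for all small `δ`. -/
lemma exists_smallTilt (S : Finset Plane) :
    ∃ δ > 0, F.SmallTilt S δ ∧ F.SmallTilt S (-δ) := by
  have h : ∀ᶠ δ in nhds (0 : ℝ), ∀ s ∈ S, ∀ t ∈ S, F.l s < F.l t →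
      (F.tilt δ).l s < (F.tilt δ).l t := by
    simp only [tilt_l]
    rw [Filter.eventually_all_finset]
    intro s _
    rw [Filter.eventually_all_finset]
    intro t _
    by_cases hst : F.l s < F.l t
    · have hc : Continuous fun δ : ℝ => F.l t + δ * F.w t - (F.l s + δ * F.w s) := by fun_prop
      filter_upwards [(hc.tendsto 0).eventually_const_lt (u := 0) (by simpa using hst)] with δ hδ _
      linarith
    · exact Filter.Eventually.of_forall fun δ h => absurd h hst
  obtain ⟨ε, hε, h⟩ := Metric.eventually_nhds_iff.1 h
  refine ⟨ε / 2, by positivity, ⟨by positivity, h ?_⟩, ⟨by simpa using hε.ne', h ?_⟩⟩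
  · rw [Real.dist_eq, sub_zero, abs_of_pos (by positivity)]
    linarith
  · rw [Real.dist_eq, sub_zero, abs_neg, abs_of_pos (by positivity)]
    linarith

variable {F} {S : Finset Plane} {δ : ℝ}

lemma SmallTilt.le_of_le (h : F.SmallTilt S δ) {s t : Plane} (hs : s ∈ S) (ht : t ∈ S)
    (hst : (F.tilt δ).l s ≤ (F.tilt δ).l t) : F.l s ≤ F.l t := by
  by_contra hlt
  exact absurd (h.2 t ht s hs (not_le.1 hlt)) (not_lt.2 hst)

/-- A tilt only breaks ties: points on a common vertical line are separated by `δ * w`, and no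
strict order is lost. -/
lemma SmallTilt.injOn (h : F.SmallTilt S δ) : Set.InjOn (F.tilt δ).l S := by
  intro s hs t ht hst
  have h1 : F.l s = F.l t := le_antisymm (h.le_of_le hs ht hst.le) (h.le_of_le ht hs hst.ge)
  refine F.ext_coords h1 ?_
  rw [tilt_l, tilt_l, h1] at hst
  exact mul_left_cancel₀ h.1 (by linarith)

lemma SmallTilt.flip (h : F.SmallTilt S δ) : F.flip.SmallTilt S (-δ) := by
  refine ⟨neg_ne_zero.2 h.1, ?_⟩
  rw [← flip_tilt]
  exact h.2

/-- A supporting line of slope `α` at `s` would make `w - α * l` minimal on `S` at `s`. -/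
lemma not_isLower_of_isInner {s : Plane} (h : IsInner S s) : ¬ F.IsLower S s := by
  rintro ⟨α, hα⟩
  obtain ⟨t, ht, hlt⟩ := h (F.w - α • F.l) fun h0 => by
    have := congrArg (fun g => g F.e) h0
    simp [F.l_e, F.w_e] at this
  have := hα t ht
  simp only [LinearMap.sub_apply, LinearMap.smul_apply, smul_eq_mul] at hlt
  linarith

lemma exists_lt_of_isInner {s : Plane} (h : IsInner S s) : ∃ t ∈ S, F.l t < F.l s :=
  h F.l F.l_ne_zero

lemma exists_gt_of_isInner {s : Plane} (h : IsInner S s) : ∃ t ∈ S, F.l s < F.l t := by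
  obtain ⟨t, ht, hlt⟩ := h (-F.l) (neg_ne_zero.2 F.l_ne_zero)
  exact ⟨t, ht, by simpa using hlt⟩

lemma side_nonpos_of_isLower {x y z : Plane} (hx : x ∈ S) (hy : y ∈ S) (hz : F.IsLower S z)
    (h1 : F.l x < F.l z) (h2 : F.l z < F.l y) : F.side x y z ≤ 0 := by
  obtain ⟨α, hα⟩ := hz
  have e1 := mul_le_mul_of_nonneg_left (hα x hx) (sub_pos.2 h2).le
  have e2 := mul_le_mul_of_nonneg_left (hα y hy) (sub_pos.2 h1).le
  simp only [side]
  nlinarith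

/-- Points straight above an inner point are not on the lower hull, even after a small tilt. -/
lemma SmallTilt.not_isLower (h : F.SmallTilt S δ) {q s : Plane} (hq : IsInner S q) (hqS : q ∈ S)
    (hs : s ∈ S) (hl : F.l s = F.l q) (hw : F.w q < F.w s) : ¬ (F.tilt δ).IsLower S s := by
  rintro ⟨α, hα⟩
  -- Comparison with `q` straight below forces a steep supporting line. Untilted, it would leave no
  -- points of `S` strictly on one side of the vertical line through `q`, contrary to `q` being
  -- inner.
  have h1 : 1 ≤ α * δ := by
    have := hα q hqS
    simp only [tilt_l, tilt_w, hl] at this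
    by_contra hlt
    nlinarith
  rcases h.1.lt_or_gt with hδ | hδ
  · obtain ⟨t, ht, hlt⟩ := F.exists_lt_of_isInner hq
    have h2 := h.2 t ht s hs (hl ▸ hlt)
    have h3 := mul_le_mul_of_nonpos_left (hα t ht) hδ.le
    have h4 := mul_le_mul_of_nonpos_right h1 (sub_neg.2 h2).le
    simp only [tilt_l, tilt_w] at h3 h4
    nlinarith
  · obtain ⟨t, ht, hlt⟩ := F.exists_gt_of_isInner hq
    have h2 := h.2 s hs t ht (hl ▸ hlt)
    have h3 := mul_le_mul_of_nonneg_left (hα t ht) hδ.le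
    have h4 := mul_le_mul_of_nonneg_right h1 (sub_pos.2 h2).le
    simp only [tilt_l, tilt_w] at h3 h4
    nlinarith

end Frame

namespace IsRegionOf

variable {F : Frame} {S : Finset Plane} {U : Set Plane} {a c : Plane} {P : Set Plane}

/-- Close to an upper vertex `b`, the points above the preceding edge are outside. -/
lemma not_segment_subset_left_up (h : IsRegionOf F S U a c P) {x b s : Plane}
    (hb : F.Consec (U ∪ {a, c}) x b) (hl : F.l s < F.l b) (hs : 0 < F.side x b s) :
    ¬ segment ℝ s b ⊆ P := by
  intro hsub
  have h1 := sub_pos.2 hl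
  have h2 := sub_pos.2 hb.lt
  set t := min 1 ((F.l b - F.l x) / (F.l b - F.l s)) with ht
  have ht0 : 0 < t := lt_min one_pos (div_pos h2 h1)
  have ht1 : t ≤ 1 := min_le_left _ _
  have ht2 : t * (F.l b - F.l s) ≤ F.l b - F.l x := (le_div_iff₀ h1).1 (min_le_right _ _)
  have hlz : F.l (t • s + (1 - t) • b) = F.l b - t * (F.l b - F.l s) := by
    simp only [map_add, map_smul, smul_eq_mul]
    ring
  refine h.above x b (t • s + (1 - t) • b) hb ?_ ?_ ?_
    (hsub ⟨t, 1 - t, ht0.le, by linarith, by ring, rfl⟩)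
  · rw [hlz]; linarith
  · rw [hlz]; nlinarith
  · rw [F.side_comb _ _ _ _ (by ring), F.side_right]
    nlinarith

lemma notMem_below (h : IsRegionOf F S U a c P) (hB : BiChain F S U a c) {s z : Plane}
    (hs : s ∈ S) (hsU : s ∉ U) (hsc : F.l s < F.l c) (hl : F.l z = F.l s) (hw : F.w z < F.w s) :
    z ∉ P := by
  obtain ⟨y, hy⟩ := Frame.exists_consec_right (S.finite_toSet.subset Set.sdiff_subset)
    ⟨hs, hsU⟩ ⟨hB.hc, hB.hc'⟩ hsc
  refine h.below s y z hy hl.ge (hl ▸ hy.lt.le) ?_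
  have := mul_pos (sub_pos.2 hy.lt) (sub_pos.2 hw)
  simp only [Frame.side, hl]
  linarith

lemma notMem_above (h : IsRegionOf F S U a c P) (hB : BiChain F S U a c) {s z : Plane}
    (hs : s ∈ U) (hl : F.l z = F.l s) (hw : F.w s < F.w z) : z ∉ P := by
  obtain ⟨y, hy⟩ := Frame.exists_consec_right (S.finite_toSet.subset hB.upper_subset)
    (Or.inl hs) (by simp) (hB.lt_c hs)
  refine h.above s y z hy hl.ge (hl ▸ hy.lt.le) ?_
  have := mul_pos (sub_pos.2 hy.lt) (sub_pos.2 hw)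
  simp only [Frame.side, hl]
  linarith

end IsRegionOf

/-- `P` is the region whose lower chain is the lower hull of `S`. -/
def IsHullRegion (F : Frame) (S : Finset Plane) (P : Set Plane) : Prop :=
  ∃ a c, BiChain F S (F.nonLower S) a c ∧ IsRegionOf F S (F.nonLower S) a c P

lemma exists_min_max {F : Frame} {S : Finset Plane} {p : Plane} (hp : p ∈ S) :
    ∃ a ∈ S, ∃ c ∈ S, (∀ s ∈ S, F.l a ≤ F.l s) ∧ ∀ s ∈ S, F.l s ≤ F.l c := by
  obtain ⟨a, ha, ha'⟩ := S.exists_min_image F.l ⟨p, hp⟩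
  obtain ⟨c, hc, hc'⟩ := S.exists_max_image F.l ⟨p, hp⟩
  exact ⟨a, ha, c, hc, ha', hc'⟩

lemma three_le_card_of_lt {F : Frame} {S : Finset Plane} {a p c : Plane} (ha : a ∈ S)
    (hp : p ∈ S) (hc : c ∈ S) (h1 : F.l a < F.l p) (h2 : F.l p < F.l c) : 3 ≤ S.card := by
  classical
  have : ({a, p, c} : Finset Plane).card = 3 := Finset.card_eq_three.2
    ⟨a, p, c, fun h => by simp [h] at h1, fun h => by rw [h] at h1; linarith,
      fun h => by simp [h] at h2, rfl⟩
  rw [← this]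
  refine Finset.card_le_card fun x hx => ?_
  simp only [Finset.mem_insert, Finset.mem_singleton] at hx
  rcases hx with rfl | rfl | rfl <;> assumption

lemma exists_isHullRegion {F : Frame} {S : Finset Plane} {p : Plane} (hinj : Set.InjOn F.l S)
    (hpS : p ∈ S) (hp : IsInner S p) : ∃ P, IsHullRegion F S P := by
  obtain ⟨a, ha, c, hc, ha', hc'⟩ := exists_min_max (F := F) hpS
  obtain ⟨t, ht, h1⟩ := F.exists_lt_of_isInner hp
  obtain ⟨t', ht', h2⟩ := F.exists_gt_of_isInner hp
  have hB := biChain_nonLower (three_le_card_of_lt ht hpS ht' h1 h2) hinj ha hc ha' hc'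
    ⟨hpS, Frame.not_isLower_of_isInner hp⟩
  obtain ⟨P, hP⟩ := hB.exists_region
  exact ⟨P, a, c, hB, hP⟩

/-- Below an inner point there is a point of the lower hull that survives small tilts. -/
lemma exists_common_low {F : Frame} {S : Finset Plane} {δ δ' : ℝ} (hδ : F.SmallTilt S δ)
    (hδ' : F.SmallTilt S δ') {P P' : Set Plane} (hP : IsHullRegion (F.tilt δ) S P)
    (hP' : IsHullRegion (F.tilt δ') S P') {q : Plane} (hqS : q ∈ S) (hq : IsInner S q) :
    ∃ y ∈ P, y ∈ P' ∧ (F.tilt δ).l y = (F.tilt δ).l q ∧ F.w y < F.w q := by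
  obtain ⟨a, c, hB, hP⟩ := hP
  obtain ⟨a', c', hB', hP'⟩ := hP'
  obtain ⟨x, y, hxy, h1, h2⟩ := hB.exists_low (hB.a_min q hqS) (hB.c_max q hqS)
  have hside := hxy.side_nonneg
  obtain ⟨z, hz, hzl, hzs⟩ := (F.tilt δ).exists_mem_segment_level hxy.lt h1 h2
  have hpos : 0 < (F.tilt δ).side x y q := by
    by_contra hle
    exact Frame.not_isLower_of_isInner hq (Frame.isLower_of_side hxy.lt hside (not_lt.1 hle))
  have hx := (Frame.mem_diff_nonLower.1 hxy.left_mem).1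
  have hy := (Frame.mem_diff_nonLower.1 hxy.right_mem).1
  -- A vertical edge would carry `q` on its line, but `q` is strictly above. Being non-vertical, the
  -- edge keeps its orientation under the other tilt, and `side` does not depend on the tilt.
  have hlt : F.l x < F.l y := by
    have e1 := hδ.le_of_le hx hqS h1
    have e2 := hδ.le_of_le hqS hy h2
    refine lt_of_le_of_ne (e1.trans e2) fun heq => ?_
    rw [F.tilt_side] at hpos
    simp only [Frame.side] at hpos
    have e3 : F.l q = F.l x := by linarith
    rw [e3, ← heq] at hpos
    simp at hpos
  have hlt' := hδ'.2 x hx y hy hlt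
  have hside' : ∀ s ∈ S, 0 ≤ (F.tilt δ').side x y s := fun s hs => by
    simpa using hside s hs
  refine ⟨z, hP.low x y hxy hz, hP'.low x y ⟨?_, ?_, hlt', ?_⟩ hz, hzl, ?_⟩
  · exact Frame.mem_diff_nonLower.2 ⟨hx, Frame.isLower_of_side hlt' hside' (by simp)⟩
  · exact Frame.mem_diff_nonLower.2 ⟨hy, Frame.isLower_of_side hlt' hside' (by simp)⟩
  -- A lower hull point between `x` and `y` in the second tilt would lie on the segment, hence also
  -- between them in the first tilt, where they are consecutive.
  · intro s hs hxs
    by_contra hsy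
    obtain ⟨hsS, hsl⟩ := Frame.mem_diff_nonLower.1 hs
    have hs0 := Frame.side_nonpos_of_isLower hx hy hsl hxs (not_le.1 hsy)
    have hmem := ((F.tilt δ').mem_segment_iff hlt').2
      ⟨hxs.le, (not_le.1 hsy).le, le_antisymm hs0 (hside' s hsS)⟩
    obtain ⟨e1, e2, -⟩ := ((F.tilt δ).mem_segment_iff hxy.lt).1 hmem
    rcases e1.eq_or_lt with e1 | e1
    · rw [hδ.injOn hx hsS e1] at hxs
      exact lt_irrefl _ hxs
    · have := hxy.gap s (Frame.mem_diff_nonLower.2 ⟨hsS, Frame.isLower_of_side hxy.lt hside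
        (by simpa using hs0)⟩) e1
      rw [hδ.injOn hsS hy (le_antisymm e2 this)] at hsy
      exact hsy le_rfl
  · have := sub_pos.2 hxy.lt
    simp only [Frame.tilt_w] at hzs
    by_contra hle
    nlinarith

/-- Opposite small tilts about the direction of two inner points give different regions. -/
lemma hullRegion_ne {F : Frame} {S : Finset Plane} {δ : ℝ} (h0 : 0 < δ) (hδ : F.SmallTilt S δ)
    (hδ' : F.SmallTilt S (-δ)) {P P' : Set Plane} (hP : IsHullRegion (F.tilt δ) S P)
    (hP' : IsHullRegion (F.tilt (-δ)) S P') {p q : Plane} (hpS : p ∈ S)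
    (hqS : q ∈ S) (hq : IsInner S q) (hl : F.l p = F.l q) (hw : F.w q < F.w p) : P ≠ P' := by
  rintro rfl
  obtain ⟨a, c, hB, hP⟩ := hP
  obtain ⟨a', c', hB', hP'⟩ := hP'
  -- Let `t` be the topmost point on the vertical line through `q`. The tilt by `δ` orders this line
  -- upwards, so `t` is reached along the line itself. The tilt by `-δ` orders it downwards, so `t`
  -- is reached from strictly further left. The latter edge lies outside the former region near `t`.
  obtain ⟨t, ht, hmax⟩ := (S.filter fun s => F.l s = F.l q).exists_max_image F.w
    ⟨p, by simp [hpS, hl]⟩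
  simp only [Finset.mem_filter] at ht hmax
  obtain ⟨htS, htl⟩ := ht
  have htw : F.w q < F.w t := hw.trans_le (hmax p ⟨hpS, hl⟩)
  have htU : t ∈ (F.tilt δ).nonLower S := ⟨htS, hδ.not_isLower hq hqS htS htl htw⟩
  have htU' : t ∈ (F.tilt (-δ)).nonLower S := ⟨htS, hδ'.not_isLower hq hqS htS htl htw⟩
  obtain ⟨x', hx'⟩ := Frame.exists_consec_left (S.finite_toSet.subset hB'.upper_subset)
    (Or.inl htU') (by simp) (hB'.a_lt htU')
  obtain ⟨x, hx⟩ := Frame.exists_consec_left (S.finite_toSet.subset hB.upper_subset)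
    (Or.inl htU) (by simp) (hB.a_lt htU)
  have hx'S := hB'.upper_subset hx'.left_mem
  have hxS := hB.upper_subset hx.left_mem
  have e1 : F.l x' < F.l t := by
    refine lt_of_le_of_ne (hδ'.le_of_le hx'S htS hx'.lt.le) fun heq => ?_
    have h1 := hx'.lt
    rw [Frame.tilt_l, Frame.tilt_l, heq] at h1
    have h2 := hmax x' ⟨hx'S, heq.trans htl⟩
    nlinarith
  have hqt : (F.tilt δ).l q < (F.tilt δ).l t := by
    rw [Frame.tilt_l, Frame.tilt_l, htl]
    nlinarith
  have hqx : (F.tilt δ).l q ≤ (F.tilt δ).l x := by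
    by_contra hlt
    exact absurd (hx.gap q (Or.inl ⟨hqS, Frame.not_isLower_of_isInner hq⟩) (not_le.1 hlt))
      (not_le.2 hqt)
  have e2 : F.l x = F.l t := le_antisymm (hδ.le_of_le hxS htS hx.lt.le)
    (htl ▸ hδ.le_of_le hqS hxS hqx)
  have e3 : F.w x < F.w t := by
    have h1 := hx.lt
    rw [Frame.tilt_l, Frame.tilt_l, e2] at h1
    nlinarith
  refine hP.not_segment_subset_left_up hx (hδ.2 x' hx'S t htS e1) ?_ (hP'.up x' t hx')
  rw [Frame.tilt_side]
  have := mul_pos (sub_pos.2 e1) (sub_pos.2 e3)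
  simp only [Frame.side, e2]
  linarith

/-! ### Five polygons for two inner points -/

/-- The points of `S` on or above the broken line through `a`, `p` and `c`. -/
def aboveKink (F : Frame) (S : Finset Plane) (a p c : Plane) : Set Plane :=
  {s | s ∈ S ∧ s ≠ a ∧ s ≠ c ∧
    ((F.l s ≤ F.l p ∧ 0 ≤ F.side a p s) ∨ (F.l p ≤ F.l s ∧ 0 ≤ F.side p c s))}

/-- With `p` on or above the chord, the broken line `a p c` is concave: lower edges stay strictly
below it between `a` and `c`, upper edges on or above it. The point `q` prevents the lower chain
from being the bare chord. -/
lemma biChain_aboveKink {F : Frame} {S : Finset Plane} {a c p q : Plane}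
    (hinj : Set.InjOn F.l S) (ha : a ∈ S) (hc : c ∈ S) (amin : ∀ s ∈ S, F.l a ≤ F.l s)
    (cmax : ∀ s ∈ S, F.l s ≤ F.l c) (hp : p ∈ S) (hap : F.l a < F.l p) (hpc : F.l p < F.l c)
    (hside : 0 ≤ F.side a c p) (hq : q ∈ S) (hqU : q ∉ aboveKink F S a p c) (hqa : q ≠ a)
    (hqc : q ≠ c) : BiChain F S (aboveKink F S a p c) a c where
  ha := ha
  hc := hc
  subset s hs := hs.1
  ha' h := h.2.1 rfl
  hc' h := h.2.2.1 rfl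
  inj := hinj
  a_min := amin
  c_max := cmax
  card := three_le_card_of_lt ha hp hc hap hpc
  sep x y x' y' z z' hl hu hz hz' hlev h1 h2 := by
    have hpU : p ∈ aboveKink F S a p c :=
      ⟨hp, fun h => by rw [h] at hap; exact lt_irrefl _ hap,
        fun h => by rw [h] at hpc; exact lt_irrefl _ hpc, Or.inl ⟨le_rfl, by simp⟩⟩
    have hsubU : ∀ s ∈ aboveKink F S a p c ∪ {a, c}, s ∈ S := by
      rintro s (hs | rfl | rfl)
      exacts [hs.1, ha, hc]
    have hA := sub_pos.2 hap
    have hC := sub_pos.2 hpc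
    -- The two lines compare according to the side of `p` on which `s` lies, so a point below the
    -- relevant piece of the broken line is below both lines.
    have hconc : ∀ s, F.side a p s * (F.l c - F.l p) - F.side p c s * (F.l p - F.l a) =
        F.side a c p * (F.l p - F.l s) := fun s => by
      simp only [Frame.side]
      ring
    have hlow : ∀ s ∈ (S : Set Plane) \ aboveKink F S a p c, s = a ∨ s = c ∨
        (F.side a p s < 0 ∧ F.side p c s < 0) := by
      rintro s ⟨hs, hsU⟩
      by_cases hsa : s = a
      · exact Or.inl hsa
      by_cases hsc : s = c
      · exact Or.inr (Or.inl hsc)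
      refine Or.inr (Or.inr ?_)
      have hn : ¬ ((F.l s ≤ F.l p ∧ 0 ≤ F.side a p s) ∨ (F.l p ≤ F.l s ∧ 0 ≤ F.side p c s)) :=
        fun h => hsU ⟨hs, hsa, hsc, h⟩
      rw [not_or, not_and, not_and, not_le, not_le] at hn
      have := hconc s
      rcases le_total (F.l s) (F.l p) with h | h
      · refine ⟨hn.1 h, ?_⟩
        have e1 := hn.1 h
        by_contra hge
        have e2 := mul_neg_of_neg_of_pos e1 hC
        have e3 := mul_nonneg (not_lt.1 hge) hA.le
        have e4 := mul_nonneg hside (sub_nonneg.2 h)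
        nlinarith
      · refine ⟨?_, hn.2 h⟩
        have e1 := hn.2 h
        by_contra hge
        have e2 := mul_neg_of_neg_of_pos e1 hA
        have e3 := mul_nonneg (not_lt.1 hge) hC.le
        have e4 := mul_nonneg hside (sub_nonneg.2 h)
        nlinarith
    have hac0 : F.side a p c ≤ 0 ∧ F.side p c a ≤ 0 := by
      simp only [Frame.side] at hside ⊢
      constructor <;> linarith
    have hle : ∀ s ∈ (S : Set Plane) \ aboveKink F S a p c,
        F.side a p s ≤ 0 ∧ F.side p c s ≤ 0 := by
      intro s hs
      rcases hlow s hs with rfl | rfl | h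
      · exact ⟨by simp, hac0.2⟩
      · exact ⟨hac0.1, by simp⟩
      · exact ⟨h.1.le, h.2.le⟩
    have hlt : ∀ s ∈ (S : Set Plane) \ aboveKink F S a p c, s ≠ a → s ≠ c →
        F.side a p s < 0 ∧ F.side p c s < 0 := fun s hs h1 h2 =>
      ((hlow s hs).resolve_left h1).resolve_left h2
    have hzlow : F.side a p z < 0 ∧ F.side p c z < 0 := by
      obtain ⟨α, β, hα, hβ, hαβ, rfl⟩ := hz
      rw [F.side_comb _ _ _ _ hαβ, F.side_comb _ _ _ _ hαβ]
      have ex := hle x hl.left_mem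
      have ey := hle y hl.right_mem
      rcases hα.eq_or_lt with rfl | hα'
      · obtain rfl : β = 1 := by linarith
        simp only [zero_smul, one_smul, zero_add] at h1 h2
        have := hlt y hl.right_mem (fun h => h1.ne (by rw [h])) (fun h => h2.ne (by rw [h]))
        simpa using this
      rcases hβ.eq_or_lt with rfl | hβ'
      · obtain rfl : α = 1 := by linarith
        simp only [zero_smul, one_smul, add_zero] at h1 h2
        have := hlt x hl.left_mem (fun h => h1.ne (by rw [h])) (fun h => h2.ne (by rw [h]))
        simpa using this
      have hxc : x ≠ c := fun h => by
        have := hl.lt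
        rw [h] at this
        exact absurd (cmax y hl.right_mem.1) (not_le.2 this)
      have hya : y ≠ a := fun h => by
        have := hl.lt
        rw [h] at this
        exact absurd (amin x hl.left_mem.1) (not_le.2 this)
      by_cases hxa : x = a
      · have hyc : y ≠ c := by
          rintro rfl
          subst hxa
          have h3 : F.l x < F.l q := lt_of_le_of_ne (amin q hq) fun h => hqa (hinj hq ha h.symm)
          exact hqc (hinj hq hc (le_antisymm (cmax q hq) (hl.gap q ⟨hq, hqU⟩ h3)))
        have := hlt y hl.right_mem hya hyc
        constructor
        · nlinarith [mul_neg_of_pos_of_neg hβ' this.1, mul_nonpos_of_nonneg_of_nonpos hα ex.1]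
        · nlinarith [mul_neg_of_pos_of_neg hβ' this.2, mul_nonpos_of_nonneg_of_nonpos hα ex.2]
      · have := hlt x hl.left_mem hxa hxc
        constructor
        · nlinarith [mul_neg_of_pos_of_neg hα' this.1, mul_nonpos_of_nonneg_of_nonpos hβ ey.1]
        · nlinarith [mul_neg_of_pos_of_neg hα' this.2, mul_nonpos_of_nonneg_of_nonpos hβ ey.2]
    have hupL : ∀ s ∈ aboveKink F S a p c ∪ {a, c}, F.l s ≤ F.l p → 0 ≤ F.side a p s := by
      rintro s (hs | rfl | rfl) h
      · rcases hs.2.2.2 with h' | h'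
        · exact h'.2
        · rw [hinj hs.1 hp (le_antisymm h h'.1)]
          simp
      · simp
      · exact absurd hpc (not_lt.2 h)
    have hupR : ∀ s ∈ aboveKink F S a p c ∪ {a, c}, F.l p ≤ F.l s → 0 ≤ F.side p c s := by
      rintro s (hs | rfl | rfl) h
      · rcases hs.2.2.2 with h' | h'
        · rw [hinj hs.1 hp (le_antisymm h'.1 h)]
          simp
        · exact h'.2
      · exact absurd hap (not_lt.2 h)
      · simp
    by_cases hxp : F.l x' < F.l p
    · have hyp := hu.gap p (Or.inl hpU) hxp
      have h3 := pos_of_mem_segment hz' (hupL x' hu.left_mem hxp.le) (hupL y' hu.right_mem hyp)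
      have h4 := hzlow.1
      simp only [Frame.side, hlev] at h3 h4
      nlinarith
    · have hpx := not_lt.1 hxp
      have h3 := pos_of_mem_segment hz' (hupR x' hu.left_mem hpx)
        (hupR y' hu.right_mem (hpx.trans hu.lt.le))
      have h4 := hzlow.2
      simp only [Frame.side, hlev] at h3 h4
      nlinarith

lemma exists_region_aboveKink {F : Frame} {S : Finset Plane} {a c p q : Plane}
    (hinj : Set.InjOn F.l S) (ha : a ∈ S) (hc : c ∈ S) (amin : ∀ s ∈ S, F.l a ≤ F.l s)
    (cmax : ∀ s ∈ S, F.l s ≤ F.l c) (hp : p ∈ S) (hap : F.l a < F.l p) (hpc : F.l p < F.l c)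
    (hside : 0 ≤ F.side a c p) (hq : q ∈ S) (hqU : q ∉ aboveKink F S a p c)
    (haq : F.l a < F.l q) (hqc : F.l q < F.l c) : ∃ X ∈ simplePolygons S,
      (∀ z, F.l z = F.l q → F.w z < F.w q → z ∉ X) ∧
      ∀ z, F.l z = F.l p → F.w p < F.w z → z ∉ X := by
  have hB := biChain_aboveKink hinj ha hc amin cmax hp hap hpc hside hq hqU
    (fun h => haq.ne (by rw [h])) fun h => hqc.ne (by rw [h])
  obtain ⟨X, hX⟩ := hB.exists_region
  refine ⟨X, hX.mem, fun z h1 h2 => hX.notMem_below hB hq hqU hqc h1 h2, fun z h1 h2 =>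
    hX.notMem_above hB ?_ h1 h2⟩
  exact ⟨hp, fun h => hap.ne (by rw [h]), fun h => hpc.ne (by rw [h]), Or.inl ⟨le_rfl, by simp⟩⟩

/-- A polygon that passes below the upper and above the lower of two inner points. -/
lemma exists_region_kink {F : Frame} {S : Finset Plane} {δ : ℝ} (h0 : 0 < δ)
    (hδ : F.SmallTilt S δ) {p q : Plane} (hpS : p ∈ S) (hqS : q ∈ S) (hp : IsInner S p)
    (hq : IsInner S q) (hl : F.l p = F.l q) (hw : F.w q < F.w p) : ∃ X ∈ simplePolygons S,
      (∀ z, (F.tilt δ).l z = (F.tilt δ).l q → F.w z < F.w q → z ∉ X) ∧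
      ∀ z, (F.tilt δ).l z = (F.tilt δ).l p → F.w p < F.w z → z ∉ X := by
  obtain ⟨a, ha, c, hc, amin, cmax⟩ := exists_min_max (F := F.tilt δ) hpS
  have hqp : (F.tilt δ).l q < (F.tilt δ).l p := by
    rw [Frame.tilt_l, Frame.tilt_l, hl]
    nlinarith
  obtain ⟨t, ht, h1⟩ := (F.tilt δ).exists_lt_of_isInner hq
  obtain ⟨t', ht', h2⟩ := (F.tilt δ).exists_gt_of_isInner hp
  have haq := (amin t ht).trans_lt h1
  have hpc := h2.trans_le (cmax t' ht')
  have haF : F.l a < F.l q := by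
    obtain ⟨t, ht, h⟩ := F.exists_lt_of_isInner hq
    exact (hδ.le_of_le ha ht (amin t ht)).trans_lt h
  have hcF : F.l p < F.l c := by
    obtain ⟨t, ht, h⟩ := F.exists_gt_of_isInner hp
    exact h.trans_le (hδ.le_of_le ht hc (cmax t ht))
  -- If `p` is below the chord from `a` to `c`, then so is `q`, and the flipped picture applies with
  -- `q` as the kink.
  rcases le_or_gt 0 ((F.tilt δ).side a c p) with hside | hside
  · refine exists_region_aboveKink hδ.injOn ha hc amin cmax hpS (haq.trans hqp) hpc hside hqS ?_
      haq (hqp.trans hpc)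
    rintro ⟨-, -, -, h | h⟩
    · have := h.2
      rw [Frame.tilt_side] at this
      simp only [Frame.side, hl] at this
      rw [hl] at hcF
      nlinarith
    · exact absurd hqp (not_lt.2 h.1)
  · have hside' : 0 ≤ (F.tilt δ).flip.side a c q := by
      rw [Frame.tilt_side] at hside
      rw [Frame.flip_side, Frame.tilt_side]
      simp only [Frame.side, hl] at hside ⊢
      nlinarith
    have hpU : p ∉ aboveKink (F.tilt δ).flip S a q c := by
      rintro ⟨-, -, -, h | h⟩
      · exact absurd hqp (not_lt.2 h.1)
      · have := h.2
        rw [Frame.flip_side, Frame.tilt_side] at this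
        simp only [Frame.side, hl] at this
        rw [hl] at hcF
        nlinarith
    obtain ⟨X, hX, h3, h4⟩ := exists_region_aboveKink (F := (F.tilt δ).flip) hδ.injOn ha hc amin
      cmax hqS haq (hqp.trans hpc) hside' hpS hpU (haq.trans hqp) hpc
    exact ⟨X, hX, fun z h5 h6 => h4 z h5 (by simpa using h6),
      fun z h5 h6 => h3 z h5 (by simpa using h6)⟩

lemma IsHullRegion.mem {F : Frame} {S : Finset Plane} {P : Set Plane} (h : IsHullRegion F S P) :
    P ∈ simplePolygons S := by
  obtain ⟨a, c, -, h⟩ := h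
  exact h.mem

lemma IsHullRegion.notMem_above {F : Frame} {S : Finset Plane} {P : Set Plane}
    (h : IsHullRegion F S P) {p z : Plane} (hpS : p ∈ S) (hp : IsInner S p)
    (hl : F.l z = F.l p) (hw : F.w p < F.w z) : z ∉ P := by
  obtain ⟨a, c, hB, h⟩ := h
  exact h.notMem_above hB ⟨hpS, Frame.not_isLower_of_isInner hp⟩ hl hw

/-- Two distinct points on a common vertical line. -/
lemma exists_frame (x y : Plane) (h : x ≠ y) : ∃ F : Frame, F.l x = F.l y ∧ F.w y = F.w x + 1 := by
  refine ⟨Frame.ofDirection (y - x) (sub_ne_zero.2 h.symm), ?_⟩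
  have h1 := (Frame.ofDirection (y - x) (sub_ne_zero.2 h.symm)).l_e
  have h2 := (Frame.ofDirection (y - x) (sub_ne_zero.2 h.symm)).w_e
  change (Frame.ofDirection (y - x) (sub_ne_zero.2 h.symm)).l (y - x) = 0 at h1
  change (Frame.ofDirection (y - x) (sub_ne_zero.2 h.symm)).w (y - x) = 1 at h2
  rw [map_sub] at h1 h2
  exact ⟨by linarith, by linarith⟩

/-- Put `p` above `q`. Two tilts give regions `U₁`, `U₂` bounded by the lower hull and, flipped,
`D₁`, `D₂` bounded by the upper hull. The fifth region `X` separates `p` from `q` and contains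
points neither just above `p` nor just below `q`. -/
theorem five_le_of_two_inner {S : Finset Plane} {p q : Plane} (hpS : p ∈ S) (hqS : q ∈ S)
    (hp : IsInner S p) (hq : IsInner S q) (hpq : p ≠ q) : 5 ≤ (simplePolygons S).encard := by
  obtain ⟨F, hl, hw⟩ := exists_frame q p hpq.symm
  replace hl := hl.symm
  replace hw : F.w q < F.w p := by linarith
  obtain ⟨δ, h0, hδ, hδ'⟩ := F.exists_smallTilt S
  obtain ⟨U₁, hU₁⟩ := exists_isHullRegion hδ.injOn hpS hp
  obtain ⟨U₂, hU₂⟩ := exists_isHullRegion hδ'.injOn hpS hp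
  obtain ⟨D₁, hD₁⟩ := exists_isHullRegion hδ.flip.injOn hpS hp
  obtain ⟨D₂, hD₂⟩ := exists_isHullRegion hδ'.flip.injOn hpS hp
  obtain ⟨X, hX, hXq, hXp⟩ := exists_region_kink h0 hδ hpS hqS hp hq hl hw
  have hwf : F.flip.w p < F.flip.w q := by simpa using hw
  -- The witnesses `y₁` and `y₃` lie below `q` and `y₂` lies above `p`. Exclusion needs the same
  -- level in the tilt of the other region, so `y₁` serves `D₁` and `X` while `y₃` serves `D₂`.
  obtain ⟨y₁, hy₁, hy₁', hy₁l, hy₁w⟩ := exists_common_low hδ hδ' hU₁ hU₂ hqS hq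
  obtain ⟨y₂, hy₂, hy₂', hy₂l, hy₂w⟩ := exists_common_low hδ.flip hδ'.flip hD₁ hD₂ hpS hp
  obtain ⟨y₃, hy₃, -, hy₃l, hy₃w⟩ := exists_common_low hδ' hδ hU₂ hU₁ hqS hq
  have e1 : U₁ ≠ U₂ := hullRegion_ne h0 hδ hδ' hU₁ hU₂ hpS hqS hq hl hw
  have e2 : D₂ ≠ D₁ := by
    refine hullRegion_ne h0 ?_ hδ.flip ?_ hD₁ hqS hpS hp hl.symm hwf
    · simpa using hδ'.flip
    · simpa using hD₂
  rw [← Frame.flip_tilt] at hD₁ hD₂ hy₂l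
  have hw1 : (F.tilt δ).flip.w q < (F.tilt δ).flip.w y₁ := by simpa using hy₁w
  have hw2 : (F.tilt δ).w p < (F.tilt δ).w y₂ := by simpa using hy₂w
  have hw3 : (F.tilt (-δ)).flip.w q < (F.tilt (-δ)).flip.w y₃ := by simpa using hy₃w
  have n1 : y₁ ∉ D₁ := hD₁.notMem_above hqS hq hy₁l hw1
  have n2 : y₂ ∉ U₁ := hU₁.notMem_above hpS hp hy₂l hw2
  have n3 : y₃ ∉ D₂ := hD₂.notMem_above hqS hq hy₃l hw3
  have n4 : y₁ ∉ X := hXq y₁ hy₁l hy₁w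
  have n5 : y₂ ∉ X := hXp y₂ hy₂l hw2
  have hsub : ({U₁, U₂, D₁, D₂, X} : Set (Set Plane)) ⊆ simplePolygons S := by
    rintro P (rfl | rfl | rfl | rfl | rfl)
    exacts [hU₁.mem, hU₂.mem, hD₁.mem, hD₂.mem, hX]
  refine le_trans ?_ (Set.encard_le_encard hsub)
  have f1 : U₁ ≠ D₁ := fun h => n2 (h ▸ hy₂)
  have f2 : U₁ ≠ D₂ := fun h => n2 (h ▸ hy₂')
  have f3 : U₂ ≠ D₁ := fun h => n1 (h ▸ hy₁')
  have f4 : U₂ ≠ D₂ := fun h => n3 (h ▸ hy₃)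
  have f5 : U₁ ≠ X := fun h => n4 (h ▸ hy₁)
  have f6 : U₂ ≠ X := fun h => n4 (h ▸ hy₁')
  have f7 : D₁ ≠ X := fun h => n5 (h ▸ hy₂)
  have f8 : D₂ ≠ X := fun h => n5 (h ▸ hy₂')
  rw [Set.encard_insert_of_notMem (by simp [e1, f1, f2, f5]),
    Set.encard_insert_of_notMem (by simp [f3, f4, f6]),
    Set.encard_insert_of_notMem (by simp [e2.symm, f7]),
    Set.encard_insert_of_notMem (by simp [f8]), Set.encard_singleton]
  norm_num

/-! ### Edges of a simple polygon between points that are not inner -/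

lemma forall_of_finRotate {n : ℕ} (hn : 2 ≤ n) {Q : Fin n → Prop} {i : Fin n} (hi : Q i)
    (h : ∀ j, Q j → Q (finRotate n j)) (j : Fin n) : Q j := by
  obtain ⟨m, rfl⟩ := Nat.exists_eq_add_of_le' hn
  have hne : ∀ x : Fin (m + 2), finRotate (m + 2) x ≠ x := fun x => by
    rw [finRotate_apply]
    simp
  obtain ⟨t, rfl⟩ := isCycle_finRotate.exists_pow_eq (hne i) (hne j)
  induction t with
  | zero => exact hi
  | succ t ih =>
    rw [pow_succ', Equiv.Perm.mul_apply]
    exact h _ ih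

/-- Without further zeros or sign changes, a sign propagates forward around the cycle up to the
predecessor of `i`. Applied to `f` and to `-f`, this gives that predecessor both signs. -/
lemma exists_sign_change {n : ℕ} (hn : 2 ≤ n) {f : Fin n → ℝ} {i s t : Fin n} (hi : f i = 0)
    (hi' : f (finRotate n i) = 0) (hs : f s < 0) (ht : 0 < f t) :
    ∃ j, (f j = 0 ∧ j ≠ i ∧ j ≠ finRotate n i) ∨ f j * f (finRotate n j) < 0 := by
  by_contra! hno
  have key : ∀ g : Fin n → ℝ, g i = 0 → (∀ j, g j = 0 → j ≠ i → j = finRotate n i) →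
      (∀ j, 0 ≤ g j * g (finRotate n j)) → g (finRotate n i) = 0 → ∀ t, 0 < g t →
      0 < g ((finRotate n).symm i) := by
    intro g h1 h2 h3 h4 t ht
    by_contra hle
    have hall : ∀ j, 0 < g j := forall_of_finRotate hn ht fun j hj => by
      by_contra hj'
      have h0 : g (finRotate n j) = 0 := by
        have := h3 j
        nlinarith
      by_cases hji : finRotate n j = i
      · rw [← hji, Equiv.symm_apply_apply] at hle
        exact hle hj
      · have := (finRotate n).injective (h2 _ h0 hji)
        rw [this, h1] at hj
        exact lt_irrefl _ hj
    exact (hall i).ne' h1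
  have e1 := key f hi (fun j h1 h2 => (hno j).1 h1 h2) (fun j => (hno j).2) hi' t ht
  have e2 := key (-f) (by simp [hi]) (fun j h1 h2 => (hno j).1 (by simpa using h1) h2)
    (fun j => by simpa using (hno j).2) (by rw [Pi.neg_apply, hi', neg_zero]) s (by simpa using hs)
  simp only [Pi.neg_apply] at e2
  linarith

namespace IsSimple

variable {n : ℕ} {v : Polygon Plane n}

lemma eq_of_mem_edges (hv : IsSimple v) {i j : Fin n} (hij : i ≠ j) {z : Plane}
    (hi : z ∈ segment ℝ (v i) (v (finRotate n i)))
    (hj : z ∈ segment ℝ (v j) (v (finRotate n j))) :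
    (i = finRotate n j ∧ z = v i) ∨ (j = finRotate n i ∧ z = v j) := by
  rw [← edgeSet_eq_segment] at hi hj
  by_cases h1 : i = finRotate n j
  · left
    subst h1
    have : z ∈ v.edgeSet ℝ j ∩ v.edgeSet ℝ (finRotate n j) := ⟨hj, hi⟩
    rw [hv.consecutive] at this
    exact ⟨rfl, this⟩
  by_cases h2 : j = finRotate n i
  · right
    subst h2
    have : z ∈ v.edgeSet ℝ i ∩ v.edgeSet ℝ (finRotate n i) := ⟨hi, hj⟩
    rw [hv.consecutive] at this
    exact ⟨rfl, this⟩
  exact absurd hj (Set.disjoint_left.1 (hv.disjoint i j hij.symm h2 h1) hi)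

lemma apply_inj (hv : IsSimple v) {i j : Fin n} (h : v i = v j) : i = j := hv.injective h

lemma eq_of_vertex_mem (hv : IsSimple v) {i j : Fin n}
    (h : v j ∈ segment ℝ (v i) (v (finRotate n i))) : j = i ∨ j = finRotate n i := by
  by_cases hij : i = j
  · exact Or.inl hij.symm
  rcases hv.eq_of_mem_edges hij h (left_mem_segment ℝ _ _) with ⟨-, h2⟩ | ⟨h1, -⟩
  · exact absurd (hv.apply_inj h2).symm hij
  · exact Or.inr h1

end IsSimple

lemma le_of_mem_convexHull {S : Finset Plane} (g : Plane →ₗ[ℝ] ℝ) {b : ℝ}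
    (h : ∀ s ∈ S, b ≤ g s) {z : Plane} (hz : z ∈ convexHull ℝ (S : Set Plane)) : b ≤ g z :=
  convexHull_min (t := {z | b ≤ g z}) h (convex_halfSpace_ge g.isLinear b) hz

lemma Frame.apply_sub (F : Frame) (g : Plane →ₗ[ℝ] ℝ) (x y : Plane) :
    g y - g x = (F.l y - F.l x) * g F.f + (F.w y - F.w x) * g F.e := by
  conv_lhs => rw [F.decomp x, F.decomp y]
  simp only [map_add, map_smul, smul_eq_mul]
  ring

section

variable {n : ℕ} {v : Polygon Plane n} {S : Finset Plane}

lemma vertex_mem_of_range (hS : Set.range v.vertices = (S : Set Plane)) (j : Fin n) : v j ∈ S := by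
  have : v j ∈ Set.range v.vertices := ⟨j, rfl⟩
  rwa [hS] at this

lemma exists_vertex_of_range (hS : Set.range v.vertices = (S : Set Plane)) {s : Plane}
    (hs : s ∈ S) : ∃ j, v j = s := by
  have : s ∈ Set.range v.vertices := by rwa [hS]
  exact this

end

/-- An edge of a simple polygon between two points that are not inner lies on a supporting
line. -/
theorem exists_support_of_edge {n : ℕ} {v : Polygon Plane n} (hv : IsSimple v) {S : Finset Plane}
    (hS : Set.range v.vertices = (S : Set Plane)) {i : Fin n} (h1 : ¬ IsInner S (v i))
    (h2 : ¬ IsInner S (v (finRotate n i))) :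
    ∃ g : Plane →ₗ[ℝ] ℝ, g ≠ 0 ∧ g (v i) = g (v (finRotate n i)) ∧ ∀ s ∈ S, g (v i) ≤ g s := by
  have hmem := vertex_mem_of_range hS
  have hrot := finRotate_ne hv.three_le i
  obtain ⟨F, hl, hw⟩ := exists_frame (v i) (v (finRotate n i)) fun h =>
    hrot (hv.apply_inj h).symm
  by_cases hpos : ∀ s ∈ S, F.l (v i) ≤ F.l s
  · exact ⟨F.l, F.l_ne_zero, hl, hpos⟩
  by_cases hneg : ∀ s ∈ S, F.l s ≤ F.l (v i)
  · exact ⟨-F.l, neg_ne_zero.2 F.l_ne_zero, by simp [hl], fun s hs => by simpa using hneg s hs⟩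
  push Not at hpos hneg
  obtain ⟨s, hs, hsl⟩ := hpos
  obtain ⟨t, ht, htl⟩ := hneg
  obtain ⟨s, rfl⟩ := exists_vertex_of_range hS hs
  obtain ⟨t, rfl⟩ := exists_vertex_of_range hS ht
  -- With points of `S` on both sides of the line of the edge, the polygon must meet that line
  -- again, and simplicity puts the meeting point off the edge.
  obtain ⟨z, hzS, hzl, hz⟩ : ∃ z ∈ convexHull ℝ (S : Set Plane), F.l z = F.l (v i) ∧
      z ∉ segment ℝ (v i) (v (finRotate n i)) := by
    obtain ⟨j, ⟨h0, h3, h4⟩ | hlt⟩ := exists_sign_change (f := fun j => F.l (v j) - F.l (v i))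
      (by linarith [hv.three_le]) (sub_self _) (by simp [hl]) (sub_neg.2 hsl) (sub_pos.2 htl)
    · refine ⟨v j, subset_convexHull ℝ _ (hmem j), sub_eq_zero.1 h0, fun h => ?_⟩
      rcases hv.eq_of_vertex_mem h with h | h
      exacts [h3 h, h4 h]
    · have hcont : ContinuousOn F.l (segment ℝ (v j) (v (finRotate n j))) :=
        F.continuous_l.continuousOn
      have hpre := (convex_segment (𝕜 := ℝ) (v j) (v (finRotate n j))).isPreconnected.image
        F.l hcont
      have hmemc : F.l (v i) ∈ F.l '' segment ℝ (v j) (v (finRotate n j)) := by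
        have ha := Set.mem_image_of_mem F.l (left_mem_segment ℝ (v j) (v (finRotate n j)))
        have hb := Set.mem_image_of_mem F.l (right_mem_segment ℝ (v j) (v (finRotate n j)))
        rcases mul_neg_iff.1 hlt with ⟨h3, h4⟩ | ⟨h3, h4⟩
        · exact hpre.Icc_subset hb ha ⟨(sub_neg.1 h4).le, (sub_pos.1 h3).le⟩
        · exact hpre.Icc_subset ha hb ⟨(sub_neg.1 h3).le, (sub_pos.1 h4).le⟩
      obtain ⟨z, hz, hzl⟩ := hmemc
      refine ⟨z, ?_, hzl, fun h => ?_⟩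
      · exact (convex_convexHull ℝ _).segment_subset (subset_convexHull ℝ _ (hmem _))
          (subset_convexHull ℝ _ (hmem _)) hz
      · have hij : i ≠ j := by
          rintro rfl
          simp at hlt
        rcases hv.eq_of_mem_edges hij h hz with ⟨h3, -⟩ | ⟨h3, -⟩
        · rw [← h3] at hlt
          simp at hlt
        · rw [h3, hl] at hlt
          simp at hlt
  have hout : F.w z < F.w (v i) ∨ F.w (v (finRotate n i)) < F.w z := by
    by_contra! hc
    exact hz (F.mem_segment_vertical hzl.symm (by rw [← hl, hzl]) hc.1 hc.2)
  -- Here `x` is strictly between `y` and `z`, so a functional that is minimal at `x` is constant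
  -- along the line.
  have key : ∀ x ∈ S, ∀ y ∈ S, ¬ IsInner S x → F.l y = F.l x →
      (F.w y - F.w x) * (F.w z - F.w x) < 0 → F.l z = F.l x → ∃ g : Plane →ₗ[ℝ] ℝ, g ≠ 0 ∧
        g x = g y ∧ ∀ s ∈ S, g x ≤ g s := by
    intro x hx y hy hin hyl hneg hzl
    simp only [IsInner] at hin
    push Not at hin
    obtain ⟨g, hg, hgS⟩ := hin
    have e1 := F.apply_sub g x y
    have e2 := F.apply_sub g x z
    rw [hyl] at e1
    rw [hzl] at e2
    have e3 := hgS y hy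
    have e4 := le_of_mem_convexHull g hgS hzS
    have e5 : g F.e = 0 := by
      by_contra hne
      have h5 : 0 < (g F.e) ^ 2 := by positivity
      have h6 : 0 ≤ (g y - g x) * (g z - g x) :=
        mul_nonneg (sub_nonneg.2 e3) (sub_nonneg.2 e4)
      rw [e1, e2] at h6
      nlinarith
    refine ⟨g, hg, ?_, hgS⟩
    rw [e5] at e1
    linarith
  rcases hout with h | h
  · exact key _ (hmem _) _ (hmem _) h1 hl.symm (by nlinarith) hzl
  · obtain ⟨g, h3, h4, h5⟩ := key _ (hmem (finRotate n i)) _ (hmem i) h2 hl (by nlinarith)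
      (hzl.trans hl)
    exact ⟨g, h3, h4.symm, h4 ▸ h5⟩

/-- `x` and `y` are neighbouring points of `S` on a supporting line of `S`. -/
structure HullEdge (S : Finset Plane) (x y : Plane) : Prop where
  left_mem : x ∈ S
  right_mem : y ∈ S
  ne : x ≠ y
  support : ∃ g : Plane →ₗ[ℝ] ℝ, g ≠ 0 ∧ g x = g y ∧ ∀ s ∈ S, g x ≤ g s
  gap : ∀ s ∈ S, s ∈ segment ℝ x y → s = x ∨ s = y

/-- Three extreme directions `(0, 1)`, `(a, b)` and `(a', b')` of a planar cone cannot be distinct. -/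
lemma exists_ray_of_support {a b a' b' α α' β' α'' β'' : ℝ} (hα : α ≠ 0) (h₁ : 0 ≤ a * α)
    (h₁' : 0 ≤ a' * α) (h₂ : ¬ (α' = 0 ∧ β' = 0)) (e₂ : a * α' + b * β' = 0) (hβ' : 0 ≤ β')
    (h₂' : 0 ≤ a' * α' + b' * β') (h₃ : ¬ (α'' = 0 ∧ β'' = 0)) (e₃ : a' * α'' + b' * β'' = 0)
    (hβ'' : 0 ≤ β'') (h₃' : 0 ≤ a * α'' + b * β'') (n₂ : ¬ (a = 0 ∧ b = 0))
    (n₃ : ¬ (a' = 0 ∧ b' = 0)) :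
    (a = 0 ∧ 0 < b) ∨ (a' = 0 ∧ 0 < b') ∨ ∃ t > 0, a' = t * a ∧ b' = t * b := by
  by_cases ha : a = 0
  · subst ha
    rcases lt_or_gt_of_ne (not_and.1 n₂ rfl) with hb | hb
    · obtain rfl : β'' = 0 := by nlinarith
      have hα : α'' ≠ 0 := fun h => h₃ ⟨h, rfl⟩
      obtain rfl : a' = 0 := by
        have : a' * α'' = 0 := by linarith
        exact (mul_eq_zero.1 this).resolve_right hα
      rcases lt_or_gt_of_ne (not_and.1 n₃ rfl) with hb' | hb'
      · exact Or.inr (Or.inr ⟨b' / b, div_pos_of_neg_of_neg hb' hb, by simp,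
          (div_mul_cancel₀ b' hb.ne).symm⟩)
      · exact Or.inr (Or.inl ⟨rfl, hb'⟩)
    · exact Or.inl ⟨rfl, hb⟩
  by_cases ha' : a' = 0
  · subst ha'
    rcases lt_or_gt_of_ne (not_and.1 n₃ rfl) with hb' | hb'
    · obtain rfl : β' = 0 := by nlinarith
      have hα : α' ≠ 0 := fun h => h₂ ⟨h, rfl⟩
      have : a * α' = 0 := by linarith
      exact absurd ((mul_eq_zero.1 this).resolve_right hα) ha
    · exact Or.inr (Or.inl ⟨rfl, hb'⟩)
  have haa : 0 < a * a' := by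
    have h1 : 0 ≤ a * a' * α ^ 2 := by
      have := mul_nonneg h₁ h₁'
      linarith
    exact lt_of_le_of_ne (nonneg_of_mul_nonneg_left h1 (by positivity)) (mul_ne_zero ha ha').symm
  have hβ' : 0 < β' := by
    refine lt_of_le_of_ne hβ' fun h0 => h₂ ⟨?_, h0.symm⟩
    subst h0
    have : a * α' = 0 := by linarith
    exact (mul_eq_zero.1 this).resolve_left ha
  have hβ'' : 0 < β'' := by
    refine lt_of_le_of_ne hβ'' fun h0 => h₃ ⟨?_, h0.symm⟩
    subst h0
    have : a' * α'' = 0 := by linarith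
    exact (mul_eq_zero.1 this).resolve_left ha'
  have q1 : 0 ≤ a * (a * b' - a' * b) := by
    refine nonneg_of_mul_nonneg_right (a := β') ?_ hβ'
    have h1 : β' * (a * (a * b' - a' * b)) = a ^ 2 * (a' * α' + b' * β') := by
      linear_combination (-a * a') * e₂
    rw [h1]
    positivity
  have q2 : 0 ≤ a' * (a' * b - a * b') := by
    refine nonneg_of_mul_nonneg_right (a := β'') ?_ hβ''
    have h1 : β'' * (a' * (a' * b - a * b')) = a' ^ 2 * (a * α'' + b * β'') := by
      linear_combination (-a * a') * e₃
    rw [h1]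
    positivity
  have q3 : a * b' - a' * b = 0 := by
    by_contra hne
    have h1 : 0 < (a * b' - a' * b) ^ 2 := by positivity
    nlinarith [mul_nonneg q1 q2, mul_pos haa h1]
  refine Or.inr (Or.inr ⟨a' / a, ?_, (div_mul_cancel₀ a' ha).symm, ?_⟩)
  · have : a' / a = a * a' / a ^ 2 := by field_simp
    rw [this]
    positivity
  · field_simp
    linarith

/-! ### Hull edges at a point, and uniqueness of the polygon without inner points. -/

namespace HullEdge

variable {S : Finset Plane} {x y y' y'' : Plane}

lemma symm (h : HullEdge S x y) : HullEdge S y x where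
  left_mem := h.right_mem
  right_mem := h.left_mem
  ne := h.ne.symm
  support := by
    obtain ⟨g, h1, h2, h3⟩ := h.support
    exact ⟨g, h1, h2.symm, h2 ▸ h3⟩
  gap s hs hxy := (h.gap s hs (segment_symm ℝ x y ▸ hxy)).symm

/-- Of two edges in the same direction the shorter ends on the longer, which `gap` allows only at an
endpoint. -/
lemma eq_of_ray (h : HullEdge S x y) (h' : HullEdge S x y') {F : Frame} {t : ℝ} (ht : 0 < t)
    (h1 : F.l y' - F.l x = t * (F.l y - F.l x)) (h2 : F.w y' - F.w x = t * (F.w y - F.w x)) :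
    y = y' := by
  have key : ∀ {y y' : Plane} {t : ℝ}, HullEdge S x y → HullEdge S x y' → 0 ≤ t → t ≤ 1 →
      F.l y' - F.l x = t * (F.l y - F.l x) → F.w y' - F.w x = t * (F.w y - F.w x) → y = y' := by
    intro y y' t h h' h0 ht1 h1 h2
    have hz : y' ∈ segment ℝ x y := by
      refine ⟨1 - t, t, by linarith, h0, by ring, F.ext_coords ?_ ?_⟩
      · simp only [map_add, map_smul, smul_eq_mul]
        linarith
      · simp only [map_add, map_smul, smul_eq_mul]
        linarith
    rcases h.gap y' h'.right_mem hz with h3 | h3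
    · exact absurd h3.symm h'.ne
    · exact h3.symm
  rcases le_total t 1 with h3 | h3
  · exact key h h' ht.le h3 h1 h2
  · refine (key h' h (inv_nonneg.2 ht.le) (inv_le_one_of_one_le₀ h3) ?_ ?_).symm
    · rw [h1, inv_mul_cancel_left₀ ht.ne']
    · rw [h2, inv_mul_cancel_left₀ ht.ne']

/-- A point has at most two hull edges. -/
lemma eq_or_eq (h : HullEdge S x y) (h' : HullEdge S x y') (h'' : HullEdge S x y'') :
    y = y' ∨ y = y'' ∨ y' = y'' := by
  obtain ⟨F, hl, hw⟩ := exists_frame x y h.ne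
  obtain ⟨g, hg, hgy, hgS⟩ := h.support
  obtain ⟨g', hg', hgy', hgS'⟩ := h'.support
  obtain ⟨g'', hg'', hgy'', hgS''⟩ := h''.support
  have hcoord : ∀ g : Plane →ₗ[ℝ] ℝ, g F.f = 0 → g F.e = 0 → g = 0 := fun g h1 h2 => by
    ext z
    have := F.apply_sub g 0 z
    simpa [h1, h2] using this
  have A1 := F.apply_sub g x y
  have A2 := F.apply_sub g x y'
  have A3 := F.apply_sub g x y''
  have B1 := F.apply_sub g' x y
  have B2 := F.apply_sub g' x y'
  have B3 := F.apply_sub g' x y''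
  have C1 := F.apply_sub g'' x y
  have C2 := F.apply_sub g'' x y'
  have C3 := F.apply_sub g'' x y''
  have A2' := sub_nonneg.2 (hgS y' h'.right_mem)
  have A3' := sub_nonneg.2 (hgS y'' h''.right_mem)
  have B1' := sub_nonneg.2 (hgS' y h.right_mem)
  have B3' := sub_nonneg.2 (hgS' y'' h''.right_mem)
  have C1' := sub_nonneg.2 (hgS'' y h.right_mem)
  have C2' := sub_nonneg.2 (hgS'' y' h'.right_mem)
  have e1 : F.l y - F.l x = 0 := by rw [hl, sub_self]
  have e2 : F.w y - F.w x = 1 := by rw [hw]; ring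
  rw [A2] at A2'
  rw [A3] at A3'
  rw [B1, e1, e2] at B1'
  rw [B3] at B3'
  rw [C1, e1, e2] at C1'
  rw [C2] at C2'
  rw [← hgy, sub_self, e1, e2] at A1
  rw [← hgy', sub_self] at B2
  rw [← hgy'', sub_self] at C3
  have β0 : g F.e = 0 := by linarith
  rw [β0, mul_zero, add_zero] at A2' A3'
  rcases exists_ray_of_support (fun h1 => hg (hcoord g h1 β0)) A2' A3'
    (fun h1 => hg' (hcoord g' h1.1 h1.2)) B2.symm (by linarith) B3'
    (fun h1 => hg'' (hcoord g'' h1.1 h1.2)) C3.symm (by linarith) C2'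
    (fun hc => h'.ne (F.ext_coords (sub_eq_zero.1 hc.1).symm (sub_eq_zero.1 hc.2).symm))
    (fun hc => h''.ne (F.ext_coords (sub_eq_zero.1 hc.1).symm (sub_eq_zero.1 hc.2).symm))
    with h1 | h1 | ⟨t, ht, h1, h2⟩
  · exact Or.inl (h.eq_of_ray h' h1.2 (by rw [e1, h1.1, mul_zero]) (by rw [e2, mul_one]))
  · exact Or.inr (Or.inl (h.eq_of_ray h'' h1.2 (by rw [e1, h1.1, mul_zero])
      (by rw [e2, mul_one])))
  · exact Or.inr (Or.inr (h'.eq_of_ray h'' ht h1 h2))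

end HullEdge

section

variable {n : ℕ} {v : Polygon Plane n} {S : Finset Plane}

lemma IsSimple.hullEdge (hv : IsSimple v) (hS : Set.range v.vertices = (S : Set Plane)) {i : Fin n}
    (h1 : ¬ IsInner S (v i)) (h2 : ¬ IsInner S (v (finRotate n i))) :
    HullEdge S (v i) (v (finRotate n i)) where
  left_mem := vertex_mem_of_range hS i
  right_mem := vertex_mem_of_range hS _
  ne h := finRotate_ne hv.three_le i (hv.apply_inj h).symm
  support := exists_support_of_edge hv hS h1 h2
  gap s hs hseg := by
    obtain ⟨j, rfl⟩ := exists_vertex_of_range hS hs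
    rcases hv.eq_of_vertex_mem hseg with rfl | rfl
    exacts [Or.inl rfl, Or.inr rfl]

/-- All polygon edges are hull edges. Conversely, the two polygon edges at a vertex already exhaust
the at most two hull edges there, so the boundary depends on `S` alone. -/
lemma IsSimple.mem_boundary_iff (hv : IsSimple v) (hS : Set.range v.vertices = (S : Set Plane))
    (h : ∀ s ∈ S, ¬ IsInner S s) (z : Plane) :
    z ∈ v.boundary ℝ ↔ ∃ x y, HullEdge S x y ∧ z ∈ segment ℝ x y := by
  have hedge := fun i => hv.hullEdge hS (h _ (vertex_mem_of_range hS i))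
    (h _ (vertex_mem_of_range hS (finRotate n i)))
  rw [mem_boundary]
  constructor
  · rintro ⟨i, hz⟩
    exact ⟨_, _, hedge i, hz⟩
  · rintro ⟨x, y, hxy, hz⟩
    obtain ⟨j, rfl⟩ := exists_vertex_of_range hS hxy.left_mem
    obtain ⟨i, rfl⟩ := (finRotate n).surjective j
    rcases hxy.eq_or_eq (hedge (finRotate n i)) (hedge i).symm with rfl | rfl | h3
    · exact ⟨_, hz⟩
    · exact ⟨i, by rwa [segment_symm]⟩
    · exact absurd (hv.apply_inj h3) (finRotate_finRotate_ne hv.three_le i)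

theorem encard_le_one_of_no_inner (h : ∀ s ∈ S, ¬ IsInner S s) :
    (simplePolygons S).encard ≤ 1 := by
  rw [Set.encard_le_one_iff]
  rintro P P' ⟨n, v, hv, hS, rfl⟩ ⟨n', v', hv', hS', rfl⟩
  refine region_congr (Set.ext fun z => ?_)
  rw [hv.mem_boundary_iff hS h, hv'.mem_boundary_iff hS' h]

end

/-! ### Point sets with exactly one inner point -/

lemma IsInner.lt {S : Finset Plane} {p x : Plane} (hp : IsInner S p) {g : Plane →ₗ[ℝ] ℝ}
    (hg : g ≠ 0) (h : ∀ s ∈ S, g x ≤ g s) : g x < g p := by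
  obtain ⟨t, ht, hlt⟩ := hp g hg
  exact (h t ht).trans_lt hlt

/-- A frame in which a hull edge passes above an inner point. -/
lemma HullEdge.exists_frame {S : Finset Plane} {x y p : Plane} (h : HullEdge S x y)
    (hpS : p ∈ S) (hp : IsInner S p) : ∃ G : Frame, Set.InjOn G.l S ∧ ∃ m ∈ segment ℝ x y,
      G.l m = G.l p ∧ G.w p < G.w m ∧
      ∀ z ∈ convexHull ℝ (S : Set Plane), G.l z = G.l p → G.w z ≤ G.w m := by
  obtain ⟨g, hg, hgxy, hgS⟩ := h.support
  have hgp := hp.lt hg hgS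
  -- Taking the direction from `p` to the midpoint as vertical puts `p` strictly between the levels
  -- of `x` and `y`. This survives the small tilt that makes levels injective.
  set m₀ : Plane := (1 / 2 : ℝ) • x + (1 / 2 : ℝ) • y with hm₀
  have hgm : g m₀ = g x := by
    rw [hm₀, map_add, map_smul, map_smul, ← hgxy, smul_eq_mul]
    ring
  obtain ⟨F, hl, hw⟩ := UniversalGuards.exists_frame p m₀ fun he => by
    rw [he, hgm] at hgp
    exact lt_irrefl _ hgp
  have hlm : F.l m₀ = (F.l x + F.l y) / 2 := by
    simp only [hm₀, map_add, map_smul, smul_eq_mul]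
    ring
  have hwm : F.w m₀ = (F.w x + F.w y) / 2 := by
    simp only [hm₀, map_add, map_smul, smul_eq_mul]
    ring
  have hge : g F.e < 0 := by
    have := F.apply_sub g p m₀
    rw [hl, hw, sub_self] at this
    linarith
  have hne : F.l x ≠ F.l y := fun he => h.ne <| F.ext_coords he <| by
    have := F.apply_sub g x y
    rw [he, hgxy, sub_self, sub_self, zero_mul, zero_add] at this
    have := (mul_eq_zero.1 this.symm).resolve_right hge.ne
    linarith
  obtain ⟨δ, -, hδ, -⟩ := F.exists_smallTilt S
  have key : ∀ x y, x ∈ S → y ∈ S → g x = g y → (∀ s ∈ S, g x ≤ g s) → g x < g p →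
      F.l m₀ = (F.l x + F.l y) / 2 → F.w m₀ = (F.w x + F.w y) / 2 → F.l x < F.l y →
      ∃ m ∈ segment ℝ x y, (F.tilt δ).l m = (F.tilt δ).l p ∧ F.w p < F.w m ∧
      ∀ z ∈ convexHull ℝ (S : Set Plane), (F.tilt δ).l z = (F.tilt δ).l p → F.w z ≤ F.w m := by
    intro x y hx hy hgxy hgS hgp hlm hwm hxy
    have h1 := hδ.2 x hx p hpS (by linarith)
    have h2 := hδ.2 p hpS y hy (by linarith)
    obtain ⟨m, hm, hml, hms⟩ := (F.tilt δ).exists_mem_segment_level (h1.trans h2) h1.le h2.le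
    have hside : F.side x y p < 0 := by
      have e1 : F.l p = (F.l x + F.l y) / 2 := by linarith
      have e2 : F.w p = (F.w x + F.w y) / 2 - 1 := by linarith
      simp only [Frame.side, e1, e2]
      nlinarith
    have hwpm : F.w p < F.w m := by
      rw [F.tilt_side, F.tilt_w, F.tilt_w] at hms
      have := sub_pos.2 (h1.trans h2)
      by_contra hle
      nlinarith
    have hgm : g m = g x := by
      obtain ⟨α, β, -, -, hαβ, rfl⟩ := hm
      rw [map_add, map_smul, map_smul, ← hgxy, smul_eq_mul, smul_eq_mul, ← add_mul, hαβ, one_mul]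
    have hge : g (F.tilt δ).e < 0 := by
      have := (F.tilt δ).apply_sub g p m
      rw [hml, sub_self, zero_mul, zero_add, F.tilt_w, F.tilt_w] at this
      by_contra hle
      nlinarith
    refine ⟨m, hm, hml, hwpm, fun z hz hzl => ?_⟩
    have h3 := le_of_mem_convexHull g hgS hz
    have := (F.tilt δ).apply_sub g m z
    rw [hml, hzl, sub_self, zero_mul, zero_add, F.tilt_w, F.tilt_w] at this
    by_contra hle
    nlinarith
  refine ⟨F.tilt δ, hδ.injOn, ?_⟩
  rcases hne.lt_or_gt with hlt | hlt
  · exact key x y h.left_mem h.right_mem hgxy hgS hgp hlm hwm hlt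
  · rw [segment_symm]
    exact key y x h.right_mem h.left_mem hgxy.symm (hgxy ▸ hgS) (hgxy ▸ hgp) (by linarith)
      (by linarith) hlt

namespace Frame

variable {F : Frame} {S : Finset Plane}

/-- The sign of a supporting functional on `F.e` decides the alternative. It cannot vanish, because
`S` has points at both smaller and larger levels. -/
lemma isLower_or_isLower_flip {a s c : Plane} (hs : ¬ IsInner S s) (ha : a ∈ S) (hc : c ∈ S)
    (has : F.l a < F.l s) (hsc : F.l s < F.l c) : F.IsLower S s ∨ F.flip.IsLower S s := by
  simp only [IsInner] at hs
  push Not at hs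
  obtain ⟨g, hg, hgS⟩ := hs
  have hsub := fun t ht => (F.apply_sub g s t) ▸ sub_nonneg.2 (hgS t ht)
  rcases lt_trichotomy (g F.e) 0 with h | h | h
  · right
    refine ⟨g F.f / g F.e, fun t ht => ?_⟩
    have := hsub t ht
    rw [flip_l, flip_w, flip_w, div_mul_eq_mul_div, div_le_iff_of_neg h]
    linarith
  · have h1 := hsub a ha
    have h2 := hsub c hc
    rw [h] at h1 h2
    have h3 : g F.f = 0 := by nlinarith
    refine absurd ?_ hg
    ext z
    have := F.apply_sub g 0 z
    simpa [h, h3] using this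
  · left
    refine ⟨-(g F.f) / g F.e, fun t ht => ?_⟩
    have := hsub t ht
    rw [div_mul_eq_mul_div, div_le_iff₀ h]
    linarith

/-- Supporting lines from below and above at an intermediate level must coincide, which puts `S` on
one line and leaves no inner point. -/
lemma not_isLower_flip {a s c p : Plane} (hp : IsInner S p) (hpS : p ∈ S) (ha : a ∈ S)
    (hc : c ∈ S) (has : F.l a < F.l s) (hsc : F.l s < F.l c) (h : F.IsLower S s) :
    ¬ F.flip.IsLower S s := by
  rintro ⟨β, hβ⟩
  obtain ⟨α, hα⟩ := h
  have h0 : α + β = 0 := by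
    have h1 := hα a ha
    have h2 := hα c hc
    have h3 := hβ a ha
    have h4 := hβ c hc
    simp only [flip_l, flip_w] at h3 h4
    nlinarith
  obtain rfl : β = -α := by linarith
  have heq : ∀ t ∈ S, F.w t - α * F.l t = F.w s - α * F.l s := fun t ht => by
    have h1 := hα t ht
    have h2 := hβ t ht
    simp only [flip_l, flip_w] at h2
    linarith
  obtain ⟨t, ht, hlt⟩ := hp (F.w - α • F.l) fun h0 => by
    have := congrArg (fun g => g F.e) h0
    simp [F.l_e, F.w_e] at this
  simp only [LinearMap.sub_apply, LinearMap.smul_apply, smul_eq_mul, heq t ht, heq p hpS] at hlt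
  exact lt_irrefl _ hlt

end Frame

namespace BiChain

variable {F : Frame} {S : Finset Plane} {a c p : Plane}

lemma eq_or_eq_or_lt {U : Set Plane} (hB : BiChain F S U a c) {s : Plane} (hs : s ∈ S) :
    s = a ∨ s = c ∨ (F.l a < F.l s ∧ F.l s < F.l c) := by
  by_cases h1 : s = a
  · exact Or.inl h1
  by_cases h2 : s = c
  · exact Or.inr (Or.inl h2)
  exact Or.inr (Or.inr ⟨lt_of_le_of_ne (hB.a_min s hs) fun h => h1 (hB.inj hs hB.ha h.symm),
    lt_of_le_of_ne (hB.c_max s hs) fun h => h2 (hB.inj hs hB.hc h)⟩)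

/-- Upper points with respect to the frame belong to the upper chain. -/
lemma mem_upper (hB : BiChain F S (F.nonLower S) a c) (hp : IsInner S p) (hpS : p ∈ S) {s : Plane}
    (hs : s ∈ S) (h : F.flip.IsLower S s) : s ∈ F.nonLower S ∪ {a, c} := by
  rcases hB.eq_or_eq_or_lt hs with rfl | rfl | ⟨h1, h2⟩
  · simp
  · simp
  · exact Or.inl ⟨hs, fun hl => Frame.not_isLower_flip hp hpS hB.ha hB.hc h1 h2 hl h⟩

lemma isLower_flip (hB : BiChain F S (F.nonLower S) a c) {s : Plane} (hs : ¬ IsInner S s)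
    (h : s ∈ F.nonLower S ∪ {a, c}) : F.flip.IsLower S s := by
  rcases h with h | rfl | rfl
  · exact (Frame.isLower_or_isLower_flip hs hB.ha hB.hc (hB.a_lt h) (hB.lt_c h)).resolve_left h.2
  · exact Frame.isLower_of_min fun s hs hne => lt_of_le_of_ne (hB.a_min s hs) fun h =>
      hne (hB.inj hs hB.ha h.symm)
  · exact Frame.isLower_of_max fun s hs hne => lt_of_le_of_ne (hB.c_max s hs) fun h =>
      hne (hB.inj hs hB.hc h)

/-- Away from `p`, an upper edge joins consecutive points of the lower hull in the flipped frame. -/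
lemma side_nonpos (hB : BiChain F S (F.nonLower S) a c) (hp : IsInner S p) (hpS : p ∈ S)
    (hone : ∀ s ∈ S, s ≠ p → ¬ IsInner S s) {x y : Plane}
    (hxy : F.Consec (F.nonLower S ∪ {a, c}) x y) (hx : x ≠ p) (hy : y ≠ p) :
    ∀ s ∈ S, F.side x y s ≤ 0 := by
  have hxS := hB.upper_subset hxy.left_mem
  have hyS := hB.upper_subset hxy.right_mem
  have hc : F.flip.Consec (S \ F.flip.nonLower S) x y :=
    { left_mem := Frame.mem_diff_nonLower.2
        ⟨hxS, hB.isLower_flip (hone x hxS hx) hxy.left_mem⟩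
      right_mem := Frame.mem_diff_nonLower.2
        ⟨hyS, hB.isLower_flip (hone y hyS hy) hxy.right_mem⟩
      lt := hxy.lt
      gap := fun z hz hlt => by
        obtain ⟨hzS, hzl⟩ := Frame.mem_diff_nonLower.1 hz
        exact hxy.gap z (hB.mem_upper hp hpS hzS hzl) hlt }
  intro s hs
  have := hc.side_nonneg s hs
  rw [Frame.flip_side] at this
  linarith

end BiChain

/-- A hull edge that does not pass above the inner point is contained in the region. -/
lemma IsHullRegion.segment_subset {F : Frame} {S : Finset Plane} {P : Set Plane} {p x y : Plane}
    (hP : IsHullRegion F S P) (hp : IsInner S p) (hpS : p ∈ S)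
    (hone : ∀ s ∈ S, s ≠ p → ¬ IsInner S s) (hxy : HullEdge S x y)
    (hno : ∀ z ∈ segment ℝ x y, F.l z = F.l p → F.w z ≤ F.w p) : segment ℝ x y ⊆ P := by
  obtain ⟨a, c, hB, hP⟩ := hP
  wlog hlt : F.l x < F.l y generalizing x y
  · rw [segment_symm]
    refine this hxy.symm (by rwa [segment_symm]) (lt_of_le_of_ne (not_lt.1 hlt) fun h => ?_)
    exact hxy.ne (hB.inj hxy.left_mem hxy.right_mem h.symm)
  obtain ⟨g, hg, hgxy, hgS⟩ := hxy.support
  have hsub := fun t ht => (F.apply_sub g x t) ▸ sub_nonneg.2 (hgS t ht)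
  have hyx := F.apply_sub g x y
  rw [← hgxy, sub_self] at hyx
  have hd := sub_pos.2 hlt
  have hside : ∀ t, F.side x y t * g F.e =
      (F.l y - F.l x) * ((F.l t - F.l x) * g F.f + (F.w t - F.w x) * g F.e) := fun t => by
    simp only [Frame.side]
    linear_combination (F.l t - F.l x) * hyx
  have hside' : ∀ t ∈ S, 0 ≤ F.side x y t * g F.e := fun t ht => by
    rw [hside]
    exact mul_nonneg hd.le (hsub t ht)
  have hgap : ∀ z ∈ S, F.l x < F.l z → F.l z < F.l y → F.side x y z ≠ 0 := by
    intro z hz h1 h2 h3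
    rcases hxy.gap z hz ((F.mem_segment_iff hlt).2 ⟨h1.le, h2.le, h3⟩) with rfl | rfl
    exacts [lt_irrefl _ h1, lt_irrefl _ h2]
  -- The sign tells whether the supporting line bounds `S` from above or from below. In the upper
  -- case only `p` could separate the endpoints in the chain, and `hno` excludes this.
  rcases lt_trichotomy (g F.e) 0 with h | h | h
  · have hup : ∀ t ∈ S, 0 ≤ F.flip.side x y t := fun t ht => by
      have := hside' t ht
      rw [Frame.flip_side]
      by_contra hlt
      nlinarith
    have hlt' : F.flip.l x < F.flip.l y := hlt
    refine hP.up x y ⟨hB.mem_upper hp hpS hxy.left_mem (Frame.isLower_of_side hlt' hup (by simp)),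
      hB.mem_upper hp hpS hxy.right_mem (Frame.isLower_of_side hlt' hup (by simp)), hlt, ?_⟩
    intro z hz hxz
    by_contra hzy
    have hzS := hB.upper_subset hz
    have hz0 := hgap z hzS hxz (not_le.1 hzy)
    by_cases hzp : z = p
    · subst hzp
      obtain ⟨z₀, h1, h2, h3⟩ := F.exists_mem_segment_level hlt hxz.le (not_le.1 hzy).le
      have h4 := hno z₀ h1 h2
      have h5 := hup z hzS
      rw [Frame.flip_side, h3] at h5
      rw [h3] at hz0
      exact hz0 (le_antisymm (by linarith) (mul_nonneg hd.le (sub_nonneg.2 h4)))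
    · have h1 := Frame.side_nonpos_of_isLower (F := F.flip) hxy.left_mem hxy.right_mem
        (hB.isLower_flip (hone z hzS hzp) hz) hxz (not_le.1 hzy)
      have h2 := hup z hzS
      rw [Frame.flip_side] at h1 h2
      exact hz0 (by linarith)
  · have h1 : g F.f = 0 := by
      rw [h, mul_zero, add_zero] at hyx
      exact (mul_eq_zero.1 hyx.symm).resolve_left hd.ne'
    refine absurd ?_ hg
    ext z
    have := F.apply_sub g 0 z
    simpa [h, h1] using this
  · have hlow : ∀ t ∈ S, 0 ≤ F.side x y t := fun t ht =>
      nonneg_of_mul_nonneg_left (hside' t ht) h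
    refine hP.low x y ⟨Frame.mem_diff_nonLower.2 ⟨hxy.left_mem,
      Frame.isLower_of_side hlt hlow (by simp)⟩, Frame.mem_diff_nonLower.2 ⟨hxy.right_mem,
      Frame.isLower_of_side hlt hlow (by simp)⟩, hlt, ?_⟩
    intro z hz hxz
    by_contra hzy
    obtain ⟨hzS, hzl⟩ := Frame.mem_diff_nonLower.1 hz
    exact hgap z hzS hxz (not_le.1 hzy) (le_antisymm (Frame.side_nonpos_of_isLower hxy.left_mem
      hxy.right_mem hzl hxz (not_le.1 hzy)) (hlow z hzS))

lemma Frame.side_nonneg_of_mem_convexHull {F : Frame} {S : Finset Plane} {x y z : Plane}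
    (h : ∀ s ∈ S, 0 ≤ F.side x y s) (hz : z ∈ convexHull ℝ (S : Set Plane)) :
    0 ≤ F.side x y z := by
  refine convexHull_min (t := {z | 0 ≤ F.side x y z}) h ?_ hz
  intro p hp q hq α β hα hβ hαβ
  change 0 ≤ F.side x y (α • p + β • q)
  rw [F.side_comb _ _ _ _ hαβ]
  exact add_nonneg (mul_nonneg hα hp) (mul_nonneg hβ hq)

/-- The only inner point sees the whole region. -/
lemma IsHullRegion.isGuardSet {F : Frame} {S : Finset Plane} {P : Set Plane} {p : Plane}
    (hP : IsHullRegion F S P) (hp : IsInner S p) (hpS : p ∈ S)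
    (hone : ∀ s ∈ S, s ≠ p → ¬ IsInner S s) : IsGuardSet {p} P := by
  obtain ⟨a, c, hB, hP⟩ := hP
  simp only [IsGuardSet, Finset.mem_singleton, Set.iUnion_iUnion_eq_left]
  refine Set.Subset.antisymm (fun z hz => hz.1) fun z hz => ⟨hz, fun u hu => ?_⟩
  have hzc : z ∈ convexHull ℝ (S : Set Plane) := by
    obtain ⟨h1, h2⟩ := hP.level z hz
    obtain ⟨x, y, hxy, h3, h4⟩ := hB.exists_low h1 h2
    obtain ⟨x', y', hxy', h3', h4'⟩ := hB.exists_up h1 h2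
    exact hB.mem_convexHull hxy hxy' h3 h4 h3' h4'
      (not_lt.1 fun h => hP.below x y z hxy h3 h4 h hz)
      (not_lt.1 fun h => hP.above x' y' z hxy' h3' h4' h hz)
  have huc : u ∈ convexHull ℝ (S : Set Plane) :=
    (convex_convexHull ℝ _).segment_subset (subset_convexHull ℝ _ hpS) hzc hu
  have h1 : F.l a ≤ F.l u := le_of_mem_convexHull F.l hB.a_min huc
  have h2 : F.l u ≤ F.l c := by
    have := le_of_mem_convexHull (-F.l) (b := -F.l c)
      (fun s hs => neg_le_neg (hB.c_max s hs)) huc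
    simpa using this
  obtain ⟨x, y, hxy, h3, h4⟩ := hB.exists_low h1 h2
  obtain ⟨x', y', hxy', h3', h4'⟩ := hB.exists_up h1 h2
  refine hP.between x y x' y' u hxy hxy' h3 h4 h3' h4'
    (Frame.side_nonneg_of_mem_convexHull hxy.side_nonneg huc) ?_
  have hsup : ∀ b ∈ F.nonLower S ∪ {a, c}, b ≠ p → ∃ β : ℝ,
      ∀ t ∈ convexHull ℝ (S : Set Plane), F.w t - F.w b ≤ β * (F.l t - F.l b) := by
    intro b hb hbp
    obtain ⟨β, hβ⟩ := hB.isLower_flip (hone b (hB.upper_subset hb) hbp) hb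
    refine ⟨-β, fun t ht => ?_⟩
    have := le_of_mem_convexHull (-F.w - β • F.l) (b := -F.w b - β * F.l b) (fun s hs => by
      have := hβ s hs
      simp only [Frame.flip_l, Frame.flip_w] at this
      simp only [LinearMap.sub_apply, LinearMap.smul_apply, LinearMap.neg_apply, smul_eq_mul]
      linarith) ht
    simp only [LinearMap.sub_apply, LinearMap.smul_apply, LinearMap.neg_apply, smul_eq_mul] at this
    linarith
  have hpc : p ∈ convexHull ℝ (S : Set Plane) := subset_convexHull ℝ _ hpS
  have hd := sub_pos.2 hxy'.lt
  -- Only upper edges at `p` fail to be supporting. For those, the sign of `side` at `u` is that at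
  -- `z`. It follows from `z ∈ P` over the edge, and from the supporting line at the other endpoint
  -- beyond it.
  by_cases hyp : y' = p
  · subst hyp
    obtain ⟨s, t, hs, ht, hst, rfl⟩ := hu
    rw [F.side_comb _ _ _ _ hst, F.side_right, mul_zero, zero_add]
    rcases ht.eq_or_lt with rfl | ht
    · simp
    refine mul_nonpos_of_nonneg_of_nonpos ht.le ?_
    have hlz : F.l z ≤ F.l y' := by
      simp only [map_add, map_smul, smul_eq_mul] at h4'
      obtain rfl : s = 1 - t := by linarith
      nlinarith
    rcases le_or_gt (F.l x') (F.l z) with h | h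
    · exact not_lt.1 fun hlt => hP.above x' y' z hxy' h hlz hlt hz
    · obtain ⟨β, hβ⟩ := hsup x' hxy'.left_mem fun h => hxy'.lt.ne (by rw [h])
      have e1 := mul_le_mul_of_nonneg_left (hβ z hzc) hd.le
      have e2 := mul_le_mul_of_nonneg_left (hβ y' hpc) (sub_pos.2 h).le
      simp only [Frame.side]
      linarith
  by_cases hxp : x' = p
  · subst hxp
    obtain ⟨s, t, hs, ht, hst, rfl⟩ := hu
    rw [F.side_comb _ _ _ _ hst, F.side_left, mul_zero, zero_add]
    rcases ht.eq_or_lt with rfl | ht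
    · simp
    refine mul_nonpos_of_nonneg_of_nonpos ht.le ?_
    have hlz : F.l x' ≤ F.l z := by
      simp only [map_add, map_smul, smul_eq_mul] at h3'
      obtain rfl : s = 1 - t := by linarith
      nlinarith
    rcases le_or_gt (F.l z) (F.l y') with h | h
    · exact not_lt.1 fun hlt => hP.above x' y' z hxy' hlz h hlt hz
    · obtain ⟨β, hβ⟩ := hsup y' hxy'.right_mem hyp
      have e1 := mul_le_mul_of_nonneg_left (hβ z hzc) hd.le
      have e2 := mul_le_mul_of_nonneg_left (hβ x' hpc) (sub_pos.2 h).le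
      simp only [Frame.side]
      linarith
  · have := Frame.side_nonneg_of_mem_convexHull (F := F.flip) (x := x') (y := y')
      (fun s hs => by
        rw [Frame.flip_side]
        have := hB.side_nonpos hp hpS hone hxy' hxp hyp s hs
        linarith) huc
    rw [Frame.flip_side] at this
    linarith

/-! ### Many polygons around a single inner point. -/

section

variable {n : ℕ} {v : Polygon Plane n} {S : Finset Plane} {p : Plane}

lemma IsSimple.card_eq (hv : IsSimple v) (hS : Set.range v.vertices = (S : Set Plane)) :
    n = S.card := by
  have h := Set.ncard_coe_finset S
  rw [← hS, Set.ncard_range_of_injective hv.injective] at h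
  simpa using h

/-- For each edge away from the inner point there is a hull region that misses part of this edge
but contains all others. -/
lemma IsSimple.exists_hullRegion (hv : IsSimple v) (hS : Set.range v.vertices = (S : Set Plane))
    (hp : IsInner S p) (hpS : p ∈ S) (hone : ∀ s ∈ S, s ≠ p → ¬ IsInner S s) {i : Fin n}
    (hi : v i ≠ p ∧ v (finRotate n i) ≠ p) : ∃ F P, IsHullRegion F S P ∧
      ¬ segment ℝ (v i) (v (finRotate n i)) ⊆ P ∧
      ∀ j, v j ≠ p ∧ v (finRotate n j) ≠ p → j ≠ i →
        segment ℝ (v j) (v (finRotate n j)) ⊆ P := by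
  have hedge : ∀ j, v j ≠ p ∧ v (finRotate n j) ≠ p → HullEdge S (v j) (v (finRotate n j)) :=
    fun j hj => hv.hullEdge hS (hone _ (vertex_mem_of_range hS _) hj.1)
      (hone _ (vertex_mem_of_range hS _) hj.2)
  obtain ⟨G, hinj, m, hm, hml, hmw, hmax⟩ := (hedge i hi).exists_frame hpS hp
  obtain ⟨P, hP⟩ := exists_isHullRegion hinj hpS hp
  refine ⟨G, P, hP, fun hsub => hP.notMem_above hpS hp hml hmw (hsub hm), fun j hj hji => ?_⟩
  refine hP.segment_subset hp hpS hone (hedge j hj) fun z hz hzl => ?_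
  by_contra! hlt
  have hull : ∀ k, segment ℝ (v k) (v (finRotate n k)) ⊆ convexHull ℝ (S : Set Plane) := fun k =>
    (convex_convexHull ℝ _).segment_subset (subset_convexHull ℝ _ (vertex_mem_of_range hS _))
      (subset_convexHull ℝ _ (vertex_mem_of_range hS _))
  have h1 := hmax z (hull j hz) hzl
  -- The line of edge `j` supports `S` from above at this level, so both edges pass through the top
  -- of the hull over `p`. They would meet in a polygon vertex at the level of `p`, which is `p`
  -- itself by injectivity.
  have h2 : G.w m ≤ G.w z := by
    obtain ⟨g, hg, hgj, hgS⟩ := (hedge j hj).support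
    have hgz : g z = g (v j) := by
      obtain ⟨α, β, -, -, hαβ, rfl⟩ := hz
      rw [map_add, map_smul, map_smul, ← hgj, smul_eq_mul, smul_eq_mul, ← add_mul, hαβ, one_mul]
    have h3 := hp.lt hg hgS
    have h4 := le_of_mem_convexHull g hgS (hull i hm)
    have h5 := G.apply_sub g z p
    have h6 := G.apply_sub g z m
    rw [hzl, sub_self, zero_mul, zero_add, hgz] at h5
    rw [hzl, hml, sub_self, zero_mul, zero_add, hgz] at h6
    by_contra hle
    nlinarith
  obtain rfl : z = m := G.ext_coords (hzl.trans hml.symm) (le_antisymm h1 h2)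
  rcases hv.eq_of_mem_edges hji hz hm with ⟨-, h3⟩ | ⟨-, h3⟩
  · exact hj.1 (hinj (vertex_mem_of_range hS _) hpS (h3 ▸ hml))
  · exact hi.1 (hinj (vertex_mem_of_range hS _) hpS (h3 ▸ hml))

/-- The regions whose lower chain is the lower hull in some frame. -/
def hullRegions (S : Finset Plane) : Set (Set Plane) := {P | ∃ F, IsHullRegion F S P}

lemma hullRegions_subset : hullRegions S ⊆ simplePolygons S := fun _ ⟨_, h⟩ => h.mem

/-- All but two edges of the polygon avoid `p`. The hull regions assigned to them are distinct,
since each misses part of its own edge and contains the others, and none equals `P`, which contains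
all its edges. -/
lemma exists_other_hullRegions (hp : IsInner S p) (hpS : p ∈ S)
    (hone : ∀ s ∈ S, s ≠ p → ¬ IsInner S s) {P : Set Plane} (hP : P ∈ simplePolygons S) :
    ∃ T ⊆ hullRegions S, P ∉ T ∧ ((S.card - 2 : ℕ) : ℕ∞) ≤ T.encard := by
  classical
  obtain ⟨n, v, hv, hS, rfl⟩ := hP
  obtain ⟨k, hk⟩ := exists_vertex_of_range hS hpS
  set I : Finset (Fin n) := Finset.univ.filter fun i => v i ≠ p ∧ v (finRotate n i) ≠ p with hI
  have hcard : S.card - 2 ≤ I.card := by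
    have h1 : (Finset.univ : Finset (Fin n)) ⊆ I ∪ {k, (finRotate n).symm k} := by
      intro i _
      simp only [hI, Finset.mem_union, Finset.mem_filter, Finset.mem_univ, true_and,
        Finset.mem_insert, Finset.mem_singleton]
      by_cases h1 : v i = p
      · exact Or.inr (Or.inl (hv.apply_inj (h1.trans hk.symm)))
      by_cases h2 : v (finRotate n i) = p
      · right; right
        rw [← hv.apply_inj (h2.trans hk.symm), Equiv.symm_apply_apply]
      · exact Or.inl ⟨h1, h2⟩
    have h2 := (Finset.card_le_card h1).trans (Finset.card_union_le _ _)
    have h3 : ({k, (finRotate n).symm k} : Finset (Fin n)).card ≤ 2 := Finset.card_le_two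
    rw [Finset.card_univ, Fintype.card_fin] at h2
    have := hv.card_eq hS
    omega
  have hex : ∀ i : Fin n, ∃ P, i ∈ I → P ∈ hullRegions S ∧
      ¬ segment ℝ (v i) (v (finRotate n i)) ⊆ P ∧
      ∀ j ∈ I, j ≠ i → segment ℝ (v j) (v (finRotate n j)) ⊆ P := by
    intro i
    by_cases hi : i ∈ I
    · obtain ⟨F, P, hP, h1, h2⟩ := hv.exists_hullRegion hS hp hpS hone (by simpa [hI] using hi)
      exact ⟨P, fun _ => ⟨⟨F, hP⟩, h1, fun j hj => h2 j (by simpa [hI] using hj)⟩⟩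
    · exact ⟨∅, fun h => absurd h hi⟩
  choose f hf using hex
  refine ⟨f '' I, ?_, ?_, ?_⟩
  · rintro _ ⟨i, hi, rfl⟩
    exact (hf i hi).1
  · rintro ⟨i, hi, heq⟩
    exact (hf i hi).2.1 (heq ▸ segment_subset_region v i)
  · rw [Set.InjOn.encard_image, Set.encard_coe_eq_coe_finsetCard]
    · exact_mod_cast hcard
    · intro i hi j hj hij
      by_contra hne
      exact (hf i hi).2.1 (hij ▸ (hf j hj).2.2 i hi hne)

/-- With a single inner point there are many hull regions. -/
theorem le_encard_hullRegions (hp : IsInner S p) (hpS : p ∈ S)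
    (hone : ∀ s ∈ S, s ≠ p → ¬ IsInner S s) :
    ((S.card - 2 : ℕ) : ℕ∞) + 1 ≤ (hullRegions S).encard := by
  obtain ⟨F, hF⟩ : ∃ F : Frame, Set.InjOn F.l S := by
    obtain ⟨δ, -, hδ, -⟩ := (Frame.ofDirection !₂[1, 0] fun h => by
      simpa using congrArg (fun z : Plane => z 0) h).exists_smallTilt S
    exact ⟨_, hδ.injOn⟩
  obtain ⟨P, hP⟩ := exists_isHullRegion hF hpS hp
  obtain ⟨T, hT, hPT, hcard⟩ := exists_other_hullRegions hp hpS hone hP.mem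
  calc ((S.card - 2 : ℕ) : ℕ∞) + 1 ≤ T.encard + 1 := by gcongr
    _ = (insert P T).encard := (Set.encard_insert_of_notMem hPT).symm
    _ ≤ _ := Set.encard_le_encard (Set.insert_subset (show P ∈ hullRegions S from ⟨F, hP⟩) hT)

end

/-! ### Point sets with at most four points -/

section

variable {S : Finset Plane}

lemma IsSimple.mem_boundary_three {v : Polygon Plane 3} (hv : IsSimple v)
    (hS : Set.range v.vertices = (S : Set Plane)) (z : Plane) :
    z ∈ v.boundary ℝ ↔ ∃ x ∈ S, ∃ y ∈ S, x ≠ y ∧ z ∈ segment ℝ x y := by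
  rw [mem_boundary]
  constructor
  · rintro ⟨i, hz⟩
    exact ⟨_, vertex_mem_of_range hS i, _, vertex_mem_of_range hS _,
      fun h => finRotate_ne hv.three_le i (hv.apply_inj h).symm, hz⟩
  · rintro ⟨x, hx, y, hy, hxy, hz⟩
    obtain ⟨i, rfl⟩ := exists_vertex_of_range hS hx
    obtain ⟨j, rfl⟩ := exists_vertex_of_range hS hy
    have hij : i ≠ j := fun h => hxy (h ▸ rfl)
    have : ∀ i j : Fin 3, i ≠ j → j = finRotate 3 i ∨ i = finRotate 3 j := by decide
    rcases this i j hij with rfl | rfl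
    · exact ⟨i, hz⟩
    · exact ⟨j, by rwa [segment_symm]⟩

lemma IsSimple.mem_boundary_four {v : Polygon Plane 4} (hv : IsSimple v)
    (hS : Set.range v.vertices = (S : Set Plane)) (i : Fin 4) (z : Plane) :
    z ∈ v.boundary ℝ ↔ ∃ x, (x = v i ∨ x = v (i + 2)) ∧
      ∃ y ∈ S, y ≠ v i ∧ y ≠ v (i + 2) ∧ z ∈ segment ℝ x y := by
  rw [mem_boundary]
  constructor
  · rintro ⟨j, hz⟩
    have : ∀ i j : Fin 4, ((j = i ∨ j = i + 2) ∧ finRotate 4 j ≠ i ∧ finRotate 4 j ≠ i + 2) ∨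
        ((finRotate 4 j = i ∨ finRotate 4 j = i + 2) ∧ j ≠ i ∧ j ≠ i + 2) := by decide
    rcases this i j with ⟨h1, h2, h3⟩ | ⟨h1, h2, h3⟩
    · exact ⟨v j, h1.imp (congrArg v) (congrArg v), _, vertex_mem_of_range hS _,
        fun h => h2 (hv.apply_inj h), fun h => h3 (hv.apply_inj h), hz⟩
    · exact ⟨v (finRotate 4 j), h1.imp (congrArg v) (congrArg v), _, vertex_mem_of_range hS j,
        fun h => h2 (hv.apply_inj h), fun h => h3 (hv.apply_inj h), by rwa [segment_symm]⟩
  · rintro ⟨x, hx, y, hy, h1, h2, hz⟩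
    obtain ⟨j, rfl⟩ := exists_vertex_of_range hS hy
    have h3 : j ≠ i := fun h => h1 (h ▸ rfl)
    have h4 : j ≠ i + 2 := fun h => h2 (h ▸ rfl)
    obtain ⟨k, rfl, hk⟩ : ∃ k, v k = x ∧ (k = i ∨ k = i + 2) := by
      rcases hx with rfl | rfl
      exacts [⟨_, rfl, Or.inl rfl⟩, ⟨_, rfl, Or.inr rfl⟩]
    have : ∀ i j k : Fin 4, j ≠ i → j ≠ i + 2 → (k = i ∨ k = i + 2) →
        j = finRotate 4 k ∨ k = finRotate 4 j := by decide
    rcases this i j k h3 h4 hk with rfl | rfl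
    · exact ⟨k, hz⟩
    · exact ⟨j, by rwa [segment_symm]⟩

/-- A quadrilateral is determined by the vertex opposite to a fixed point `p`. -/
lemma encard_le_three_of_card_eq_four (h : S.card = 4) : (simplePolygons S).encard ≤ 3 := by
  classical
  obtain ⟨p, hp⟩ : S.Nonempty := Finset.card_pos.1 (by omega)
  have hex : ∀ P : Set Plane, ∃ q, P ∈ simplePolygons S → q ∈ S.erase p ∧
      ∃ (v : Polygon Plane 4) (i : Fin 4), IsSimple v ∧ Set.range v.vertices = (S : Set Plane) ∧
        P = region v ∧ v i = p ∧ v (i + 2) = q := by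
    intro P
    by_cases hP : P ∈ simplePolygons S
    · obtain ⟨n, v, hv, hS, rfl⟩ := hP
      obtain rfl : n = 4 := (hv.card_eq hS).trans h
      obtain ⟨i, rfl⟩ := exists_vertex_of_range hS hp
      refine ⟨v (i + 2), fun _ => ⟨Finset.mem_erase.2 ⟨fun he => ?_, vertex_mem_of_range hS _⟩,
        v, i, hv, hS, rfl, rfl, rfl⟩⟩
      have : ∀ i : Fin 4, i + 2 ≠ i := by decide
      exact this i (hv.apply_inj he)
    · exact ⟨p, fun h => absurd h hP⟩
  choose f hf using hex
  have hinj : Set.InjOn f (simplePolygons S) := by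
    intro P hP P' hP' heq
    obtain ⟨-, v, i, hv, hS, rfl, h1, h2⟩ := hf P hP
    obtain ⟨-, v', i', hv', hS', rfl, h1', h2'⟩ := hf P' hP'
    refine region_congr (Set.ext fun z => ?_)
    rw [hv.mem_boundary_four hS i, hv'.mem_boundary_four hS' i', h1, h2, h1', h2', heq]
  rw [← hinj.encard_image]
  calc (f '' simplePolygons S).encard ≤ ((S.erase p : Finset Plane) : Set Plane).encard :=
        Set.encard_le_encard (by rintro _ ⟨P, hP, rfl⟩; exact (hf P hP).1)
    _ ≤ 3 := by
        rw [Set.encard_coe_eq_coe_finsetCard, Finset.card_erase_of_mem hp, h]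
        norm_num

theorem encard_le_three (h : S.card ≤ 4) : (simplePolygons S).encard ≤ 3 := by
  rcases h.eq_or_lt with h4 | h4
  · exact encard_le_three_of_card_eq_four h4
  refine le_trans (Set.encard_le_one_iff.2 ?_) (by norm_num)
  rintro P P' ⟨n, v, hv, hS, rfl⟩ ⟨n', v', hv', hS', rfl⟩
  have h1 := hv.card_eq hS
  have h2 := hv'.card_eq hS'
  have h3 := hv.three_le
  obtain rfl : n = 3 := by omega
  obtain rfl : n' = 3 := by omega
  refine region_congr (Set.ext fun z => ?_)
  rw [hv.mem_boundary_three hS, hv'.mem_boundary_three hS']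

end

/-! ### Comparison of four and five polygons -/

lemma guardNumber_mono {S : Finset Plane} {A B : Set (Set Plane)} (h : A ⊆ B) :
    guardNumber S A ≤ guardNumber S B :=
  biInf_mono fun _ hG => ⟨hG.1, fun P hP => hG.2 P (h hP)⟩

lemma guardNumber_le_kUniversalGuardNumber {S : Finset Plane} {A : Set (Set Plane)} {k : ℕ}
    (hA : A ⊆ simplePolygons S) (hk : A.encard = k) :
    guardNumber S A ≤ kUniversalGuardNumber k S.card :=
  le_iSup₂_of_le S (by simp) <| le_iSup₂_of_le A ⟨hA, hk⟩ le_rfl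

lemma one_le_guardNumber {S : Finset Plane} {A : Set (Set Plane)} {P : Set Plane} (hP : P ∈ A)
    (hA : A ⊆ simplePolygons S) : 1 ≤ guardNumber S A := by
  refine le_iInf₂ fun G hG => ?_
  have hne : G.Nonempty := by
    rw [Finset.nonempty_iff_ne_empty]
    rintro rfl
    have h1 := hG.2 P hP
    obtain ⟨n, v, hv, -, rfl⟩ := hA hP
    have h2 := segment_subset_region v ⟨0, by linarith [hv.three_le]⟩ (left_mem_segment ℝ _ _)
    simp [IsGuardSet] at h1
    rw [← h1] at h2
    exact h2
  exact_mod_cast hne.card_pos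

/-- The supremum could be over an empty family, so a five-point set with at least five polygons is
needed: a large triangle with two points inside. -/
lemma one_le_kUniversalGuardNumber_five : 1 ≤ kUniversalGuardNumber 5 5 := by
  classical
  set S : Finset Plane := ({(0, 10), (-10, -10), (10, -10), (0, 0), (1, 0)} :
    Finset (ℤ × ℤ)).map ⟨pt, pt_injective⟩ with hS
  have hcard : S.card = 5 := by
    rw [hS, Finset.card_map]
    rfl
  have hmem : ∀ q ∈ ({(0, 10), (-10, -10), (10, -10), (0, 0), (1, 0)} : Finset (ℤ × ℤ)),
      (!₂[(q.1 : ℝ), (q.2 : ℝ)] : Plane) ∈ S := fun q hq => Finset.mem_map.2 ⟨q, hq, rfl⟩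
  have hinner : ∀ t : ℝ, 0 ≤ t → t ≤ 1 → IsInner S !₂[t, 0] := by
    intro t h0 h1 g hg
    by_contra! hno
    have hlin : ∀ a b : ℝ, g !₂[a, b] = a * g !₂[1, 0] + b * g !₂[0, 1] := fun a b => by
      rw [← smul_eq_mul, ← smul_eq_mul, ← map_smul, ← map_smul, ← map_add]
      congr 1
      ext i
      fin_cases i <;> simp
    have e1 : g !₂[t, 0] ≤ g !₂[0, 10] := by simpa using hno _ (hmem (0, 10) (by simp))
    have e2 : g !₂[t, 0] ≤ g !₂[-10, -10] := by simpa using hno _ (hmem (-10, -10) (by simp))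
    have e3 : g !₂[t, 0] ≤ g !₂[10, -10] := by simpa using hno _ (hmem (10, -10) (by simp))
    rw [hlin t, hlin 0 10] at e1
    rw [hlin t, hlin (-10)] at e2
    rw [hlin t, hlin 10] at e3
    have z1 : g !₂[1, 0] = 0 := by
      have h1 : g !₂[1, 0] * (2 * t + 10) ≤ 0 := by linarith
      have h2 : 0 ≤ g !₂[1, 0] * (10 - 2 * t) := by linarith
      exact le_antisymm (nonpos_of_mul_nonpos_left h1 (by linarith))
        (nonneg_of_mul_nonneg_left h2 (by linarith))
    have z2 : g !₂[0, 1] = 0 := by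
      rw [z1] at e1 e2
      linarith
    refine hg ?_
    ext z
    have := hlin (z 0) (z 1)
    rw [z1, z2] at this
    have hz : (!₂[z 0, z 1] : Plane) = z := by
      ext i
      fin_cases i <;> simp
    rw [hz] at this
    simpa using this
  have h5 : 5 ≤ (simplePolygons S).encard := by
    refine five_le_of_two_inner (p := !₂[0, 0]) (q := !₂[1, 0])
      (by simpa using hmem (0, 0) (by simp)) (by simpa using hmem (1, 0) (by simp))
      (hinner 0 le_rfl zero_le_one) (hinner 1 zero_le_one le_rfl) fun h => ?_
    simpa using congrArg (fun z : Plane => z 0) h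
  obtain ⟨A, hA, hA5⟩ := Set.exists_subset_encard_eq h5
  obtain ⟨P, hP⟩ : A.Nonempty := by
    rw [← Set.encard_pos, hA5]
    norm_num
  refine (one_le_guardNumber hP hA).trans ?_
  have := guardNumber_le_kUniversalGuardNumber hA (k := 5) (by simpa using hA5)
  rwa [hcard] at this

/-- Only a family that exhausts `simplePolygons S` cannot be enlarged. The counting results then
force five points with a single inner point, which guards everything. -/
theorem kUniversalGuardNumber_four_le_five (n : ℕ) :
    kUniversalGuardNumber 4 n ≤ kUniversalGuardNumber 5 n := by
  refine iSup₂_le fun S hS => iSup₂_le fun A hA => ?_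
  obtain rfl : S.card = n := hS
  obtain ⟨hA, hA4⟩ := hA
  by_cases hex : ∃ P ∈ simplePolygons S, P ∉ A
  · obtain ⟨P, hP, hPA⟩ := hex
    refine (guardNumber_mono (Set.subset_insert P A)).trans
      (guardNumber_le_kUniversalGuardNumber (Set.insert_subset hP hA) ?_)
    rw [Set.encard_insert_of_notMem hPA, hA4]
    norm_num
  obtain rfl : A = simplePolygons S := by
    push Not at hex
    exact hA.antisymm hex
  obtain ⟨p, hpS, hp⟩ : ∃ p ∈ S, IsInner S p := by
    by_contra! hno
    have := encard_le_one_of_no_inner hno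
    rw [hA4] at this
    norm_num at this
  have hone : ∀ s ∈ S, s ≠ p → ¬ IsInner S s := fun s hs hsp hin => by
    have := five_le_of_two_inner hs hpS hin hp hsp
    rw [hA4] at this
    norm_num at this
  have h5 : 4 < S.card := by
    by_contra hle
    have := encard_le_three (not_lt.1 hle)
    rw [hA4] at this
    norm_num at this
  have hhull := le_encard_hullRegions hp hpS hone
  have hle := Set.encard_le_encard (hullRegions_subset (S := S))
  have hcard : S.card = 5 := by
    have := hhull.trans hle
    rw [hA4] at this
    have : S.card - 2 + 1 ≤ 4 := by exact_mod_cast this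
    omega
  -- For five points there are at least `5 - 2 + 1 = 4` hull regions, as many as there are polygons.
  have heq : hullRegions S = simplePolygons S := by
    refine Set.Finite.eq_of_subset_of_encard_le
      ((Set.finite_of_encard_eq_coe hA4).subset hullRegions_subset) hullRegions_subset ?_
    · rw [hA4]
      rw [hcard] at hhull
      exact_mod_cast hhull
  have h1 : guardNumber S (simplePolygons S) ≤ 1 := by
    refine (iInf₂_le {p} ⟨by simpa using hpS, fun P hP => ?_⟩).trans (by simp)
    rw [← heq] at hP
    obtain ⟨F, hF⟩ := hP
    exact hF.isGuardSet hp hpS hone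
  rw [hcard]
  exact h1.trans one_le_kUniversalGuardNumber_five

theorem le_kUniversalGuardNumber_four {k r : ℕ} (hk : 2 ≤ k) (hr : r < 2) :
    ((2 * (k / 2) : ℕ) : ℕ∞) ≤ kUniversalGuardNumber 4 (2 * k + 4 + r) := by
  obtain ⟨A, hA, hA4, hle⟩ := exists_four_zigzags (r := r) hk
  have h := hle.trans (guardNumber_le_kUniversalGuardNumber hA (k := 4) (by simpa using hA4))
  rwa [grid, Finset.card_map, card_gridIndex hr] at h

end UniversalGuards

theorem mainTheorem11 (n : ℕ) :
    UniversalGuards.kUniversalGuardNumber 4 n ≤ UniversalGuards.kUniversalGuardNumber 5 n ∧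
    (((n : ℝ) / 2 - 8 * Real.sqrt (n : ℝ) - 23 : ℝ) : EReal) ≤
      (((UniversalGuards.kUniversalGuardNumber 4 n : ℕ∞) : ℝ≥0∞) : EReal) := by
  refine ⟨UniversalGuards.kUniversalGuardNumber_four_le_five n, ?_⟩
  have hsqrt := Real.sqrt_nonneg (n : ℝ)
  rcases lt_or_ge n 8 with hn | hn
  · have : (n : ℝ) < 8 := by exact_mod_cast hn
    -- For fewer than eight points the claimed bound is negative.
    refine le_trans (EReal.coe_le_coe_iff.2 (show _ ≤ (0 : ℝ) by linarith)) ?_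
    exact EReal.coe_ennreal_nonneg _
  · obtain ⟨k, r, hk, hr, rfl⟩ : ∃ k r, 2 ≤ k ∧ r < 2 ∧ n = 2 * k + 4 + r :=
      ⟨(n - 4) / 2, n % 2, by omega, by omega, by omega⟩
    have h := UniversalGuards.le_kUniversalGuardNumber_four hk hr
    have h1 : (((2 * (k / 2) : ℕ) : ℕ∞) : ℝ≥0∞) ≤
        ((UniversalGuards.kUniversalGuardNumber 4 (2 * k + 4 + r) : ℕ∞) : ℝ≥0∞) :=
      ENat.toENNReal_le.2 h
    refine le_trans ?_ (EReal.coe_ennreal_le_coe_ennreal_iff.2 h1)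
    have h2 : ((((2 * (k / 2) : ℕ) : ℕ∞) : ℝ≥0∞) : EReal) = ((2 * (k / 2) : ℕ) : ℝ) := by
      rw [ENat.toENNReal_coe]
      rw [← ENNReal.ofReal_natCast, EReal.coe_ennreal_ofReal, max_eq_left (Nat.cast_nonneg _)]
    rw [h2, EReal.coe_le_coe_iff]
    -- The loss of 7 comes from four corners, one parity point and an unpaired column of two points.
    have h3 : 2 * k + 4 + r ≤ 2 * (2 * (k / 2)) + 7 := by omega
    have h4 : ((2 * k + 4 + r : ℕ) : ℝ) ≤ 2 * ((2 * (k / 2) : ℕ) : ℝ) + 7 := by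
      exact_mod_cast h3
    linarith
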